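/- All graphs are finite and simple. For an edge $e$ of a graph $G$, the graph $G-e$ is an edge-card of $G$; the edge-deck of $G$ is the multiset of isomorphism types of its edge-cards. The edge-reconstruction number $\mathrm{ern}(G)$ is the least number $m$ for which there are $m$ edges $e_1,\dots,e_m$ of $G$ such that every graph whose edge-deck contains the edge-cards $G-e_1,\dots,G-e_m$ (counted with multiplicity) is isomorphic to $G$. For a vertex $v$ of a tree $T$, the weight of $v$ is the number of vertices in a largest component of $T-v$; the centroid of $T$ is the set of vertices of minimum weight, and $T$ is bicentroidal if its centroid has exactly two vertices. These two vertices are then adjacent; the edge $e$ joining them is the centroidal edge, and the two components of $T-e$ are the centroidal components of $T$. Let $P_k$ be the path on $k$ vertices, and let $S_1$ (respectively $S_2$) be the tree formed by three paths with $1,1,2$ (respectively $1,2,3$) edges starting at a common vertex and otherwise disjoint. A pseudopath is a tree isomorphic to some $P_k$, to $S_1$ or to $S_2$. **Lemma.** Let $T$ be a bicentroidal tree one of whose centroidal components is a path $P_k$ while the other centroidal component is not a pseudopath. Then $\mathrm{ern}(T)=2$. -/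

import Mathlib

universe u

namespace SimpleGraph

/-! ### Edge-reconstruction number -/

/-- The subcollection `{G - e : e ∈ S}` (counted with multiplicity) of the edge-deck of the finite
graph `G` is contained in the edge-deck of `H`: distinct edges `e ∈ S` are assigned distinct edges
`φ e` of `H` with `G - e ≃ H - φ e`. -/
def HasEdgeCards {V W : Type u} (G : SimpleGraph V) (S : Set (Sym2 V)) (H : SimpleGraph W) : Prop :=
  ∃ φ : S → H.edgeSet, Function.Injective φ ∧
    ∀ e : S, Nonempty (G.deleteEdges {(e : Sym2 V)} ≃g H.deleteEdges {(φ e : Sym2 W)})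

/-- The edge-cards `G - e`, `e ∈ S`, determine `G` up to isomorphism among all finite graphs. -/
def IsReconstructibleFromEdges {V : Type u} (G : SimpleGraph V) (S : Set (Sym2 V)) : Prop :=
  ∀ (W : Type u) [Finite W] (H : SimpleGraph W), G.HasEdgeCards S H → Nonempty (G ≃g H)

/-- The edge-reconstruction number of `G`: the least number of edge-cards of `G` which determine
`G` up to isomorphism (`⊤` if even the whole edge-deck does not). -/
noncomputable def ern {V : Type u} (G : SimpleGraph V) : ℕ∞ :=
  ⨅ (S : Set (Sym2 V)) (_ : S ⊆ G.edgeSet) (_ : G.IsReconstructibleFromEdges S), S.encard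

/-! ### Centroid of a tree -/

/-- The weight of `v`: the number of vertices in a largest component of `T - v`
(`0` if `v` is the only vertex). -/
noncomputable def weight {V : Type u} (T : SimpleGraph V) (v : V) : ℕ :=
  ⨆ C : (T.induce ({v}ᶜ : Set V)).ConnectedComponent, C.supp.ncard

/-- The centroid: the set of vertices of minimum weight. -/
def centroid {V : Type u} (T : SimpleGraph V) : Set V :=
  {v | ∀ w, T.weight v ≤ T.weight w}

/-- A tree is bicentroidal if it has exactly two centroidal vertices. -/
def IsBicentroidal {V : Type u} (T : SimpleGraph V) : Prop :=
  T.IsTree ∧ T.centroid.ncard = 2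

/-- `e` is the centroidal edge: the edge joining two (distinct) centroidal vertices. -/
def IsCentroidalEdge {V : Type u} (T : SimpleGraph V) (e : Sym2 V) : Prop :=
  e ∈ T.edgeSet ∧ ∀ v ∈ e, v ∈ T.centroid

/-! ### Pseudopaths -/

/-- The tree `S₁ = S_{1,1,2}`: three paths with `1`, `1`, `2` edges from the vertex `0`. -/
def treeS1 : SimpleGraph (Fin 5) :=
  fromEdgeSet {s(0, 1), s(0, 2), s(0, 3), s(3, 4)}

/-- The tree `S₂ = S_{1,2,3}`: three paths with `1`, `2`, `3` edges from the vertex `0`. -/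
def treeS2 : SimpleGraph (Fin 7) :=
  fromEdgeSet {s(0, 1), s(0, 2), s(2, 3), s(0, 4), s(4, 5), s(5, 6)}

/-- A pseudopath is a graph isomorphic to a path `P_k`, to `S₁` or to `S₂`. -/
def IsPseudopath {V : Type*} (G : SimpleGraph V) : Prop :=
  (∃ k : ℕ, Nonempty (G ≃g pathGraph k)) ∨ Nonempty (G ≃g treeS1) ∨ Nonempty (G ≃g treeS2)

end SimpleGraph

/-! Write `cd` for the centroidal edge, `C` for the path component (containing `c`) and `D` for the
other one. Both ends of `cd` have the same weight, which forces `C` and `D` to have the same number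
`k` of vertices (`IsCut.ncard_eq_ncard_compl`). After this reduction to `ern_eq_two`, only bridges
and the sizes of their sides matter.

One card never suffices: putting the deleted edge back between two nonadjacent vertices of one side
gives a disconnected graph with the same card (`IsTree.two_le_ern`).

For the upper bound, take the cards of two bridges whose sides have different sizes. A graph `H`
with both cards arises from `T` by replacing the first bridge and, up to a bijection `π`, by
replacing the second one. The difference in sizes forces each new edge to join the two pieces again
(`ern_le_two`), so `H` is connected and carries two systems of cuts: those surviving from `T` on the
nose and those transported by `π`. Cut sides do not cross (`IsCut.nested`), so counting leaves few
possible positions of the two systems, differing by at most three vertices. In each position either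
an isomorphism from `T` to `H` is assembled from the pieces, or a local contradiction appears: a
vertex of degree three inside a copy of the path, too many edges across a bridge, or too many
vertices.

The cards depend on how `cd` sits in `T`. If `d` has two neighbours in `D`, a pendant edge at an end
of `C` and a leaf of `D` are used (`ern_le_two_of_two_neighbors`), except when `k = 4` and `c` is
inner in `C`; then `D` is a star and the centroidal edge and a leaf work
(`ern_le_two_of_ncard_eq_four`). If `d` is a leaf of `D`, the two edges at `d` work when `D - d`
still branches or `c` is an end of `C` (`ern_le_two_of_degree_two`); matching up the attachment
points there rests on the absence of pseudosimilar leaves in trees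
(`IsTree.exists_iso_of_addLeaf_iso`). What remains is a spider `D` with `d` as a leg of one vertex.
Shortening a leg of at least three vertices usually changes the spider, so `cd` and the end of that
leg work (`IsSpiderOn.ern_le_two_of_leg`). The exceptions are `S₁` and `S₂`, which are excluded, and
the spider with legs 1, 2, 2, settled by hand. -/

namespace SimpleGraph

/-! ### Bridges and their sides. -/

section Cuts

variable {V : Type*} {G : SimpleGraph V} {A B : Set V} {a b a' b' : V}

/-- `A` is one side of the bridge `ab` of `G`: the edge `ab` is the only edge leaving `A`. -/
structure IsCut (G : SimpleGraph V) (A : Set V) (a b : V) : Prop where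
  left_mem : a ∈ A
  right_notMem : b ∉ A
  adj : G.Adj a b
  unique : ∀ ⦃x y⦄, x ∈ A → y ∉ A → G.Adj x y → x = a ∧ y = b

lemma Preconnected.exists_adj_of_mem_of_notMem (hG : G.Preconnected) {S : Set V} {s t : V}
    (hs : s ∈ S) (ht : t ∉ S) : ∃ x ∈ S, ∃ y ∉ S, G.Adj x y := by
  obtain ⟨p⟩ := hG s t
  obtain ⟨d, hd, h1, h2⟩ := p.exists_boundary_dart S hs ht
  exact ⟨d.fst, h1, d.snd, h2, d.adj⟩

lemma preconnected_of_forall_exists_adj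
    (h : ∀ (S : Set V) (s t : V), s ∈ S → t ∉ S → ∃ x ∈ S, ∃ y ∉ S, G.Adj x y) :
    G.Preconnected := by
  intro s t
  by_contra hst
  obtain ⟨x, hx, y, hy, hxy⟩ := h {v | G.Reachable s v} s t (Reachable.refl s) hst
  exact hy (Reachable.trans hx hxy.reachable)

namespace IsCut

lemma compl (h : IsCut G A a b) : IsCut G Aᶜ b a :=
  ⟨h.right_notMem, fun h' => h' h.left_mem, h.adj.symm, fun _ _ hx hy hxy =>
    (h.unique (not_not.1 hy) hx hxy.symm).symm⟩

/-- A side of a bridge is connected, in boundary-edge form. Connectedness of `G` is applied to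
whichever of `S` and `A \ S` misses `a`: the bridge cannot start there, so the boundary edge stays
in `A`. -/
lemma exists_adj_inside (h : IsCut G A a b) (hG : G.Preconnected) {S : Set V} {s t : V}
    (hSA : S ⊆ A) (hs : s ∈ S) (htA : t ∈ A) (ht : t ∉ S) :
    ∃ x ∈ S, ∃ y ∈ A, y ∉ S ∧ G.Adj x y := by
  by_cases ha : a ∈ S
  · obtain ⟨x, hx, y, hy, hxy⟩ := hG.exists_adj_of_mem_of_notMem (S := A \ S) ⟨htA, ht⟩
      (fun h' => h'.2 hs)
    by_cases hyA : y ∈ A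
    · have : y ∈ S := by by_contra h'; exact hy ⟨hyA, h'⟩
      exact ⟨y, this, x, hx.1, hx.2, hxy.symm⟩
    · obtain ⟨rfl, -⟩ := h.unique hx.1 hyA hxy
      exact absurd ha hx.2
  · obtain ⟨x, hx, y, hy, hxy⟩ := hG.exists_adj_of_mem_of_notMem hs ht
    by_cases hyA : y ∈ A
    · exact ⟨x, hx, y, hyA, hy, hxy⟩
    · obtain ⟨rfl, -⟩ := h.unique (hSA hx) hyA hxy
      exact absurd hx ha

lemma eq_of_same_edge (h : IsCut G A a b) (h' : IsCut G B a b) (hG : G.Preconnected) : A = B := by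
  have key : ∀ {A B : Set V}, IsCut G A a b → IsCut G B a b → A ⊆ B := by
    intro A B h h' t ht
    by_contra htB
    obtain ⟨x, hx, y, hy, hyB, hxy⟩ := h.exists_adj_inside hG (S := A ∩ B) Set.inter_subset_left
      ⟨h.left_mem, h'.left_mem⟩ ht (fun h'' => htB h''.2)
    obtain ⟨-, rfl⟩ := h'.unique hx.2 (fun h'' => hyB ⟨hy, h''⟩) hxy
    exact h.right_notMem hy
  exact (key h h').antisymm (key h' h)

/-- If all four corners were inhabited, the connected sets `A` and `Aᶜ` would each contain an edge
leaving `B`, but only one edge leaves `B`. -/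
lemma nested (h : IsCut G A a b) (h' : IsCut G B a' b') (hG : G.Preconnected) :
    A ⊆ B ∨ B ⊆ A ∨ Disjoint A B ∨ A ∪ B = Set.univ := by
  by_contra! hcon
  obtain ⟨h1, h2, h3, h4⟩ := hcon
  obtain ⟨p, hpA, hpB⟩ := Set.not_subset.1 h1
  obtain ⟨q, hqB, hqA⟩ := Set.not_subset.1 h2
  obtain ⟨r, hrA, hrB⟩ := Set.not_disjoint_iff.1 h3
  obtain ⟨s, hs⟩ := (Set.ne_univ_iff_exists_notMem _).1 h4
  have hsA : s ∉ A := fun h => hs (Or.inl h)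
  have hsB : s ∉ B := fun h => hs (Or.inr h)
  obtain ⟨x, hx, y, hy, hyS, hxy⟩ := h.exists_adj_inside hG (S := A ∩ B) Set.inter_subset_left
    ⟨hrA, hrB⟩ hpA (fun h => hpB h.2)
  obtain ⟨z, hz, w, hw, hwS, hzw⟩ := h.compl.exists_adj_inside hG (S := Aᶜ ∩ B)
    Set.inter_subset_left ⟨hqA, hqB⟩ hsA (fun h => hsB h.2)
  obtain ⟨rfl, -⟩ := h'.unique hx.2 (fun h => hyS ⟨hy, h⟩) hxy
  obtain ⟨rfl, -⟩ := h'.unique hz.2 (fun h => hwS ⟨hw, h⟩) hzw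
  exact hz.1 hx.1

lemma disjoint_of_ne {w : V} (h : IsCut G A a w) (h' : IsCut G B b w) (hab : a ≠ b)
    (hG : G.Preconnected) : Disjoint A B := by
  have haB : a ∉ B := fun hB => hab (h'.unique hB h'.right_notMem h.adj).1
  have hbA : b ∉ A := fun hA => hab.symm (h.unique hA h.right_notMem h'.adj).1
  rcases h.nested h' hG with h1 | h1 | h1 | h1
  · exact absurd (h1 h.left_mem) haB
  · exact absurd (h1 h'.left_mem) hbA
  · exact h1
  · have : w ∈ A ∪ B := h1 ▸ Set.mem_univ w
    exact absurd this (not_or.2 ⟨h.right_notMem, h'.right_notMem⟩)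

lemma map {W : Type*} {H : SimpleGraph W} (h : IsCut G A a b) (f : G ≃g H) :
    IsCut H (f '' A) (f a) (f b) := by
  refine ⟨⟨a, h.left_mem, rfl⟩, ?_, f.map_adj_iff.2 h.adj, ?_⟩
  · rintro ⟨x, hx, hxb⟩
    exact h.right_notMem (f.injective hxb ▸ hx)
  · rintro _ y ⟨x, hx, rfl⟩ hy hxy
    obtain ⟨y, rfl⟩ := f.surjective y
    obtain ⟨rfl, rfl⟩ := h.unique hx (fun hyA => hy ⟨y, hyA, rfl⟩) (f.map_adj_iff.1 hxy)
    exact ⟨rfl, rfl⟩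

end IsCut

lemma IsAcyclic.exists_isCut (hG : G.IsAcyclic) (hab : G.Adj a b) : ∃ A, IsCut G A a b := by
  have hb : G.IsBridge s(a, b) := isAcyclic_iff_forall_adj_isBridge.1 hG hab
  rw [isBridge_iff] at hb
  refine ⟨{v | (G.deleteEdges {s(a, b)}).Reachable a v}, Reachable.refl a, ?_, hab, ?_⟩
  · simpa [deleteEdges] using hb
  · intro x y hx hy hxy
    have he : s(x, y) = s(a, b) := by
      by_contra hne
      exact hy (Reachable.trans hx (Adj.reachable (by rw [deleteEdges_adj]; exact ⟨hxy, hne⟩)))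
    rcases Sym2.eq_iff.1 he with h | h
    · exact h
    · exact absurd (h.2 ▸ Reachable.refl _) hy

/-- The vertex `x` together with all branches at `x` is closed under adjacency, hence is everything.
-/
lemma IsTree.exists_isCut_toward (hG : G.IsTree) {x y : V} (hxy : x ≠ y) :
    ∃ A a, IsCut G A a x ∧ y ∈ A := by
  by_contra! hcon
  obtain ⟨p, hp, q, hq, hpq⟩ := hG.1.preconnected.exists_adj_of_mem_of_notMem
    (S := {v | v = x ∨ ∃ A a, IsCut G A a x ∧ v ∈ A}) (s := x) (t := y) (Or.inl rfl)
    (by rintro (h | ⟨A, a, h, h'⟩)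
        · exact hxy h.symm
        · exact hcon A a h h')
  have hqx : q ≠ x := fun h => hq (Or.inl h)
  rcases hp with rfl | ⟨A, a, h, hpA⟩
  · obtain ⟨A, hA⟩ := hG.2.exists_isCut hpq.symm
    exact hq (Or.inr ⟨A, q, hA, hA.left_mem⟩)
  · by_cases hqA : q ∈ A
    · exact hq (Or.inr ⟨A, a, h, hqA⟩)
    · exact hqx (h.unique hpA hqA hpq).2

end Cuts

/-! ### Similar vertices of a tree can be interchanged. -/

section Swap

variable {V : Type*} {G : SimpleGraph V}

/-- An automorphism of a finite tree fixes a vertex or reverses an edge. -/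
lemma IsTree.exists_fixed_or_flip [Finite V] (hG : G.IsTree) (f : G ≃g G) :
    (∃ z, f z = z) ∨ ∃ z w, G.Adj z w ∧ f z = w ∧ f w = z := by
  by_contra! hcon
  obtain ⟨hfix, hflip⟩ := hcon
  -- Every vertex `x` points along the first edge towards `f x`. There are fewer edges than
  -- vertices, so two vertices choose the same edge; they point at each other, and `f` must reverse
  -- that edge.
  choose A n hA hmem using fun x => hG.exists_isCut_toward (hfix x).symm
  have hcard := (isTree_iff_connected_and_card.1 hG).2
  let F : V → G.edgeSet := fun x => ⟨s(n x, x), (hA x).adj⟩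
  have : ¬ Function.Injective F := by
    intro hinj
    have := Nat.card_le_card_of_injective F hinj
    omega
  obtain ⟨x, y, hxy, hne⟩ := Function.not_injective_iff.1 this
  have hs : s(n x, x) = s(n y, y) := congrArg Subtype.val hxy
  rcases Sym2.eq_iff.1 hs with ⟨-, h⟩ | ⟨h1, h2⟩
  · exact hne h
  · have hx := hA x
    have hy := hA y
    rw [h1] at hx
    rw [← h2] at hy
    have hxy := hx.eq_of_same_edge hy.compl hG.1.preconnected
    have hfx := hmem x
    have hfy := hmem y
    have hfy' : f y ∉ A x := by rw [hxy]; exact fun h => h hfy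
    have := hx.unique hfx hfy' (f.map_adj_iff.2 hx.adj.symm)
    exact hflip x y hx.adj.symm this.1 this.2

/-- Exchange a set `A` with its image under a partial symmetry `f`. -/
lemma exists_swap_of_disjoint (f : G ≃g G) {A : Set V} {a w : V} (h : IsCut G A a w)
    (hw : f w = w) (hdis : Disjoint A (f '' A)) {s : V} (hs : s ∈ A) :
    ∃ g : G ≃g G, g s = f s ∧ g (f s) = s := by
  classical
  have hB := h.map f
  rw [hw] at hB
  have hd : ∀ x ∈ A, x ∉ f '' A := fun x hx hx' => Set.disjoint_left.1 hdis hx hx'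
  let g : V → V := fun x => if x ∈ A then f x else if x ∈ f '' A then f.symm x else x
  have g1 : ∀ x ∈ A, g x = f x := fun x hx => if_pos hx
  have g2 : ∀ x ∈ A, g (f x) = x := fun x hx => by
    have h2 : f x ∈ f '' A := ⟨x, hx, rfl⟩
    have h1 : f x ∉ A := fun h => hd _ h h2
    simp only [g, if_neg h1, if_pos h2, RelIso.symm_apply_apply]
  have g3 : ∀ x, x ∉ A → x ∉ f '' A → g x = x := fun x h1 h2 => by
    simp only [g, if_neg h1, if_neg h2]
  have hinv : Function.Involutive g := by
    intro x
    by_cases h1 : x ∈ A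
    · rw [g1 x h1, g2 x h1]
    · by_cases h2 : x ∈ f '' A
      · obtain ⟨y, hy, rfl⟩ := h2
        rw [g2 y hy, g1 y hy]
      · rw [g3 x h1 h2, g3 x h1 h2]
  have hwB : w ∉ f '' A := hB.right_notMem
  have hadj : ∀ x y, G.Adj x y → G.Adj (g x) (g y) := by
    have outA : ∀ x y, x ∈ A → y ∉ A → G.Adj x y → G.Adj (g x) (g y) := by
      intro x y hx hy hxy
      obtain ⟨rfl, rfl⟩ := h.unique hx hy hxy
      rw [g1 _ hx, g3 _ hy hwB]
      exact hB.adj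
    have outB : ∀ x y, x ∈ f '' A → y ∉ f '' A → G.Adj x y → G.Adj (g x) (g y) := by
      intro x y hx hy hxy
      obtain ⟨rfl, rfl⟩ := hB.unique hx hy hxy
      rw [g2 _ h.left_mem, g3 _ h.right_notMem hy]
      exact h.adj
    intro x y hxy
    by_cases hx : x ∈ A
    · by_cases hy : y ∈ A
      · rw [g1 x hx, g1 y hy]; exact f.map_adj_iff.2 hxy
      · exact outA x y hx hy hxy
    · by_cases hy : y ∈ A
      · exact (outA y x hy hx hxy.symm).symm
      · by_cases hx' : x ∈ f '' A
        · by_cases hy' : y ∈ f '' A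
          · obtain ⟨x, hx2, rfl⟩ := hx'
            obtain ⟨y, hy2, rfl⟩ := hy'
            rw [g2 x hx2, g2 y hy2]; exact f.map_adj_iff.1 hxy
          · exact outB x y hx' hy' hxy
        · by_cases hy' : y ∈ f '' A
          · exact (outB y x hy' hx' hxy.symm).symm
          · rw [g3 x hx hx', g3 y hy hy']; exact hxy
  refine ⟨⟨hinv.toPerm g, ?_⟩, g1 s hs, g2 s hs⟩
  intro x y
  refine ⟨fun hxy => ?_, hadj x y⟩
  have := hadj _ _ hxy
  simpa [hinv.coe_toPerm, hinv x, hinv y] using this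

/-- Since `f` reverses the edge `zw`, it exchanges the two sides. Using `f` on one side and its
inverse on the other makes an involution, even if `f` is not one. -/
lemma exists_swap_of_flip (hG : G.Preconnected) (f : G ≃g G) {z w s : V} (hz : f z = w)
    (hw : f w = z) {A : Set V} (h : IsCut G A z w) (hs : s ∈ A) :
    ∃ g : G ≃g G, g s = f s ∧ g (f s) = s := by
  classical
  have hB := h.map f
  rw [hw, hz] at hB
  have hBA : f '' A = Aᶜ := hB.eq_of_same_edge h.compl hG
  have hf : ∀ x, f x ∈ A ↔ x ∉ A := by
    intro x
    rw [← not_iff_not, ← Set.mem_compl_iff, ← hBA, not_not]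
    exact f.injective.mem_set_image
  let g : V → V := fun x => if x ∈ A then f x else f.symm x
  have g1 : ∀ x ∈ A, g x = f x := fun x hx => if_pos hx
  have g2 : ∀ x ∈ A, g (f x) = x := fun x hx => by
    have h1 : f x ∉ A := fun h => (hf x).1 h hx
    simp only [g, if_neg h1, RelIso.symm_apply_apply]
  have hsurj : ∀ x, x ∉ A → ∃ y ∈ A, f y = x := fun x hx => by
    have : x ∈ f '' A := by rw [hBA]; exact hx
    exact this
  have hinv : Function.Involutive g := by
    intro x
    by_cases h1 : x ∈ A
    · rw [g1 x h1, g2 x h1]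
    · obtain ⟨y, hy, rfl⟩ := hsurj x h1
      rw [g2 y hy, g1 y hy]
  have hadj : ∀ x y, G.Adj x y → G.Adj (g x) (g y) := by
    have outA : ∀ x y, x ∈ A → y ∉ A → G.Adj x y → G.Adj (g x) (g y) := by
      intro x y hx hy hxy
      obtain ⟨rfl, rfl⟩ := h.unique hx hy hxy
      have h2 := g2 _ h.left_mem
      rw [hz] at h2
      rw [g1 _ hx, h2, hz]
      exact h.adj.symm
    intro x y hxy
    by_cases hx : x ∈ A
    · by_cases hy : y ∈ A
      · rw [g1 x hx, g1 y hy]; exact f.map_adj_iff.2 hxy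
      · exact outA x y hx hy hxy
    · by_cases hy : y ∈ A
      · exact (outA y x hy hx hxy.symm).symm
      · obtain ⟨x, hx2, rfl⟩ := hsurj x hx
        obtain ⟨y, hy2, rfl⟩ := hsurj y hy
        rw [g2 x hx2, g2 y hy2]; exact f.map_adj_iff.1 hxy
  refine ⟨⟨hinv.toPerm g, ?_⟩, g1 s hs, g2 s hs⟩
  intro x y
  refine ⟨fun hxy => ?_, hadj x y⟩
  have := hadj _ _ hxy
  simpa [hinv.coe_toPerm, hinv x, hinv y] using this

/-- Similar vertices of a finite tree are interchanged by an automorphism. -/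
lemma IsTree.exists_swap [Finite V] (hG : G.IsTree) (f : G ≃g G) (s : V) :
    ∃ g : G ≃g G, g s = f s ∧ g (f s) = s := by
  have hc := hG.1.preconnected
  rcases hG.exists_fixed_or_flip f with ⟨z, hz⟩ | ⟨z, w, hzw, hz, hw⟩
  · by_cases hsf : f s = s
    · exact ⟨Iso.refl, hsf.symm, hsf⟩
    · have hzs : z ≠ s := by rintro rfl; exact hsf hz
      -- A smallest branch at a fixed vertex among those containing `s`. Its root `a` is not fixed,
      -- since otherwise the branch at `a` towards `s` would be smaller.
      let P : ℕ → Prop := fun n => ∃ A a w, IsCut G A a w ∧ f w = w ∧ s ∈ A ∧ A.ncard = n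
      have hP : ∃ n, P n := by
        obtain ⟨A, a, hA, hsA⟩ := hG.exists_isCut_toward hzs
        exact ⟨_, A, a, z, hA, hz, hsA, rfl⟩
      classical
      obtain ⟨A, a, w, hA, hw, hsA, hn⟩ := Nat.find_spec hP
      have hfa : f a ≠ a := by
        intro hfa
        have has : a ≠ s := by rintro rfl; exact hsf hfa
        obtain ⟨B, b, hB, hsB⟩ := hG.exists_isCut_toward has
        have hwB : w ∉ B := by
          intro hwB
          have := hB.unique hwB hB.right_notMem hA.adj.symm
          rcases hA.compl.nested hB hc with h | h | h | h
          · rcases hB.nested hA hc with h' | h' | h' | h'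
            · exact hA.right_notMem (h' hwB)
            · exact hB.right_notMem (h' hA.left_mem)
            · exact Set.disjoint_left.1 h' hsB hsA
            · have h5 := hA.compl
              have : Aᶜ = B := h5.eq_of_same_edge (this.1 ▸ hB) hc
              exact (this ▸ hsB : s ∈ Aᶜ) hsA
          · exact (h hsB) hsA
          · exact Set.disjoint_left.1 h hA.right_notMem hwB
          · have h5 := hA.compl
            have : Aᶜ = B := h5.eq_of_same_edge (this.1 ▸ hB) hc
            exact (this ▸ hsB : s ∈ Aᶜ) hsA
        have hBA : B ⊂ A := by
          refine ⟨?_, fun h => hB.right_notMem (h hA.left_mem)⟩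
          rcases hB.nested hA hc with h' | h' | h' | h'
          · exact h'
          · exact absurd (h' hA.left_mem) hB.right_notMem
          · exact absurd hsA (Set.disjoint_left.1 h' hsB)
          · have : w ∈ B ∪ A := h' ▸ Set.mem_univ w
            exact absurd this (not_or.2 ⟨hwB, hA.right_notMem⟩)
        have hlt := Set.ncard_lt_ncard hBA (Set.toFinite A)
        rw [hn] at hlt
        exact Nat.find_min hP hlt ⟨B, b, a, hB, hfa, hsB, rfl⟩
      have hB := hA.map f
      rw [hw] at hB
      -- `A` and its image are now two different branches at the fixed vertex `w`, so they can be
      -- exchanged with the rest left in place.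
      exact exists_swap_of_disjoint f hA hw (hA.disjoint_of_ne hB (Ne.symm hfa) hc) hsA
  · obtain ⟨A, hA⟩ := hG.2.exists_isCut hzw
    by_cases hsA : s ∈ A
    · exact exists_swap_of_flip hc f hz hw hA hsA
    · exact exists_swap_of_flip hc f hw hz hA.compl hsA

end Swap

/-! ### Attaching leaves, and the absence of pseudosimilar leaves in trees. -/

section AddLeaf

variable {α β : Type*}

/-- The graph obtained from `X` by attaching a new leaf `none` at the vertex `p`. -/
def addLeaf (X : SimpleGraph α) (p : α) : SimpleGraph (Option α) where
  Adj x y := match x, y with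
    | some x, some y => X.Adj x y
    | some x, none => x = p
    | none, some y => y = p
    | none, none => False
  symm := ⟨fun x y h => by
    cases x <;> cases y <;> first | exact h | exact h.symm⟩
  loopless := ⟨fun x => by cases x <;> simp⟩

@[simp] lemma addLeaf_some_some {X : SimpleGraph α} {p x y : α} :
    (X.addLeaf p).Adj (some x) (some y) ↔ X.Adj x y := Iff.rfl

@[simp] lemma addLeaf_some_none {X : SimpleGraph α} {p x : α} :
    (X.addLeaf p).Adj (some x) none ↔ x = p := Iff.rfl

@[simp] lemma addLeaf_none_some {X : SimpleGraph α} {p x : α} :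
    (X.addLeaf p).Adj none (some x) ↔ x = p := Iff.rfl

/-- An isomorphism extends to the graphs with a leaf attached at corresponding vertices. -/
def addLeafCongr {X : SimpleGraph α} {Y : SimpleGraph β} (f : X ≃g Y) {p : α} {q : β}
    (h : f p = q) : X.addLeaf p ≃g Y.addLeaf q where
  toEquiv := Equiv.optionCongr f.toEquiv
  map_rel_iff' := by
    intro x y
    subst h
    cases x <;> cases y <;> simp [f.map_adj_iff]

/-- An isomorphism of graphs with an attached leaf fixing the leaves restricts to the graphs. -/
def isoOfAddLeaf {X : SimpleGraph α} {Y : SimpleGraph β} {p : α} {q : β}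
    (f : X.addLeaf p ≃g Y.addLeaf q) (h : f none = none) : X ≃g Y where
  toEquiv := Equiv.removeNone f.toEquiv
  map_rel_iff' := by
    have key : ∀ x, some (Equiv.removeNone f.toEquiv x) = f (some x) := by
      intro x
      refine Equiv.removeNone_some f.toEquiv ?_
      rcases hx : f.toEquiv (some x) with _ | y
      · have : f (some x) = f none := by rw [h]; exact hx
        exact absurd (f.injective this) (by simp)
      · exact ⟨y, rfl⟩
    intro x y
    rw [← addLeaf_some_some (X := Y) (p := q), key, key, f.map_adj_iff, addLeaf_some_some]

lemma some_isoOfAddLeaf {X : SimpleGraph α} {Y : SimpleGraph β} {p : α} {q : β}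
    (f : X.addLeaf p ≃g Y.addLeaf q) (h : f none = none) (x : α) :
    some (isoOfAddLeaf f h x) = f (some x) := by
  refine Equiv.removeNone_some f.toEquiv ?_
  rcases hx : f.toEquiv (some x) with _ | y
  · have : f (some x) = f none := by rw [h]; exact hx
    exact absurd (f.injective this) (by simp)
  · exact ⟨y, rfl⟩

open Classical in
/-- Deleting a leaf `v` with neighbour `s` and attaching it again. -/
noncomputable def addLeafInduceIso {X : SimpleGraph α} {v s : α} (hs : s ≠ v)
    (h : ∀ x, X.Adj v x ↔ x = s) :
    (X.induce {x | x ≠ v}).addLeaf ⟨s, hs⟩ ≃g X where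
  toEquiv := (Equiv.optionSubtypeNe v : Option {x // x ≠ v} ≃ α)
  map_rel_iff' := by
    have h1 : ∀ x : {x // x ≠ v}, Equiv.optionSubtypeNe v (some x) = x := fun x => by simp
    have h2 : Equiv.optionSubtypeNe v none = v := by simp
    intro x y
    rcases x with _ | x <;> rcases y with _ | y
    · simp
    · rw [h2, h1, h]; rw [addLeaf_none_some, Subtype.ext_iff]
    · rw [h2, h1, X.adj_comm, h]; rw [addLeaf_some_none, Subtype.ext_iff]
    · rw [h1, h1]; exact Iff.rfl

lemma addLeafInduceIso_some {X : SimpleGraph α} {v s : α} (hs : s ≠ v)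
    (h : ∀ x, X.Adj v x ↔ x = s) (x : {x | x ≠ v}) :
    addLeafInduceIso hs h (some x) = x := by
  classical
  exact Equiv.optionSubtypeNe_some v x

lemma IsTree.induce_ne {X : SimpleGraph α} (hX : X.IsTree) {v s : α} (hs : s ≠ v)
    (h : ∀ x, X.Adj v x ↔ x = s) : (X.induce {x | x ≠ v}).IsTree := by
  have : Nonempty {x | x ≠ v} := ⟨⟨s, hs⟩⟩
  refine ⟨⟨preconnected_of_forall_exists_adj ?_⟩, hX.2.induce _⟩
  intro S a b ha hb
  obtain ⟨x, hx, y, hy, hxy⟩ := hX.1.preconnected.exists_adj_of_mem_of_notMem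
    (S := {x | (∃ h : x ≠ v, (⟨x, h⟩ : {x | x ≠ v}) ∈ S) ∨
      (x = v ∧ (⟨s, hs⟩ : {x | x ≠ v}) ∈ S)}) (s := a) (t := b)
    (Or.inl ⟨a.2, ha⟩) (by
      rintro (⟨_, h⟩ | ⟨h, -⟩)
      · exact hb h
      · exact b.2 h)
  by_cases hyv : y = v
  · subst hyv
    obtain rfl := (h x).1 hxy.symm
    rcases hx with ⟨h1, h2⟩ | ⟨h1, -⟩
    · exact absurd (Or.inr ⟨rfl, h2⟩) hy
    · exact absurd h1 hs
  · have hyS : (⟨y, hyv⟩ : {x | x ≠ v}) ∉ S := fun h => hy (Or.inl ⟨hyv, h⟩)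
    rcases hx with ⟨h1, h2⟩ | ⟨rfl, h2⟩
    · exact ⟨_, h2, _, hyS, hxy⟩
    · obtain rfl := (h y).1 hxy
      exact absurd h2 hyS

/-- A finite tree has no pseudosimilar leaves (Harary–Palmer): if attaching a leaf to the tree `X`
at `p` and at `r` gives isomorphic trees, then `p` and `r` are similar in `X`. -/
theorem IsTree.exists_iso_of_addLeaf_iso (n : ℕ) : ∀ {α : Type u} [Finite α] {X : SimpleGraph α},
    X.IsTree → Nat.card α = n → ∀ {p r : α}, (X.addLeaf p ≃g X.addLeaf r) →
    ∃ φ : X ≃g X, φ p = r := by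
  induction n with
  | zero =>
    intro α _ X hX hn p r _
    have := hX.1.nonempty
    exact absurd hn Nat.card_pos.ne'
  | succ n ih =>
    intro α _ X hX hn p r τ
    by_cases hnone : τ none = none
    · refine ⟨isoOfAddLeaf τ hnone, ?_⟩
      have h : (X.addLeaf r).Adj (τ none) (τ (some p)) := τ.map_adj_iff.2 rfl
      rw [hnone, ← some_isoOfAddLeaf τ hnone] at h
      exact h
    -- The preimage `v` of the new leaf is a leaf of `X`, with neighbour `s`. With `Y = X - v`, the
    -- tree `X` is `Y` with a leaf at `s` and, through `τ`, also `Y` with a leaf at `p`; the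
    -- induction hypothesis applies to `Y`.
    obtain ⟨u, hu⟩ : ∃ u, τ u = none := τ.surjective none
    rcases u with _ | v
    · exact absurd hu hnone
    by_cases hsub : Subsingleton α
    · exact ⟨Iso.refl, Subsingleton.elim _ _⟩
    have hvadj : ∀ y, (X.addLeaf p).Adj (some v) y ↔ τ y = some r := by
      intro y
      rw [← τ.map_adj_iff, hu]
      cases τ y <;> simp
    obtain ⟨s, hvs⟩ : ∃ s, X.Adj v s := by
      rw [not_subsingleton_iff_nontrivial] at hsub
      obtain ⟨w, hw⟩ := exists_ne v
      obtain ⟨x, hx, y, hy, hxy⟩ := hX.1.preconnected.exists_adj_of_mem_of_notMem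
        (S := {v}) (s := v) (t := w) rfl hw
      obtain rfl : x = v := hx
      exact ⟨y, hxy⟩
    have hτs : τ (some s) = some r := (hvadj (some s)).1 hvs
    have hX1 : ∀ x, X.Adj v x ↔ x = s := by
      intro x
      refine ⟨fun h => ?_, by rintro rfl; exact hvs⟩
      have : τ (some x) = some r := (hvadj (some x)).1 h
      rw [← hτs] at this
      exact Option.some_injective _ (τ.injective this)
    have hvp : p ≠ v := by
      rintro rfl
      have : τ none = some r := (hvadj none).1 rfl
      rw [← hτs] at this
      exact absurd (τ.injective this) (by simp)
    have hsv : s ≠ v := hvs.ne'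
    let Y := X.induce {x | x ≠ v}
    have hY : Y.IsTree := hX.induce_ne hsv hX1
    have hcard : Nat.card {x | x ≠ v} = n := by
      have h1 := Nat.card_congr (addLeafInduceIso hsv hX1).toEquiv
      rw [Finite.card_option] at h1
      omega
    classical
    let E1 : Y.addLeaf ⟨s, hsv⟩ ≃g X := addLeafInduceIso hsv hX1
    -- deleting `v` from `addLeaf X p` and its image `none` from `addLeaf X r`
    let j : Option {x | x ≠ v} → Option α := Option.map (↑)
    have hj : ∀ x, τ (j x) ≠ none := by
      intro x hx
      rw [← hu] at hx
      have := τ.injective hx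
      rcases x with _ | x
      · simp [j] at this
      · simp only [j, Option.map_some, Option.some.injEq] at this
        exact x.2 this
    choose e he using fun x => Option.ne_none_iff_exists'.1 (hj x)
    have hjinj : Function.Injective j := Option.map_injective Subtype.val_injective
    have hebij : Function.Bijective e := by
      refine ⟨fun x y hxy => hjinj (τ.injective (by rw [he, he, hxy])), fun y => ?_⟩
      obtain ⟨x, hx⟩ := τ.surjective (some y)
      rcases x with _ | x
      · exact ⟨none, Option.some_injective _ (by rw [← he, ← hx]; rfl)⟩
      · have hxv : x ≠ v := by rintro rfl; rw [hu] at hx; cases hx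
        exact ⟨some ⟨x, hxv⟩, Option.some_injective _ (by rw [← he, ← hx]; rfl)⟩
    let E2 : Y.addLeaf ⟨p, hvp⟩ ≃g X := by
      refine ⟨Equiv.ofBijective e hebij, ?_⟩
      intro x y
      rw [Equiv.ofBijective_apply, Equiv.ofBijective_apply, ← addLeaf_some_some (p := r),
        ← he, ← he, τ.map_adj_iff]
      rcases x with _ | x <;> rcases y with _ | y <;>
        simp [j, Y, Subtype.ext_iff]
    obtain ⟨f, hf⟩ := ih hY hcard (E1.trans E2.symm)
    -- An automorphism of `Y` taking `s` to `p` is not enough: in `E1.symm`, `g`, `E2` the vertex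
    -- `p` has to go to `s`, and `E2` then takes `s` to `r`. Hence the need for an automorphism
    -- interchanging `s` and `p`.
    obtain ⟨g, hg1, hg2⟩ := hY.exists_swap f ⟨s, hsv⟩
    rw [hf] at hg1 hg2
    refine ⟨(E1.symm.trans (addLeafCongr g hg1)).trans E2, ?_⟩
    have h1 : E1.symm p = some ⟨p, hvp⟩ := by
      apply E1.injective
      rw [E1.apply_symm_apply]
      exact (addLeafInduceIso_some hsv hX1 ⟨p, hvp⟩).symm
    have h2 : E2 (some ⟨s, hsv⟩) = r := by
      apply Option.some_injective
      rw [← hτs]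
      exact (he (some ⟨s, hsv⟩)).symm
    change E2 (addLeafCongr g hg1 (E1.symm p)) = r
    rw [h1, ← h2]
    change E2 (some (g _)) = _
    rw [hg2]

end AddLeaf

/-! ### Replacing one edge, and its effect on cuts. -/

section MoveEdge

variable {V : Type u} {T : SimpleGraph V} {A B : Set V} {a b a' b' c d : V}

/-- The graph obtained from `T` by deleting the edge `ab` and adding the edge `a'b'`. -/
def moveEdge (T : SimpleGraph V) (a b a' b' : V) : SimpleGraph V where
  Adj x y := (T.Adj x y ∧ s(x, y) ≠ s(a, b)) ∨ (s(x, y) = s(a', b') ∧ x ≠ y)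
  symm := ⟨fun x y h => by rwa [T.adj_comm, Sym2.eq_swap, ne_comm (a := y)]⟩
  loopless := ⟨fun x h => by
    rcases h with h | h
    · exact h.1.ne rfl
    · exact h.2 rfl⟩

lemma moveEdge_adj {x y : V} : (T.moveEdge a b a' b').Adj x y ↔
    (T.Adj x y ∧ s(x, y) ≠ s(a, b)) ∨ (s(x, y) = s(a', b') ∧ x ≠ y) := Iff.rfl

lemma moveEdge_swap : T.moveEdge a b b' a' = T.moveEdge a b a' b' := by
  ext x y
  rw [moveEdge_adj, moveEdge_adj, Sym2.eq_swap (a := b')]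

lemma moveEdge_self (h : T.Adj a b) : T.moveEdge a b a b = T := by
  ext x y
  rw [moveEdge_adj]
  constructor
  · rintro (h1 | ⟨h1, -⟩)
    · exact h1.1
    · rcases Sym2.eq_iff.1 h1 with ⟨rfl, rfl⟩ | ⟨rfl, rfl⟩
      exacts [h, h.symm]
  · intro h1
    by_cases h2 : s(x, y) = s(a, b)
    · exact Or.inr ⟨h2, h1.ne⟩
    · exact Or.inl ⟨h1, h2⟩

lemma IsCut.moveEdge_adj_of_mem (h : IsCut T A a b) (ha : a' ∈ A) (hb : b' ∉ A) {x y : V}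
    (hx : x ∈ A) (hy : y ∈ A) : (T.moveEdge a b a' b').Adj x y ↔ T.Adj x y := by
  have := h.left_mem
  have := h.right_notMem
  simp only [moveEdge_adj, Sym2.eq_iff, ne_eq]
  constructor
  · rintro (h | ⟨⟨rfl, rfl⟩ | ⟨rfl, rfl⟩, -⟩)
    · exact h.1
    · contradiction
    · contradiction
  · intro h
    refine Or.inl ⟨h, ?_⟩
    rintro (⟨rfl, rfl⟩ | ⟨rfl, rfl⟩) <;> contradiction

lemma IsCut.moveEdge_adj_of_notMem (h : IsCut T A a b) (ha : a' ∈ A) (hb : b' ∉ A) {x y : V}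
    (hx : x ∉ A) (hy : y ∉ A) : (T.moveEdge a b a' b').Adj x y ↔ T.Adj x y := by
  have := h.left_mem
  have := h.right_notMem
  simp only [moveEdge_adj, Sym2.eq_iff, ne_eq]
  constructor
  · rintro (h | ⟨⟨rfl, rfl⟩ | ⟨rfl, rfl⟩, -⟩)
    · exact h.1
    · contradiction
    · contradiction
  · intro h
    refine Or.inl ⟨h, ?_⟩
    rintro (⟨rfl, rfl⟩ | ⟨rfl, rfl⟩) <;> contradiction

lemma IsCut.moveEdge (h : IsCut T A a b) (ha : a' ∈ A) (hb : b' ∉ A) :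
    IsCut (T.moveEdge a b a' b') A a' b' := by
  refine ⟨ha, hb, Or.inr ⟨rfl, fun h => hb (h ▸ ha)⟩, ?_⟩
  rintro x y hx hy (⟨h1, h2⟩ | ⟨h1, -⟩)
  · obtain ⟨rfl, rfl⟩ := h.unique hx hy h1
    exact absurd rfl h2
  · rcases Sym2.eq_iff.1 h1 with h | ⟨rfl, rfl⟩
    · exact h
    · exact absurd hx hb

lemma IsCut.preconnected_moveEdge (h : IsCut T A a b) (hT : T.Preconnected) (ha : a' ∈ A)
    (hb : b' ∉ A) : (T.moveEdge a b a' b').Preconnected := by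
  apply preconnected_of_forall_exists_adj
  intro S s t hs ht
  by_contra! hcon
  have hA : ∀ {x y}, x ∈ A → y ∈ A → x ∈ S → y ∈ S := by
    intro x y hx hy hxS
    by_contra hyS
    obtain ⟨u, hu, v, hv, hvS, huv⟩ := h.exists_adj_inside hT (S := A ∩ S) Set.inter_subset_left
      ⟨hx, hxS⟩ hy (fun h => hyS h.2)
    exact hcon u hu.2 v (fun h => hvS ⟨hv, h⟩) ((h.moveEdge_adj_of_mem ha hb hu.1 hv).2 huv)
  have hA' : ∀ {x y}, x ∉ A → y ∉ A → x ∈ S → y ∈ S := by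
    intro x y hx hy hxS
    by_contra hyS
    obtain ⟨u, hu, v, hv, hvS, huv⟩ := h.compl.exists_adj_inside hT (S := Aᶜ ∩ S)
      Set.inter_subset_left ⟨hx, hxS⟩ hy (fun h => hyS h.2)
    exact hcon u hu.2 v (fun h => hvS ⟨hv, h⟩) ((h.moveEdge_adj_of_notMem ha hb hu.1 hv).2 huv)
  have hadj := (h.moveEdge ha hb).adj
  by_cases hsA : s ∈ A
  · have ha'S := hA hsA ha hs
    have hb'S : b' ∈ S := by by_contra h'; exact hcon _ ha'S _ h' hadj
    by_cases htA : t ∈ A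
    · exact ht (hA hsA htA hs)
    · exact ht (hA' hb htA hb'S)
  · have hb'S := hA' hsA hb hs
    have ha'S : a' ∈ S := by by_contra h'; exact hcon _ hb'S _ h' hadj.symm
    by_cases htA : t ∈ A
    · exact ht (hA ha htA ha'S)
    · exact ht (hA' hsA htA hs)

/-- Moving an edge inside one side of a cut preserves the cut. -/
lemma IsCut.moveEdge_of_subset (h : IsCut T A a b) (hB : IsCut T B c d) (hAB : A ⊆ B)
    (hac : c ∉ A) (ha : a' ∈ A) (hb : b' ∈ B) : IsCut (T.moveEdge a b a' b') B c d := by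
  refine ⟨hB.left_mem, hB.right_notMem, Or.inl ⟨hB.adj, fun h' => ?_⟩, ?_⟩
  · rcases Sym2.eq_iff.1 h' with ⟨rfl, rfl⟩ | ⟨rfl, rfl⟩
    · exact hac h.left_mem
    · exact hB.right_notMem (hAB h.left_mem)
  · rintro x y hx hy (⟨h1, -⟩ | ⟨h1, -⟩)
    · exact hB.unique hx hy h1
    · rcases Sym2.eq_iff.1 h1 with ⟨rfl, rfl⟩ | ⟨rfl, rfl⟩
      · exact absurd hb hy
      · exact absurd (hAB ha) hy

/-- Moving a pendant part `A` of `B` to the other side of the cut `B`. -/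
lemma IsCut.moveEdge_diff (h : IsCut T A a b) (hB : IsCut T B c d) (hAB : A ⊆ B)
    (hac : c ∉ A) (ha : a' ∈ A) (hb : b' ∉ B) : IsCut (T.moveEdge a b a' b') (B \ A) c d := by
  refine ⟨⟨hB.left_mem, hac⟩, fun h' => hB.right_notMem h'.1,
    Or.inl ⟨hB.adj, fun h' => ?_⟩, ?_⟩
  · rcases Sym2.eq_iff.1 h' with ⟨rfl, rfl⟩ | ⟨rfl, rfl⟩
    · exact hac h.left_mem
    · exact hB.right_notMem (hAB h.left_mem)
  · rintro x y hx hy (⟨h1, h2⟩ | ⟨h1, -⟩)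
    · by_cases hyB : y ∈ B
      · have hyA : y ∈ A := by by_contra h'; exact hy ⟨hyB, h'⟩
        obtain ⟨rfl, rfl⟩ := h.unique hyA hx.2 h1.symm
        exact absurd Sym2.eq_swap h2
      · exact hB.unique hx.1 hyB h1
    · rcases Sym2.eq_iff.1 h1 with ⟨rfl, rfl⟩ | ⟨rfl, rfl⟩
      · exact absurd ha hx.2
      · exact absurd hx.1 hb

end MoveEdge

/-! ### Gluing isomorphisms across a bridge. -/

section Glue

variable {V W : Type*} {T : SimpleGraph V} {H : SimpleGraph W} {A : Set V} {B : Set W}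
  {a b : V} {a' b' : W}

/-- Isomorphisms of the two sides of a cut matching the ends of the bridge glue together. -/
lemma IsCut.nonempty_iso_of_glue (h : IsCut T A a b) (h' : IsCut H B a' b') (f g : V → W)
    (hf : Set.BijOn f A B) (hg : Set.BijOn g Aᶜ Bᶜ) (hfa : f a = a') (hgb : g b = b')
    (hfadj : ∀ x ∈ A, ∀ y ∈ A, H.Adj (f x) (f y) ↔ T.Adj x y)
    (hgadj : ∀ x ∉ A, ∀ y ∉ A, H.Adj (g x) (g y) ↔ T.Adj x y) : Nonempty (T ≃g H) := by
  classical
  let F : V → W := fun x => if x ∈ A then f x else g x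
  have F1 : ∀ x ∈ A, F x = f x := fun x hx => if_pos hx
  have F2 : ∀ x, x ∉ A → F x = g x := fun x hx => if_neg hx
  have hbij : Function.Bijective F := by
    constructor
    · intro x y hxy
      by_cases hx : x ∈ A <;> by_cases hy : y ∈ A
      · rw [F1 x hx, F1 y hy] at hxy
        exact hf.injOn hx hy hxy
      · rw [F1 x hx, F2 y hy] at hxy
        exact absurd (hxy ▸ hf.mapsTo hx) (hg.mapsTo hy)
      · rw [F2 x hx, F1 y hy] at hxy
        exact absurd (hxy.symm ▸ hf.mapsTo hy) (hg.mapsTo hx)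
      · rw [F2 x hx, F2 y hy] at hxy
        exact hg.injOn hx hy hxy
    · intro w
      by_cases hw : w ∈ B
      · obtain ⟨x, hx, rfl⟩ := hf.surjOn hw
        exact ⟨x, F1 x hx⟩
      · obtain ⟨x, hx, rfl⟩ := hg.surjOn hw
        exact ⟨x, F2 x hx⟩
  have cross : ∀ x ∈ A, ∀ y ∉ A, H.Adj (F x) (F y) ↔ T.Adj x y := by
    intro x hx y hy
    rw [F1 x hx, F2 y hy]
    constructor
    · intro hxy
      obtain ⟨h1, h2⟩ := h'.unique (hf.mapsTo hx) (hg.mapsTo hy) hxy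
      rw [← hfa] at h1
      rw [← hgb] at h2
      rw [hf.injOn hx h.left_mem h1, hg.injOn hy h.right_notMem h2]
      exact h.adj
    · intro hxy
      obtain ⟨rfl, rfl⟩ := h.unique hx hy hxy
      rw [hfa, hgb]
      exact h'.adj
  refine ⟨Equiv.ofBijective F hbij, ?_⟩
  intro x y
  change H.Adj (F x) (F y) ↔ T.Adj x y
  by_cases hx : x ∈ A <;> by_cases hy : y ∈ A
  · rw [F1 x hx, F1 y hy, hfadj x hx y hy]
  · exact cross x hx y hy
  · rw [H.adj_comm, T.adj_comm]
    exact cross y hy x hx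
  · rw [F2 x hx, F2 y hy, hgadj x hx y hy]

end Glue

/-! ### Reconstruction from two bridge cards. -/

section Reconstruction

variable {V : Type u} {T : SimpleGraph V}

lemma eq_moveEdge_of_deleteEdges_eq {H : SimpleGraph V} {a b a' b' : V} (hf : H.Adj a' b')
    (h : T.deleteEdges {s(a, b)} = H.deleteEdges {s(a', b')}) : H = T.moveEdge a b a' b' := by
  ext x y
  have h1 : (T.deleteEdges {s(a, b)}).Adj x y ↔ (H.deleteEdges {s(a', b')}).Adj x y := by rw [h]
  simp only [deleteEdges_adj, Set.mem_singleton_iff] at h1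
  rw [moveEdge_adj]
  constructor
  · intro hxy
    by_cases h2 : s(x, y) = s(a', b')
    · exact Or.inr ⟨h2, hxy.ne⟩
    · exact Or.inl (h1.2 ⟨hxy, h2⟩)
  · rintro (h2 | ⟨h2, -⟩)
    · exact (h1.1 h2).1
    · rcases Sym2.eq_iff.1 h2 with ⟨rfl, rfl⟩ | ⟨rfl, rfl⟩
      exacts [hf, hf.symm]

/-- If the pieces of two cards have different sizes, then the new edge of the graph to be
reconstructed joins the pieces of the first card. -/
lemma mem_iff_notMem_of_moveEdge_iso [Finite V] (hT : T.Preconnected) {A B : Set V}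
    {a b p q a' b' p' q' : V} (hA : IsCut T A a b) (hB : IsCut T B p q)
    (h1 : A.ncard ≠ B.ncard) (h2 : A.ncard ≠ Bᶜ.ncard)
    (π : T.moveEdge p q p' q' ≃g T.moveEdge a b a' b') : a' ∈ A ↔ b' ∉ A := by
  by_contra hcon
  have hcon' : a' ∈ A ↔ b' ∈ A := by tauto
  have hclosed : ∀ x y, x ∈ A → y ∉ A → ¬ (T.moveEdge a b a' b').Adj x y := by
    rintro x y hx hy (⟨h3, h4⟩ | ⟨h3, -⟩)
    · obtain ⟨rfl, rfl⟩ := hA.unique hx hy h3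
      exact h4 rfl
    · rcases Sym2.eq_iff.1 h3 with ⟨rfl, rfl⟩ | ⟨rfl, rfl⟩
      · exact hy (hcon'.1 hx)
      · exact hy (hcon'.2 hx)
  -- If the new edge did not cross `A`, no edge at all would leave `A`. The pullback `S` is then a
  -- union of pieces of `T - pq`, nonempty and proper, hence `B` or `Bᶜ`; both have the wrong size.
  let S : Set V := π ⁻¹' A
  have hSclosed : ∀ x y, x ∈ S → y ∉ S → T.Adj x y → s(x, y) = s(p, q) := by
    intro x y hx hy hxy
    by_contra h3
    exact hclosed _ _ hx hy (π.map_adj_iff.2 (Or.inl ⟨hxy, h3⟩))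
  have hcard : S.ncard = A.ncard := Set.ncard_preimage_of_injective_subset_range π.injective
    (fun y _ => π.surjective y)
  have key : ∀ {D : Set V} {r t}, IsCut T D r t → s(r, t) = s(p, q) →
      (∀ x ∈ D, x ∈ S) ∨ (∀ x ∈ D, x ∉ S) := by
    intro D r t hD hrt
    by_contra! h3
    obtain ⟨⟨x, hx, hxS⟩, y, hy, hyS⟩ := h3
    obtain ⟨u, hu, v, hv, hvS, huv⟩ := hD.exists_adj_inside hT (S := D ∩ S) Set.inter_subset_left
      ⟨hy, hyS⟩ hx (fun h => hxS h.2)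
    have h4 := hSclosed u v hu.2 (fun h => hvS ⟨hv, h⟩) huv
    rw [← hrt] at h4
    rcases Sym2.eq_iff.1 h4 with ⟨rfl, rfl⟩ | ⟨rfl, rfl⟩
    · exact hD.right_notMem hv
    · exact hD.right_notMem hu.1
  have hne : ∃ x, x ∈ S := by
    obtain ⟨x, hx⟩ := π.surjective a
    exact ⟨x, by rw [Set.mem_preimage, hx]; exact hA.left_mem⟩
  have hne' : ∃ x, x ∉ S := by
    obtain ⟨x, hx⟩ := π.surjective b
    exact ⟨x, by rw [Set.mem_preimage, hx]; exact hA.right_notMem⟩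
  rcases key hB rfl with h3 | h3 <;> rcases key hB.compl Sym2.eq_swap with h4 | h4
  · obtain ⟨x, hx⟩ := hne'
    by_cases hxB : x ∈ B
    exacts [hx (h3 x hxB), hx (h4 x hxB)]
  · have : S = B := by
      ext x
      exact ⟨fun h => by by_contra h'; exact h4 x h' h, h3 x⟩
    exact h1 (by rw [← hcard, this])
  · have : S = Bᶜ := by
      ext x
      exact ⟨fun h h' => h3 x h' h, h4 x⟩
    exact h2 (by rw [← hcard, this])
  · obtain ⟨x, hx⟩ := hne
    by_cases hxB : x ∈ B
    exacts [h3 x hxB hx, h4 x hxB hx]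

/-- Two bridges of a tree whose deletion gives pieces of different sizes determine the tree as soon
as no other way of reconnecting the pieces of both cards leads to the same graph. -/
lemma ern_le_two [Finite V] (hT : T.Preconnected) {A B : Set V}
    {a b p q : V} (hA : IsCut T A a b) (hB : IsCut T B p q)
    (h1 : A.ncard ≠ B.ncard) (h2 : A.ncard ≠ Bᶜ.ncard)
    (key : ∀ a' ∈ A, ∀ b' ∉ A, ∀ p' ∈ B, ∀ q' ∉ B,
      (T.moveEdge p q p' q' ≃g T.moveEdge a b a' b') → Nonempty (T ≃g T.moveEdge a b a' b')) :
    T.ern ≤ 2 := by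
  have hne : s(a, b) ≠ s(p, q) := by
    intro h
    rcases Sym2.eq_iff.1 h with ⟨rfl, rfl⟩ | ⟨rfl, rfl⟩
    · exact h1 (by rw [hA.eq_of_same_edge hB hT])
    · exact h2 (by rw [hA.eq_of_same_edge hB.compl hT])
  have hS : ({s(a, b), s(p, q)} : Set (Sym2 V)).encard = 2 := Set.encard_pair hne
  rw [← hS]
  refine iInf₂_le_of_le {s(a, b), s(p, q)} ?_ (iInf_le_of_le ?_ le_rfl)
  · rintro e (rfl | rfl)
    exacts [hA.adj, hB.adj]
  rintro W _ H ⟨φ, -, hφ⟩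
  have hΦ := hφ ⟨s(a, b), Or.inl rfl⟩
  have hΨ := hφ ⟨s(p, q), Or.inr rfl⟩
  generalize φ ⟨s(a, b), Or.inl rfl⟩ = f₁ at hΦ
  generalize φ ⟨s(p, q), Or.inr rfl⟩ = f₂ at hΨ
  obtain ⟨⟨x₁, y₁⟩, hf₁⟩ := f₁
  obtain ⟨⟨x₂, y₂⟩, hf₂⟩ := f₂
  change H.Adj x₁ y₁ at hf₁
  change H.Adj x₂ y₂ at hf₂
  have unpack : ∀ {x y : V} {x' y' : W},
      Nonempty (T.deleteEdges {s(x, y)} ≃g H.deleteEdges {s(x', y')}) →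
      ∃ Φ : V ≃ W, ∀ u v, T.Adj u v ∧ s(u, v) ≠ s(x, y) ↔
        H.Adj (Φ u) (Φ v) ∧ s(Φ u, Φ v) ≠ s(x', y') := by
    rintro x y x' y' ⟨Φ⟩
    refine ⟨Φ.toEquiv, fun u v => ?_⟩
    have := Φ.map_adj_iff (v := u) (w := v)
    rw [deleteEdges_adj, deleteEdges_adj] at this
    exact this.symm
  obtain ⟨Φ, hΦ⟩ := unpack hΦ
  obtain ⟨Ψ, hΨ⟩ := unpack hΨ
  obtain ⟨a', rfl⟩ := Φ.surjective x₁
  obtain ⟨b', rfl⟩ := Φ.surjective y₁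
  obtain ⟨p', rfl⟩ := Ψ.surjective x₂
  obtain ⟨q', rfl⟩ := Ψ.surjective y₂
  -- Transporting `H` along the first card puts it on the vertices of `T`, where it differs from `T`
  -- in one edge. The second card then becomes the isomorphism `π`.
  let H' : SimpleGraph V := H.comap Φ
  let ι : H' ≃g H := ⟨Φ, Iff.rfl⟩
  have hH' : H' = T.moveEdge a b a' b' := by
    apply eq_moveEdge_of_deleteEdges_eq
    · exact hf₁
    · ext x y
      rw [deleteEdges_adj, deleteEdges_adj]
      refine (hΦ x y).trans ?_
      change _ ↔ H.Adj (Φ x) (Φ y) ∧ _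
      simp only [Set.mem_singleton_iff, Sym2.eq_iff, ne_eq, Φ.injective.eq_iff]
  have π : T.moveEdge p q p' q' ≃g T.moveEdge a b a' b' := by
    rw [← hH']
    refine RelIso.trans (s := H.Adj) ⟨Ψ, ?_⟩ ι.symm
    intro x y
    have h3 := hΨ x y
    simp only [Sym2.eq_iff, ne_eq, Ψ.injective.eq_iff] at h3
    simp only [moveEdge_adj, ne_eq, Sym2.eq_iff]
    constructor
    · intro hxy
      have := hxy.ne
      rw [ne_eq, Ψ.injective.eq_iff] at this
      tauto
    · rintro (h4 | ⟨⟨rfl, rfl⟩ | ⟨rfl, rfl⟩, -⟩)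
      · exact (h3.1 h4).1
      · exact hf₂
      · exact hf₂.symm
  have c1 := mem_iff_notMem_of_moveEdge_iso hT hA hB h1 h2 π
  have hcard : ∀ D : Set V, Dᶜ.ncard = Nat.card V - D.ncard := fun D => Set.ncard_compl D
  have hle : ∀ D : Set V, D.ncard ≤ Nat.card V := fun D => Set.ncard_le_card D
  have c2 := mem_iff_notMem_of_moveEdge_iso hT hB hA h1.symm (fun h => h2 (by
    have := hle A; have := hle B; rw [hcard] at h ⊢; omega)) π.symm
  suffices h : Nonempty (T ≃g T.moveEdge a b a' b') by
    obtain ⟨f⟩ := h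
    rw [← hH'] at f
    exact ⟨f.trans ι⟩
  -- The new edges are unordered, so their ends are renamed to have the first one in `A` and in `B`,
  -- respectively.
  by_cases ha' : a' ∈ A <;> by_cases hp' : p' ∈ B
  · exact key a' ha' b' (c1.1 ha') p' hp' q' (c2.1 hp') π
  · rw [← moveEdge_swap (a' := p')] at π
    exact key a' ha' b' (c1.1 ha') q' (by tauto) p' hp' π
  · rw [← moveEdge_swap (a' := a')] at π ⊢
    exact key b' (by tauto) a' ha' p' hp' q' (c2.1 hp') π
  · rw [← moveEdge_swap (a' := p'), ← moveEdge_swap (a' := a')] at π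
    rw [← moveEdge_swap (a' := a')]
    exact key b' (by tauto) a' ha' q' (by tauto) p' hp' π

end Reconstruction

/-! ### Leaves of trees. -/

section Leaves

variable {V : Type*} {G : SimpleGraph V} {A B : Set V} {a w t : V}

lemma IsCut.subset_of_adj (hA : IsCut G A a w) (hB : IsCut G B t a) (hG : G.Preconnected)
    (ht : t ∈ A) : B ⊆ A := by
  rcases hB.nested hA hG with h | h | h | h
  · exact h
  · exact absurd (h hA.left_mem) hB.right_notMem
  · exact absurd ht (Set.disjoint_left.1 h hB.left_mem)
  · have hw : w ∈ B ∪ A := h ▸ Set.mem_univ w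
    have hwB := hw.resolve_right hA.right_notMem
    obtain ⟨rfl, -⟩ := hB.unique hwB hB.right_notMem hA.adj.symm
    exact absurd ht hA.right_notMem

/-- Each side of a cut of a finite tree contains a leaf. -/
lemma IsTree.exists_leaf_mem [Finite V] (hG : G.IsTree) (hA : IsCut G A a w) :
    ∃ l ∈ A, ∃ p, ∀ x, G.Adj l x ↔ x = p := by
  have hc := hG.1.preconnected
  induction hn : A.ncard using Nat.strong_induction_on generalizing A a w with
  | _ n ih =>
    -- Descent: a side with a second vertex contains a smaller side hanging off `a`; a one-vertex
    -- side is a leaf.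
    by_cases h : ∃ t ∈ A, t ≠ a
    · obtain ⟨t, ht, hta⟩ := h
      obtain ⟨x, hx, y, hy, hya, hxy⟩ := hA.exists_adj_inside hc (S := {a})
        (by rintro _ rfl; exact hA.left_mem) rfl ht hta
      obtain rfl : x = a := hx
      obtain ⟨B, hB⟩ := hG.2.exists_isCut hxy.symm
      have hBA := hA.subset_of_adj hB hc hy
      have hlt : B.ncard < A.ncard := Set.ncard_lt_ncard
        ⟨hBA, fun h => hB.right_notMem (h hA.left_mem)⟩ (Set.toFinite A)
      obtain ⟨l, hl, h⟩ := ih _ (hn ▸ hlt) hB rfl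
      exact ⟨l, hBA hl, h⟩
    · push Not at h
      refine ⟨a, hA.left_mem, w, fun x => ⟨fun hx => ?_, by rintro rfl; exact hA.adj⟩⟩
      by_cases hxA : x ∈ A
      · exact absurd (h x hxA) hx.ne'
      · exact (hA.unique hA.left_mem hxA hx).2

lemma IsTree.exists_leaf [Finite V] [Nontrivial V] (hG : G.IsTree) :
    ∃ l p, ∀ x, G.Adj l x ↔ x = p := by
  obtain ⟨x, y, hxy⟩ := exists_pair_ne V
  obtain ⟨A, a, hA, -⟩ := hG.exists_isCut_toward hxy
  obtain ⟨l, -, p, h⟩ := hG.exists_leaf_mem hA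
  exact ⟨l, p, h⟩

end Leaves

/-! ### Trees without branching are paths. -/

section Paths

/-- A finite tree all of whose vertices have degree at most two is a path. -/
lemma IsTree.nonempty_iso_pathGraph (n : ℕ) : ∀ {α : Type*} [Finite α] {X : SimpleGraph α},
    X.IsTree → Nat.card α = n →
    (∀ v x y z, X.Adj v x → X.Adj v y → X.Adj v z → x = y ∨ x = z ∨ y = z) →
    Nonempty (X ≃g pathGraph n) := by
  induction n with
  | zero =>
    intro α _ X hX hn
    have := hX.1.nonempty
    exact absurd hn Nat.card_pos.ne'
  | succ n ih =>
    intro α _ X hX hn hdeg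
    by_cases hsub : Subsingleton α
    · have h0 : n = 0 := by
        have := Finite.card_le_one_iff_subsingleton.2 hsub
        omega
      subst h0
      refine ⟨⟨Finite.equivFinOfCardEq hn, ?_⟩⟩
      intro x y
      simp [Subsingleton.elim x y]
    rw [not_subsingleton_iff_nontrivial] at hsub
    obtain ⟨v, s, hv⟩ := hX.exists_leaf
    have hsv : s ≠ v := ((hv s).2 rfl).ne'
    let Y := X.induce {x | x ≠ v}
    have hY : Y.IsTree := hX.induce_ne hsv hv
    have E1 : Y.addLeaf ⟨s, hsv⟩ ≃g X := addLeafInduceIso hsv hv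
    have hcard : Nat.card {x | x ≠ v} = n := by
      have h1 := Nat.card_congr E1.toEquiv
      rw [Finite.card_option] at h1
      omega
    obtain ⟨f⟩ := ih hY hcard (fun v x y z h1 h2 h3 => by
      have := hdeg v x y z h1 h2 h3
      simpa only [Subtype.ext_iff] using this)
    -- the neighbour of the removed leaf is an end of the remaining path
    have hend : (f ⟨s, hsv⟩ : ℕ) = 0 ∨ (f ⟨s, hsv⟩ : ℕ) + 1 = n := by
      by_contra! hcon
      have hlt := (f ⟨s, hsv⟩).2
      have h1 : Y.Adj ⟨s, hsv⟩ (f.symm ⟨f ⟨s, hsv⟩ - 1, by omega⟩) := by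
        rw [← f.map_adj_iff, f.apply_symm_apply, pathGraph_adj]
        right; simp; omega
      have h2 : Y.Adj ⟨s, hsv⟩ (f.symm ⟨f ⟨s, hsv⟩ + 1, by omega⟩) := by
        rw [← f.map_adj_iff, f.apply_symm_apply, pathGraph_adj]
        left; simp
      rcases hdeg s v _ _ ((hv s).2 rfl).symm h1 h2 with h | h | h
      · exact (f.symm _).2 h.symm
      · exact (f.symm _).2 h.symm
      · have h := f.symm.injective (Subtype.ext h)
        rw [Fin.mk.injEq] at h
        omega
    -- The path is reversed if necessary, so that the removed leaf comes back as the last vertex.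
    obtain ⟨f, hf⟩ : ∃ f : Y ≃g pathGraph n, (f ⟨s, hsv⟩ : ℕ) + 1 = n := by
      rcases hend with h | h
      · refine ⟨f.trans ⟨Fin.revPerm, ?_⟩, ?_⟩
        · intro x y
          simp only [pathGraph_adj, Fin.revPerm_apply, Fin.val_rev]
          omega
        · have hlt := (f ⟨s, hsv⟩).2
          change ((Fin.rev (f ⟨s, hsv⟩) : Fin n) : ℕ) + 1 = n
          rw [Fin.val_rev]
          omega
      · exact ⟨f, h⟩
    let E : Option {x | x ≠ v} ≃ Fin (n + 1) :=
      (Equiv.optionCongr f.toEquiv).trans finSuccEquivLast.symm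
    refine ⟨E1.symm.trans ⟨E, ?_⟩⟩
    have e1 : E none = Fin.last n := by simp [E]
    have e2 : ∀ x, E (some x) = (f x).castSucc := by intro x; simp [E]
    have key : ∀ x : {x | x ≠ v}, (f x : ℕ) + 1 = n ↔ x = ⟨s, hsv⟩ := by
      intro x
      rw [← f.injective.eq_iff, Fin.ext_iff]
      omega
    intro x y
    rcases x with _ | x <;> rcases y with _ | y
    · simp
    · have := (f y).2
      rw [e1, e2, pathGraph_adj, addLeaf_none_some, ← key]
      simp only [Fin.val_castSucc, Fin.val_last]
      omega
    · have := (f x).2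
      rw [e1, e2, pathGraph_adj, addLeaf_some_none, ← key]
      simp only [Fin.val_castSucc, Fin.val_last]
      omega
    · rw [e2, e2, addLeaf_some_some, ← f.map_adj_iff, pathGraph_adj, pathGraph_adj]
      simp

end Paths

/-! ### Components after deleting an edge, weights, and centroidal components. -/

section Components

variable {V : Type u} {T : SimpleGraph V}

lemma IsCut.reachable_deleteEdges {A : Set V} {c d u v : V} (h : IsCut T A c d)
    (hT : T.Preconnected) (hu : u ∈ A) (hv : v ∈ A) :
    (T.deleteEdges {s(c, d)}).Reachable u v := by
  by_contra hcon
  obtain ⟨x, hx, y, hy, hyS, hxy⟩ := h.exists_adj_inside hT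
    (S := {x ∈ A | (T.deleteEdges {s(c, d)}).Reachable u x}) (fun x hx => hx.1)
    ⟨hu, Reachable.refl u⟩ hv (fun h => hcon h.2)
  refine hyS ⟨hy, hx.2.trans (Adj.reachable ?_)⟩
  rw [deleteEdges_adj]
  refine ⟨hxy, fun h' => ?_⟩
  rcases Sym2.eq_iff.1 h' with ⟨rfl, rfl⟩ | ⟨rfl, rfl⟩
  · exact h.right_notMem hy
  · exact h.right_notMem hx.1

lemma IsCut.mem_iff_of_reachable {A : Set V} {c d u v : V} (h : IsCut T A c d)
    (huv : (T.deleteEdges {s(c, d)}).Reachable u v) : u ∈ A ↔ v ∈ A := by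
  have key : ∀ {u v}, (T.deleteEdges {s(c, d)}).Reachable u v → u ∈ A → v ∈ A := by
    rintro u v ⟨p⟩ hu
    by_contra hv
    obtain ⟨e, -, h1, h2⟩ := p.exists_boundary_dart A hu hv
    have h3 := e.adj
    rw [deleteEdges_adj] at h3
    obtain ⟨h4, h5⟩ := h.unique h1 h2 h3.1
    rw [h4, h5] at h3
    exact h3.2 rfl
  exact ⟨key huv, key huv.symm⟩

/-- Deleting an edge of a tree leaves exactly two components. -/
lemma IsTree.exists_isCut_of_components (hT : T.IsTree) {e : Sym2 V} (he : e ∈ T.edgeSet)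
    {C D : (T.deleteEdges {e}).ConnectedComponent} (hCD : C ≠ D) :
    ∃ c d, e = s(c, d) ∧ IsCut T C.supp c d ∧ D.supp = C.suppᶜ := by
  obtain ⟨x, y⟩ := e
  change T.Adj x y at he
  obtain ⟨A, hA⟩ := hT.2.exists_isCut he
  have hc := hT.1.preconnected
  change (T.deleteEdges {s(x, y)}).ConnectedComponent at C
  change (T.deleteEdges {s(x, y)}).ConnectedComponent at D
  have key : ∀ u v, (T.deleteEdges {s(x, y)}).Reachable u v ↔ (u ∈ A ↔ v ∈ A) := by
    intro u v
    refine ⟨hA.mem_iff_of_reachable, fun h => ?_⟩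
    by_cases hu : u ∈ A
    · exact hA.reachable_deleteEdges hc hu (h.1 hu)
    · have := hA.compl.reachable_deleteEdges hc (u := u) (v := v) hu (fun h' => hu (h.2 h'))
      rwa [Sym2.eq_swap] at this
  induction C using ConnectedComponent.ind with | _ u =>
  induction D using ConnectedComponent.ind with | _ v =>
  rw [ne_eq, ConnectedComponent.eq, key] at hCD
  have hs : ∀ w, ((T.deleteEdges {s(x, y)}).connectedComponentMk w).supp =
      {z | z ∈ A ↔ w ∈ A} := by
    intro w
    ext z
    rw [ConnectedComponent.mem_supp_iff, ConnectedComponent.eq, key]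
    rfl
  by_cases hu : u ∈ A
  · have h1 : ((T.deleteEdges {s(x, y)}).connectedComponentMk u).supp = A := by
      rw [hs]; ext z; simp [hu]
    refine ⟨x, y, rfl, h1 ▸ hA, ?_⟩
    rw [h1, hs]
    ext z
    simp only [Set.mem_ofPred_eq, Set.mem_compl_iff]
    tauto
  · have h1 : ((T.deleteEdges {s(x, y)}).connectedComponentMk u).supp = Aᶜ := by
      rw [hs]; ext z; simp [hu]
    refine ⟨y, x, Sym2.eq_swap, h1 ▸ hA.compl, ?_⟩
    rw [h1, hs]
    ext z
    simp only [Set.mem_ofPred_eq, Set.mem_compl_iff]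
    tauto

/-- The side `A` is connected and avoids `d`, so a single component of `T - d` contains it. -/
lemma IsCut.ncard_le_weight [Finite V] (hT : T.Preconnected) {A : Set V} {c d : V}
    (h : IsCut T A c d) : A.ncard ≤ T.weight d := by
  have hcd : c ∈ ({d}ᶜ : Set V) := fun h' => h.right_notMem (h' ▸ h.left_mem)
  let K := (T.induce ({d}ᶜ : Set V)).connectedComponentMk ⟨c, hcd⟩
  have hK : A.ncard ≤ K.supp.ncard := by
    rw [← Set.ncard_image_of_injective K.supp Subtype.val_injective]
    refine Set.ncard_le_ncard ?_ (Set.toFinite _)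
    by_contra hcon
    obtain ⟨t, ht, htK⟩ := Set.not_subset.1 hcon
    obtain ⟨x, hx, y, hy, hyS, hxy⟩ := h.exists_adj_inside hT
      (S := A ∩ Subtype.val '' K.supp) Set.inter_subset_left
      ⟨h.left_mem, ⟨c, hcd⟩, rfl, rfl⟩ ht (fun h => htK h.2)
    obtain ⟨hxA, ⟨x, hxd⟩, hxK, rfl⟩ := hx
    have hyd : y ∈ ({d}ᶜ : Set V) := fun h' => h.right_notMem (h' ▸ hy)
    refine hyS ⟨hy, ⟨y, hyd⟩, ?_, rfl⟩
    rw [ConnectedComponent.mem_supp_iff] at hxK ⊢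
    rw [← hxK, ConnectedComponent.eq]
    exact Adj.reachable (G := T.induce ({d}ᶜ : Set V)) hxy.symm
  refine hK.trans ?_
  exact le_ciSup (f := fun C : (T.induce ({d}ᶜ : Set V)).ConnectedComponent => C.supp.ncard)
    (Set.finite_range _).bddAbove K

/-- The only edge leaving `A` starts at `c`, so each component of `T - c` lies in `A \ {c}` or in
the smaller set `Aᶜ`. -/
lemma IsCut.weight_lt [Finite V] {A : Set V} {c d : V} (h : IsCut T A c d)
    (hlt : Aᶜ.ncard < A.ncard) : T.weight c < A.ncard := by
  have hle : T.weight c ≤ A.ncard - 1 := by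
    refine ciSup_le' fun K => ?_
    rw [← Set.ncard_image_of_injective K.supp Subtype.val_injective]
    induction K using ConnectedComponent.ind with | _ u =>
    obtain ⟨u, hu⟩ := u
    have key : ∀ v ∈ ((T.induce ({c}ᶜ : Set V)).connectedComponentMk ⟨u, hu⟩).supp,
        (v : V) ∈ A ↔ u ∈ A := by
      intro v hv
      rw [ConnectedComponent.mem_supp_iff, ConnectedComponent.eq] at hv
      have aux : ∀ {x y : ({c}ᶜ : Set V)}, (T.induce ({c}ᶜ : Set V)).Reachable x y →
          (x : V) ∈ A → (y : V) ∈ A := by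
        rintro x y ⟨p⟩ hx
        by_contra hy
        obtain ⟨e, -, h1, h2⟩ := p.exists_boundary_dart (Subtype.val ⁻¹' A) hx hy
        have h3 : T.Adj e.fst e.snd := e.adj
        exact e.fst.2 (h.unique h1 h2 h3).1
      exact ⟨aux hv, aux hv.symm⟩
    by_cases huA : u ∈ A
    · rw [← Set.ncard_sdiff_singleton_of_mem h.left_mem]
      refine Set.ncard_le_ncard ?_ (Set.toFinite _)
      rintro _ ⟨v, hv, rfl⟩
      exact ⟨(key v hv).2 huA, v.2⟩
    · have : (Subtype.val '' ((T.induce ({c}ᶜ : Set V)).connectedComponentMk ⟨u, hu⟩).supp).ncard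
          ≤ Aᶜ.ncard := by
        refine Set.ncard_le_ncard ?_ (Set.toFinite _)
        rintro _ ⟨v, hv, rfl⟩
        exact fun h' => huA ((key v hv).1 h')
      omega
  have : 0 < A.ncard := by omega
  omega

/-- The two centroidal components of a bicentroidal tree have the same size. -/
lemma IsCut.ncard_eq_ncard_compl [Finite V] (hT : T.Preconnected) {A : Set V} {c d : V}
    (h : IsCut T A c d) (hw : T.weight c = T.weight d) : A.ncard = Aᶜ.ncard := by
  -- With unequal sides, the end in the larger side has weight below the size of that side, while
  -- the other end has at least this weight.
  by_contra hne
  rcases lt_or_gt_of_ne hne with hlt | hlt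
  · have h1 := h.compl.weight_lt (by rwa [compl_compl])
    have h2 := h.compl.ncard_le_weight hT
    omega
  · have h1 := h.weight_lt hlt
    have h2 := h.ncard_le_weight hT
    omega

end Components

/-! ### One card is not enough. -/

section LowerBound

variable {V : Type u} {T : SimpleGraph V}

lemma IsTree.exists_not_adj [Finite V] (hT : T.IsTree) {A : Set V} (hcard : 3 ≤ A.ncard) :
    ∃ x ∈ A, ∃ y ∈ A, x ≠ y ∧ ¬ T.Adj x y := by
  by_contra! hcon
  obtain ⟨x, hx, y, hy, z, hz, hxy, hxz, hyz⟩ := (Set.two_lt_ncard (Set.toFinite A)).1 hcard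
  have h1 := hcon x hx y hy hxy
  have h2 := hcon x hx z hz hxz
  have h3 := hcon y hy z hz hyz
  classical
  exact hT.2.cliqueFree (le_refl 3) {x, y, z} (is3Clique_triple_iff.2 ⟨h1, h2, h3⟩)

/-- A single card does not determine a tree with at least five vertices. -/
lemma IsTree.two_le_ern [Finite V] (hT : T.IsTree) (hcard : 5 ≤ Nat.card V) : 2 ≤ T.ern := by
  refine le_iInf₂ fun S hS => le_iInf fun hrec => ?_
  by_contra hlt
  have hle : S.encard ≤ 1 := by
    rw [not_le] at hlt
    exact Order.le_of_lt_add_one (by rwa [one_add_one_eq_two])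
  have hno : ∀ {H : SimpleGraph V} {A : Set V} {s t : V}, s ∈ A → t ∉ A →
      (∀ x ∈ A, ∀ y ∉ A, ¬ H.Adj x y) → ¬ T.HasEdgeCards S H := by
    intro H A s t hs ht h hcards
    obtain ⟨f⟩ := hrec V H hcards
    obtain ⟨x, hx, y, hy, hxy⟩ :=
      (f.connected_iff.1 hT.1).preconnected.exists_adj_of_mem_of_notMem hs ht
    exact h x hx y hy hxy
  rcases S.eq_empty_or_nonempty with rfl | ⟨e, he⟩
  -- With no card at all, the edgeless graph is a competitor.
  · have : Nontrivial V := Finite.one_lt_card_iff_nontrivial.1 (by omega)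
    obtain ⟨s, t, hst⟩ := exists_pair_ne V
    refine hno (H := ⊥) (A := {s}) (s := s) (t := t) rfl hst.symm (fun _ _ _ _ h => h) ?_
    exact ⟨fun e => absurd e.2 (Set.notMem_empty _), fun e => absurd e.2 (Set.notMem_empty _),
      fun e => absurd e.2 (Set.notMem_empty _)⟩
  · obtain rfl : S = {e} := (Set.encard_le_one_iff_eq.1 hle).elim
      (fun h => absurd he (h ▸ Set.notMem_empty e))
      (fun ⟨x, hx⟩ => by rw [hx] at he ⊢; rw [Set.mem_singleton_iff.1 he])
    obtain ⟨a, b⟩ := e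
    have hab : T.Adj a b := hS rfl
    obtain ⟨A, hA⟩ := hT.2.exists_isCut hab
    have hsum := Set.ncard_add_ncard_compl A
    -- Of at least five vertices, one side gets at least three, and these do not form a triangle.
    obtain ⟨x, y, hxy, hadj, hside⟩ : ∃ x y, x ≠ y ∧ ¬ T.Adj x y ∧ (x ∈ A ↔ y ∈ A) := by
      by_cases h3 : 3 ≤ A.ncard
      · obtain ⟨x, hx, y, hy, hxy, h⟩ := hT.exists_not_adj h3
        exact ⟨x, y, hxy, h, by simp [hx, hy]⟩
      · obtain ⟨x, hx, y, hy, hxy, h⟩ := hT.exists_not_adj (A := Aᶜ) (by omega)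
        exact ⟨x, y, hxy, h, by
          rw [Set.mem_compl_iff] at hx hy; simp [hx, hy]⟩
    -- The competitor has the edge `xy` in place of `ab`; nothing then leaves `A`, so it is
    -- disconnected.
    refine hno (H := T.moveEdge a b x y) hA.left_mem hA.right_notMem ?_ ?_
    · rintro u hu v hv (⟨h1, h2⟩ | ⟨h1, -⟩)
      · obtain ⟨rfl, rfl⟩ := hA.unique hu hv h1
        exact h2 rfl
      · rcases Sym2.eq_iff.1 h1 with ⟨rfl, rfl⟩ | ⟨rfl, rfl⟩
        · exact hv (hside.1 hu)
        · exact hv (hside.2 hu)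
    · have hmem : s(x, y) ∈ (T.moveEdge a b x y).edgeSet := Or.inr ⟨rfl, hxy⟩
      refine ⟨fun _ => ⟨s(x, y), hmem⟩, fun u v _ => Subtype.ext (u.2.trans v.2.symm), ?_⟩
      rintro ⟨e, rfl⟩
      refine ⟨⟨Equiv.refl V, ?_⟩⟩
      intro u v
      change ((T.moveEdge a b x y).deleteEdges {s(x, y)}).Adj u v ↔
        (T.deleteEdges {s(a, b)}).Adj u v
      simp only [deleteEdges_adj, moveEdge_adj, Set.mem_singleton_iff]
      constructor
      · tauto
      · rintro ⟨h1, h2⟩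
        refine ⟨Or.inl ⟨h1, h2⟩, fun h3 => ?_⟩
        rcases Sym2.eq_iff.1 h3 with ⟨rfl, rfl⟩ | ⟨rfl, rfl⟩
        · exact hadj h1
        · exact hadj h1.symm

end LowerBound

/-! ### Induced subgraphs on cut sides. -/

section Induced

variable {V W : Type*} {G : SimpleGraph V} {H : SimpleGraph W}

/-- `v` has at least three neighbours in `S`. -/
def HasThreeNeighborsIn (G : SimpleGraph V) (S : Set V) (v : V) : Prop :=
  ∃ x ∈ S, ∃ y ∈ S, ∃ z ∈ S, x ≠ y ∧ x ≠ z ∧ y ≠ z ∧ G.Adj v x ∧ G.Adj v y ∧ G.Adj v z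

lemma HasThreeNeighborsIn.image {S : Set V} {S' : Set W} {f : V → W} {v : V}
    (h : G.HasThreeNeighborsIn S v) (hmaps : Set.MapsTo f S S') (hinj : Set.InjOn f S)
    (hadj : ∀ y ∈ S, G.Adj v y → H.Adj (f v) (f y)) :
    H.HasThreeNeighborsIn S' (f v) := by
  obtain ⟨x, hx, y, hy, z, hz, h1, h2, h3, h4, h5, h6⟩ := h
  exact ⟨f x, hmaps hx, f y, hmaps hy, f z, hmaps hz, hinj.ne hx hy h1, hinj.ne hx hz h2,
    hinj.ne hy hz h3, hadj x hx h4, hadj y hy h5, hadj z hz h6⟩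

/-- A map which is an isomorphism between the subgraphs induced on `S` and `S'`. -/
noncomputable def induceIso {S : Set V} {S' : Set W} (f : V → W) (hf : Set.BijOn f S S')
    (h : ∀ x ∈ S, ∀ y ∈ S, H.Adj (f x) (f y) ↔ G.Adj x y) : G.induce S ≃g H.induce S' where
  toEquiv := hf.equiv f
  map_rel_iff' := by
    intro x y
    exact h x x.2 y y.2

lemma nonempty_iso_of_glue_induce {A : Set V} {B : Set W} {a b : V} {a' b' : W}
    (h : IsCut G A a b) (h' : IsCut H B a' b')
    (f : G.induce A ≃g H.induce B) (g : G.induce Aᶜ ≃g H.induce Bᶜ)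
    (hf : f ⟨a, h.left_mem⟩ = ⟨a', h'.left_mem⟩)
    (hg : g ⟨b, h.right_notMem⟩ = ⟨b', h'.right_notMem⟩) : Nonempty (G ≃g H) := by
  classical
  -- The values of `f'` off `A` and of `g'` on `A` are placeholders and never used.
  let f' : V → W := fun x => if hx : x ∈ A then f ⟨x, hx⟩ else a'
  let g' : V → W := fun x => if hx : x ∈ Aᶜ then g ⟨x, hx⟩ else b'
  have hf' : ∀ x (hx : x ∈ A), f' x = f ⟨x, hx⟩ := fun x hx => dif_pos hx
  have hg' : ∀ x (hx : x ∈ Aᶜ), g' x = g ⟨x, hx⟩ := fun x hx => dif_pos hx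
  refine h.nonempty_iso_of_glue h' f' g' ?_ ?_ (by rw [hf' a h.left_mem, hf])
    (by rw [hg' b h.right_notMem, hg]) ?_ ?_
  · refine ⟨fun x hx => by rw [hf' x hx]; exact (f _).2, fun x hx y hy hxy => ?_, fun y hy => ?_⟩
    · rw [hf' x hx, hf' y hy] at hxy
      exact congrArg Subtype.val (f.injective (Subtype.ext hxy))
    · obtain ⟨x, hx⟩ := f.surjective ⟨y, hy⟩
      exact ⟨x, x.2, by rw [hf' x x.2]; exact congrArg Subtype.val hx⟩
  · refine ⟨fun x hx => by rw [hg' x hx]; exact (g _).2, fun x hx y hy hxy => ?_, fun y hy => ?_⟩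
    · rw [hg' x hx, hg' y hy] at hxy
      exact congrArg Subtype.val (g.injective (Subtype.ext hxy))
    · obtain ⟨x, hx⟩ := g.surjective ⟨y, hy⟩
      exact ⟨x, x.2, by rw [hg' x x.2]; exact congrArg Subtype.val hx⟩
  · intro x hx y hy
    rw [hf' x hx, hf' y hy]
    exact f.map_adj_iff (v := ⟨x, hx⟩) (w := ⟨y, hy⟩)
  · intro x hx y hy
    rw [hg' x hx, hg' y hy]
    exact g.map_adj_iff (v := ⟨x, hx⟩) (w := ⟨y, hy⟩)

/-- Attaching a leaf to the subgraph induced on `S` at the only neighbour in `S` of `v`. -/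
lemma exists_addLeaf_induce_iso {S S' : Set V} {v s : V} (hv : v ∉ S) (hs : s ∈ S)
    (h : ∀ x ∈ S, G.Adj v x ↔ x = s) (hS' : insert v S = S') :
    ∃ E : (G.induce S).addLeaf ⟨s, hs⟩ ≃g G.induce S', (E none : V) = v ∧
      ∀ x : S, (E (some x) : V) = x := by
  subst hS'
  let f : Option S → (insert v S : Set V) := fun x =>
    x.elim ⟨v, Set.mem_insert v S⟩ (fun y => ⟨y, Set.mem_insert_of_mem v y.2⟩)
  have hbij : Function.Bijective f := by
    constructor
    · rintro (_ | x) (_ | y) hxy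
      · rfl
      · exact absurd (congrArg Subtype.val hxy) (fun h' : v = y => hv (h' ▸ y.2))
      · exact absurd (congrArg Subtype.val hxy) (fun h' : (x : V) = v => hv (h' ▸ x.2))
      · exact congrArg some (Subtype.ext (congrArg Subtype.val hxy :))
    · rintro ⟨x, rfl | hx⟩
      · exact ⟨none, rfl⟩
      · exact ⟨some ⟨x, hx⟩, rfl⟩
  refine ⟨⟨Equiv.ofBijective f hbij, ?_⟩, rfl, fun _ => rfl⟩
  rintro (_ | x) (_ | y)
  · simp [f]
  · exact (h y y.2).trans (by rw [addLeaf_none_some, Subtype.ext_iff])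
  · exact (G.adj_comm x v).trans ((h x x.2).trans (by rw [addLeaf_some_none, Subtype.ext_iff]))
  · exact Iff.rfl

lemma IsCut.isTree_induce {A : Set V} {a b : V} (h : IsCut G A a b) (hG : G.IsTree) :
    (G.induce A).IsTree := by
  have : Nonempty A := ⟨⟨a, h.left_mem⟩⟩
  refine ⟨⟨preconnected_of_forall_exists_adj ?_⟩, hG.2.induce _⟩
  intro S s t hs ht
  obtain ⟨x, ⟨x', hx, rfl⟩, y, hy, hyS, hxy⟩ := h.exists_adj_inside hG.1.preconnected
    (S := Subtype.val '' S) (by rintro _ ⟨x, -, rfl⟩; exact x.2) ⟨s, hs, rfl⟩ t.2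
    (by rintro ⟨t', ht', h'⟩; exact ht (Subtype.ext h' ▸ ht'))
  exact ⟨x', hx, ⟨y, hy⟩, fun h' => hyS ⟨_, h', rfl⟩, hxy⟩

/-- If a cut side exceeds another one by a single vertex, then this vertex carries the bridge of
the smaller side and of the larger side. -/
lemma IsCut.eq_insert_of_ncard {A B : Set V} [Finite V] {a b w z : V} (hB : IsCut G B w z)
    (hA : IsCut G A a b) (hG : G.Preconnected) (hBA : B ⊆ A) (hcard : A.ncard = B.ncard + 1) :
    A = insert z B ∧ a = z := by
  have h1 : (A \ B).ncard = 1 := by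
    rw [Set.ncard_sdiff hBA]
    omega
  obtain ⟨x, hx⟩ := Set.ncard_eq_one.1 h1
  have hxA : x ∈ A \ B := hx ▸ rfl
  have hx' : ∀ y ∈ A, y ∉ B → y = x := fun y h h' => by
    have : y ∈ A \ B := ⟨h, h'⟩
    rwa [hx] at this
  obtain ⟨u, hu, y, hy, hyB, huy⟩ := hA.exists_adj_inside hG hBA hB.left_mem hxA.1 hxA.2
  have hyz := (hB.unique hu hyB huy).2
  obtain rfl : z = x := hyz ▸ hx' y hy hyB
  refine ⟨?_, hx' a hA.left_mem fun haB => ?_⟩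
  · ext y
    constructor
    · intro hyA
      by_cases hyB : y ∈ B
      · exact Or.inr hyB
      · exact Or.inl (hx' y hyA hyB)
    · rintro (rfl | hyB)
      exacts [hxA.1, hBA hyB]
  · have := (hB.unique haB (fun h => hA.right_notMem (hBA h)) hA.adj).2
    exact hA.right_notMem (this ▸ hxA.1)

end Induced

/-! ### The cards of the two edges at a vertex `d` of degree two. -/

section PendantVertex

variable {V : Type u} {T : SimpleGraph V}

lemma IsCut.compl_sdiff_singleton {C : Set V} {c d o : V} (hC : IsCut T C c d) (hoC : o ∉ C)
    (hd : ∀ x, T.Adj d x ↔ x = c ∨ x = o) : IsCut T (Cᶜ \ {d}) o d := by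
  have hod : T.Adj o d := ((hd o).2 (Or.inr rfl)).symm
  refine ⟨⟨hoC, hod.ne⟩, fun h => h.2 rfl, hod, ?_⟩
  intro x y hx hy hxy
  by_cases hyC : y ∈ C
  · exact absurd (hC.unique hyC hx.1 hxy.symm).2 hx.2
  · have hyd : y = d := by by_contra h; exact hy ⟨hyC, h⟩
    subst hyd
    rcases (hd x).1 hxy.symm with rfl | rfl
    · exact absurd hC.left_mem hx.1
    · exact ⟨rfl, rfl⟩

/-- A bicentroidal tree in which the end `d` of the centroidal edge `cd` has degree two is
determined by the cards of the two edges at `d`, apart from one degenerate situation. -/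
theorem ern_le_two_of_degree_two [Finite V] (hT : T.IsTree) {C : Set V} {c d o : V}
    (hC : IsCut T C c d) (hcard : C.ncard = Cᶜ.ncard) (hoC : o ∉ C)
    (hd : ∀ x, T.Adj d x ↔ x = c ∨ x = o) (hdeg : ∀ v ∈ C, ¬ T.HasThreeNeighborsIn C v)
    (hbad : (∃ v, v ∉ C ∧ v ≠ d ∧ T.HasThreeNeighborsIn (Cᶜ \ {d}) v) ∨
      ∀ z ∈ insert d C, IsEmpty (T.induce Cᶜ ≃g T.induce (insert d C \ {z} : Set V))) :
    T.ern ≤ 2 := by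
  have hc := hT.1.preconnected
  have hdC := hC.right_notMem
  let B : Set V := Cᶜ \ {d}
  have hB : IsCut T B o d := hC.compl_sdiff_singleton hoC hd
  have hBc : Bᶜ = insert d C := by
    ext x
    simp only [B, Set.mem_compl_iff, Set.mem_sdiff, Set.mem_singleton_iff, Set.mem_insert_iff]
    tauto
  have hBcard : B.ncard + 1 = Cᶜ.ncard := Set.ncard_sdiff_singleton_add_one hdC
  have hBcard' : Bᶜ.ncard = C.ncard + 1 := by rw [hBc, Set.ncard_insert_of_notMem hdC]
  have hdB : insert d B = Cᶜ := by
    ext x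
    simp only [B, Set.mem_compl_iff, Set.mem_sdiff, Set.mem_singleton_iff, Set.mem_insert_iff]
    constructor
    · rintro (rfl | h)
      exacts [hdC, h.1]
    · intro h
      by_cases hxd : x = d
      exacts [Or.inl hxd, Or.inr ⟨h, hxd⟩]
  have hsum := Set.ncard_add_ncard_compl C
  refine ern_le_two hc hC hB (by omega) (by omega) ?_
  intro r hr r' hr' w hw z hz π
  have hH := hC.preconnected_moveEdge hc hr hr'
  have hCH := hC.moveEdge hr hr'
  have hWH := (hB.moveEdge hw hz).map π
  have hinC : ∀ x ∈ C, ∀ y ∈ C, (T.moveEdge c d r r').Adj x y ↔ T.Adj x y :=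
    fun x hx y hy => hC.moveEdge_adj_of_mem hr hr' hx hy
  have hinD : ∀ x ∉ C, ∀ y ∉ C, (T.moveEdge c d r r').Adj x y ↔ T.Adj x y :=
    fun x hx y hy => hC.moveEdge_adj_of_notMem hr hr' hx hy
  have hπB : ∀ x ∈ B, ∀ y ∈ B, (T.moveEdge c d r r').Adj (π x) (π y) ↔ T.Adj x y :=
    fun x hx y hy => π.map_adj_iff.trans (hB.moveEdge_adj_of_mem hw hz hx hy)
  have hπBc : ∀ x ∉ B, ∀ y ∉ B, (T.moveEdge c d r r').Adj (π x) (π y) ↔ T.Adj x y :=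
    fun x hx y hy => π.map_adj_iff.trans (hB.moveEdge_adj_of_notMem hw hz hx hy)
  have hWcard : (π '' B).ncard = B.ncard := Set.ncard_image_of_injective _ π.injective
  have hcompl : π '' Bᶜ = (π '' B)ᶜ := Set.image_compl_eq π.bijective
  generalize hHdef : T.moveEdge c d r r' = H at *
  -- The image of `D - d` is a side with one vertex less than `C` and `Cᶜ`. Counting excludes the
  -- second and the fourth position.
  rcases hWH.nested hCH hH with h | h | h | h
  · exfalso
    obtain ⟨h1, h2⟩ := hWH.eq_insert_of_ncard hCH hH h (by omega)
    -- Here `D - d` is mapped into `C`. A branching vertex of `D - d` would then lie in the path;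
    -- otherwise the complements show that `D` is a copy of `C + d - z`, the degenerate situation.
    rcases hbad with ⟨v, hvC, hvd, hv⟩ | hbad
    · refine hdeg (π v) (h ⟨v, ⟨hvC, hvd⟩, rfl⟩) ?_
      refine hv.image (fun x hx => h ⟨x, hx, rfl⟩) π.injective.injOn (fun y hy hvy => ?_)
      rw [← hinC _ (h ⟨v, ⟨hvC, hvd⟩, rfl⟩) _ (h ⟨y, hy, rfl⟩)]
      exact (hπB v ⟨hvC, hvd⟩ y hy).2 hvy
    · refine (hbad z (hBc ▸ hz)).elim (RelIso.symm ?_)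
      have hmem : ∀ x, x ∈ (insert d C \ {z} : Set V) ↔ π x ∉ C := by
        intro x
        rw [← hBc, h1, Set.mem_insert_iff, not_or, π.injective.eq_iff, π.injective.mem_set_image,
          Set.mem_sdiff, Set.mem_singleton_iff, Set.mem_compl_iff, and_comm]
      refine induceIso π ⟨fun x hx => (hmem x).1 hx, π.injective.injOn, fun y hy => ?_⟩ ?_
      · obtain ⟨x, rfl⟩ := π.surjective y
        exact ⟨x, (hmem x).2 hy, rfl⟩
      · intro x hx y hy
        rw [← hinD _ ((hmem x).1 hx) _ ((hmem y).1 hy)]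
        rw [← hBc] at hx hy
        exact hπBc x hx.1 y hy.1
  · have := Set.ncard_le_ncard h (Set.toFinite _)
    omega
  · have hWD : π '' B ⊆ Cᶜ := fun x hx hxC => Set.disjoint_left.1 h hx hxC
    obtain ⟨h1, h2⟩ := hWH.eq_insert_of_ncard hCH.compl hH hWD (by omega)
    have hzW : π z ∉ π '' B := hWH.right_notMem
    have hzC : π z ∉ C := h2 ▸ hr'
    have hWc : π '' (insert d C) = insert (π z) C := by
      rw [← hBc, hcompl, ← compl_compl C, h1]
      ext x
      simp only [Set.mem_compl_iff, Set.mem_insert_iff, not_or]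
      by_cases hxz : x = π z <;> simp [hxz, hzW]
    obtain ⟨E1, hE1, -⟩ := exists_addLeaf_induce_iso (G := T) hdC hC.left_mem
      (fun x hx => ⟨fun hxd => (hC.unique hx hdC hxd.symm).1,
        by rintro rfl; exact hC.adj.symm⟩) rfl
    obtain ⟨E2, hE2, -⟩ := exists_addLeaf_induce_iso (G := H) hzC hr
      (fun x hx => ⟨fun hxd => (hCH.unique hx hzC hxd.symm).1,
        by rintro rfl; exact h2 ▸ hCH.adj.symm⟩) rfl
    have hHC : H.induce C = T.induce C := by
      ext x y
      exact hinC x x.2 y y.2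
    have E3 : T.induce (insert d C) ≃g H.induce (insert (π z) C) :=
      induceIso π ⟨fun x hx => hWc ▸ ⟨x, hx, rfl⟩, π.injective.injOn, hWc.symm.subset⟩
        (fun x hx y hy => hπBc x (hBc.symm ▸ hx : x ∈ Bᶜ) y (hBc.symm ▸ hy : y ∈ Bᶜ))
    have E4 := (E1.trans E3).trans E2.symm
    rw [hHC] at E4
    -- Here `π` maps `C + d` onto `C` plus one vertex. Thus attaching a leaf to `C` at `c` or at `r`
    -- gives isomorphic trees, and some automorphism of `C` takes `c` to `r`.
    obtain ⟨α, hα⟩ := IsTree.exists_iso_of_addLeaf_iso _ (hC.isTree_induce hT) rfl E4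
    have hHD : H.induce Cᶜ = T.induce Cᶜ := by
      ext x y
      exact hinD x x.2 y y.2
    obtain ⟨F1, hF1, -⟩ := exists_addLeaf_induce_iso (G := T) hB.right_notMem hB.left_mem
      (fun x hx => ⟨fun hxd => (hB.unique hx hB.right_notMem hxd.symm).1,
        by rintro rfl; exact hB.adj.symm⟩) hdB
    obtain ⟨F2, hF2, -⟩ := exists_addLeaf_induce_iso (G := H) hzW hWH.left_mem
      (fun x hx => ⟨fun hxd => (hWH.unique hx hzW hxd.symm).1,
        by rintro rfl; exact hWH.adj.symm⟩) h1.symm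
    let F3 : T.induce B ≃g H.induce (π '' B) :=
      induceIso π ⟨Set.mapsTo_image _ _, π.injective.injOn, Set.surjOn_image _ _⟩ hπB
    have F4 := (F1.trans (hHD ▸ F2.symm)).trans
      (addLeafCongr F3 (p := ⟨w, hw⟩) (q := ⟨π w, hWH.left_mem⟩) rfl).symm
    obtain ⟨β, hβ⟩ := IsTree.exists_iso_of_addLeaf_iso _ (hB.isTree_induce hT) rfl F4
    -- In the same way `β` takes `o` to `w` in `D - d`. It extends to the attached leaf `d`, which
    -- goes to `π z = r'`, so `α` and `γ` match the ends of the bridges.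
    let γ := ((F1.symm.trans (addLeafCongr β hβ)).trans
      (addLeafCongr F3 (p := ⟨w, hw⟩) (q := ⟨π w, hWH.left_mem⟩) rfl)).trans F2
    have hγ : γ ⟨d, hdC⟩ = ⟨r', hr'⟩ := by
      have : F1.symm ⟨d, hdC⟩ = none := by
        rw [RelIso.symm_apply_eq]
        exact Subtype.ext hF1.symm
      apply Subtype.ext
      simp only [γ, RelIso.trans_apply]
      rw [this]
      exact hF2.trans h2.symm
    obtain ⟨α', hα'⟩ : ∃ α' : T.induce C ≃g H.induce C,
        α' ⟨c, hC.left_mem⟩ = ⟨r, hr⟩ := by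
      rw [hHC]
      exact ⟨α, hα⟩
    exact nonempty_iso_of_glue_induce hC hCH α' γ hα' hγ
  · have h3 : (π '' B ∪ C).ncard ≤ (π '' B).ncard + C.ncard := Set.ncard_union_le _ _
    rw [h, Set.ncard_univ] at h3
    omega

end PendantVertex

/-! ### Positions of two cuts determined by sizes. -/

section Nested

variable {V : Type*} {H : SimpleGraph V} [Finite V]

/-- Two complementary pairs of cut sides of equal size coincide. -/
lemma IsCut.eq_or_eq_compl {A B : Set V} {a b a' b' : V} (hA : IsCut H A a b)
    (hB : IsCut H B a' b') (hH : H.Preconnected) (h : A.ncard = B.ncard)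
    (h' : B.ncard = Bᶜ.ncard) : A = B ∨ A = Bᶜ := by
  have h1 := Set.ncard_add_ncard_compl A
  have h2 := Set.ncard_add_ncard_compl B
  rcases hA.nested hB hH with h3 | h3 | h3 | h3
  · exact Or.inl (Set.eq_of_subset_of_ncard_le h3 h.ge)
  · exact Or.inl (Set.eq_of_subset_of_ncard_le h3 h.le).symm
  · exact Or.inr (Set.eq_of_subset_of_ncard_le h3.subset_compl_right (by omega))
  · have : Bᶜ ⊆ A := fun x hx => ((h3 ▸ Set.mem_univ x : x ∈ A ∪ B)).resolve_right hx
    exact Or.inr (Set.eq_of_subset_of_ncard_le this (by omega)).symm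

/-- A cut side smaller than both sides of another cut is contained in one of them. -/
lemma IsCut.subset_or_subset_compl {A B : Set V} {a b a' b' : V} (hA : IsCut H A a b)
    (hB : IsCut H B a' b') (hH : H.Preconnected) (h : A.ncard < B.ncard)
    (h' : A.ncard < Bᶜ.ncard) : A ⊆ B ∨ A ⊆ Bᶜ := by
  have h1 := Set.ncard_add_ncard_compl B
  rcases hA.nested hB hH with h3 | h3 | h3 | h3
  · exact Or.inl h3
  · exact absurd (Set.ncard_le_ncard h3) (by omega)
  · exact Or.inr h3.subset_compl_right
  · have := Set.ncard_union_le A B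
    rw [h3, Set.ncard_univ] at this
    omega

end Nested

/-! ### The cards of the centroidal edge and of a leaf. -/

section Leaf

variable {V : Type u} {T : SimpleGraph V}

lemma isCut_singleton {l p : V} (h : ∀ x, T.Adj l x ↔ x = p) : IsCut T {l} l p :=
  ⟨rfl, fun h' => T.loopless.irrefl l ((h l).2 (Set.mem_singleton_iff.1 h').symm),
    (h p).2 rfl, fun x y hx _ hxy => by
      rw [Set.mem_singleton_iff] at hx
      subst hx
      exact ⟨rfl, (h y).1 hxy⟩⟩

/-- Suppose that the end `c` of the centroidal edge has two neighbours in its centroidal component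
`C`, and that a leaf `l` of the other component cannot be moved inside this component without
changing its isomorphism type. Then `T` is determined by the cards of `cd` and of the edge at `l`. -/
theorem ern_le_two_of_leaf [Finite V] (hT : T.IsTree) {C : Set V} {c d o l p c₁ c₂ : V}
    (hC : IsCut T C c d) (hcard : C.ncard = Cᶜ.ncard)
    (hdeg : ∀ v ∈ C, ¬ T.HasThreeNeighborsIn C v) (hoC : o ∉ C)
    (ho : T.HasThreeNeighborsIn Cᶜ o) (h₁ : c₁ ∈ C) (h₂ : c₂ ∈ C) (h₁₂ : c₁ ≠ c₂)
    (hc₁ : T.Adj c c₁) (hc₂ : T.Adj c c₂) (hlC : l ∉ C) (hld : l ≠ d)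
    (hl : ∀ x, T.Adj l x ↔ x = p)
    (hmove : ∀ q ∉ C, q ≠ l → ((T.moveEdge l p l q).induce Cᶜ ≃g T.induce Cᶜ) → q = p) :
    T.ern ≤ 2 := by
  have hc := hT.1.preconnected
  have hdC := hC.right_notMem
  have hL := isCut_singleton hl
  have hCc : 3 ≤ C.ncard := by
    have := (Set.two_lt_ncard (Set.toFinite C)).2
      ⟨c, hC.left_mem, c₁, h₁, c₂, h₂, hc₁.ne, hc₂.ne, h₁₂⟩
    omega
  have hsum := Set.ncard_add_ncard_compl C
  have hsum' := Set.ncard_add_ncard_compl ({l} : Set V)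
  rw [Set.ncard_singleton] at hsum'
  refine ern_le_two hc hC hL (by rw [Set.ncard_singleton]; omega) (by omega) ?_
  intro r hr r' hr' l' hl' q hq π
  obtain rfl : l = l' := (Set.mem_singleton_iff.1 hl').symm
  have hql : q ≠ l := hq
  have hH := hC.preconnected_moveEdge hc hr hr'
  have hCH := hC.moveEdge hr hr'
  have hinC : ∀ x ∈ C, ∀ y ∈ C, (T.moveEdge c d r r').Adj x y ↔ T.Adj x y :=
    fun x hx y hy => hC.moveEdge_adj_of_mem hr hr' hx hy
  have hinD : ∀ x ∉ C, ∀ y ∉ C, (T.moveEdge c d r r').Adj x y ↔ T.Adj x y :=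
    fun x hx y hy => hC.moveEdge_adj_of_notMem hr hr' hx hy
  have hkeep : ∀ x ≠ l, ∀ y ≠ l, (T.moveEdge l p l q).Adj x y ↔ T.Adj x y :=
    fun x hx y hy => hL.moveEdge_adj_of_notMem rfl hq hx hy
  have hCl : ∀ x ∈ C, x ≠ l := fun x hx h => hlC (h ▸ hx)
  have hlD : ({l} : Set V) ⊆ Cᶜ := Set.singleton_subset_iff.2 hlC
  -- If the leaf is reattached in `C`, the image of `D - l` lies in `C` or `Cᶜ` and misses just one
  -- vertex of it, namely `π c`. The images of `c₁` and `c₂` are then neighbours of `π c` across a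
  -- single bridge.
  by_cases hqC : q ∈ C
  · exfalso
    have hX := (hL.moveEdge_diff hC.compl hlD (fun h => hld h.symm) rfl
      (show q ∉ Cᶜ from fun h => h hqC)).map π
    generalize T.moveEdge c d r r' = H at *
    have hXcard : (π '' (Cᶜ \ {l})).ncard + 1 = Cᶜ.ncard := by
      rw [Set.ncard_image_of_injective _ π.injective]
      exact Set.ncard_sdiff_singleton_add_one hlC
    have main : ∀ {A : Set V} {a b : V}, IsCut H A a b → A.ncard = Cᶜ.ncard →
        ¬ π '' (Cᶜ \ {l}) ⊆ A := by
      intro A a b hA hAcard hsub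
      obtain ⟨h3, h4⟩ := hX.eq_insert_of_ncard hA hH hsub (by omega)
      have key : ∀ x ∈ C, T.Adj c x → π x = b := by
        intro x hx hcx
        have hadj : H.Adj (π c) (π x) :=
          π.map_adj_iff.2 ((hkeep c (hCl c hC.left_mem) x (hCl x hx)).2 hcx)
        refine (hA.unique (h4 ▸ hA.left_mem) (fun hxA => ?_) hadj).2
        rw [h3] at hxA
        rcases hxA with hxA | hxA
        · exact hcx.ne (π.injective hxA).symm
        · rw [π.injective.mem_set_image] at hxA
          exact hxA.1 hx
      exact h₁₂ (π.injective ((key c₁ h₁ hc₁).trans (key c₂ h₂ hc₂).symm))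
    rcases hX.subset_or_subset_compl hCH hH (by omega) (by omega) with h | h
    · exact main hCH hcard h
    · exact main hCH.compl rfl h
  · have hP := (hL.moveEdge_of_subset hC.compl hlD (fun h => hld h.symm) rfl
      (show q ∈ Cᶜ from hqC)).compl.map π
    rw [compl_compl] at hP
    suffices hqp : q = p by
      subst hqp
      rw [moveEdge_self hL.adj] at π
      exact ⟨π⟩
    generalize T.moveEdge c d r r' = H at *
    -- The image of `C` is a side of half the size. If it is `C`, then `π` restricts to `D` and
    -- `hmove` applies; if it is `Cᶜ`, the branching vertex `o` would lie in a copy of the path.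
    rcases hP.eq_or_eq_compl hCH hH (Set.ncard_image_of_injective _ π.injective) hcard with h | h
    · have hmem : ∀ x, π x ∈ C ↔ x ∈ C := fun x => by
        conv_lhs => rw [← h]
        exact π.injective.mem_set_image
      refine hmove q hqC hql (induceIso π ⟨fun x hx => fun h' => hx ((hmem x).1 h'), π.injective.injOn,
        fun y hy => ?_⟩ fun x hx y hy => ?_)
      · obtain ⟨x, rfl⟩ := π.surjective y
        exact ⟨x, fun h' => hy ((hmem x).2 h'), rfl⟩
      · rw [← π.map_adj_iff]
        exact (hinD _ (fun h' => hx ((hmem x).1 h')) _ (fun h' => hy ((hmem y).1 h'))).symm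
    · exfalso
      have hmem : ∀ x ∉ C, ∃ y ∈ C, π y = x := fun x hx => by
        have : x ∈ π '' C := h ▸ hx
        exact this
      have hinv : ∀ x ∉ C, π.symm x ∈ C := fun x hx => by
        obtain ⟨y, hy, rfl⟩ := hmem x hx
        rwa [RelIso.symm_apply_apply]
      refine hdeg (π.symm o) (hinv o hoC) (ho.image hinv π.symm.injective.injOn ?_)
      intro y hy hoy
      rw [← hkeep _ (hCl _ (hinv o hoC)) _ (hCl _ (hinv y hy)), π.symm.map_adj_iff]
      exact (hinD o hoC y hy).2 hoy

end Leaf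

/-! ### Triangles, and cut sides differing by two vertices. -/

section Aux

variable {V : Type*} {G : SimpleGraph V}

lemma IsAcyclic.not_adj_of_adj_adj (hG : G.IsAcyclic) {a b c : V} (hab : G.Adj a b)
    (hac : G.Adj a c) : ¬ G.Adj b c := by
  intro hbc
  obtain ⟨A, hA⟩ := hG.exists_isCut hab
  by_cases hcA : c ∈ A
  · exact hac.ne (hA.unique hcA hA.right_notMem hbc.symm).1.symm
  · exact hbc.ne (hA.unique hA.left_mem hcA hac).2.symm

/-- A cut side exceeding another one by two vertices. -/
lemma IsCut.exists_eq_insert_insert [Finite V] {A B : Set V} {a b w z : V} (hB : IsCut G B w z)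
    (hA : IsCut G A a b) (hG : G.Preconnected) (hBA : B ⊆ A) (hcard : A.ncard = B.ncard + 2) :
    ∃ s, s ∉ B ∧ s ≠ z ∧ (∀ x, x ∈ A ↔ x = z ∨ x = s ∨ x ∈ B) ∧ G.Adj z s ∧ (a = z ∨ a = s) ∧
      ∀ x ∈ A, G.Adj s x → x = z := by
  have h1 : (A \ B).ncard = 2 := by
    rw [Set.ncard_sdiff hBA]
    omega
  obtain ⟨t, htA, htB⟩ : (A \ B).Nonempty := by
    rw [← Set.ncard_pos]
    omega
  obtain ⟨u, hu, y, hy, hyB, huy⟩ := hA.exists_adj_inside hG hBA hB.left_mem htA htB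
  obtain rfl := (hB.unique hu hyB huy).2
  have h2 : ((A \ B) \ {y}).ncard = 1 := by
    rw [Set.ncard_sdiff_singleton_of_mem (show y ∈ A \ B from ⟨hy, hyB⟩), h1]
  obtain ⟨s, hs⟩ := Set.ncard_eq_one.1 h2
  have hsA : s ∈ (A \ B) \ {y} := hs ▸ rfl
  have hsy : s ≠ y := hsA.2
  have hmem : ∀ x, x ∈ A ↔ x = y ∨ x = s ∨ x ∈ B := by
    intro x
    constructor
    · intro hx
      by_contra! hcon
      have : x ∈ (A \ B) \ {y} := ⟨⟨hx, hcon.2.2⟩, hcon.1⟩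
      rw [hs] at this
      exact hcon.2.1 this
    · rintro (rfl | rfl | h)
      exacts [hy, hsA.1.1, hBA h]
  have hsnbr : ∀ x ∈ A, G.Adj s x → x = y := by
    intro x hx hsx
    rcases (hmem x).1 hx with rfl | rfl | h
    · rfl
    · exact absurd rfl hsx.ne
    · exact absurd (hB.unique h hsA.1.2 hsx.symm).2 hsy
  refine ⟨s, hsA.1.2, hsy, hmem, ?_, ?_, hsnbr⟩
  · obtain ⟨x, hx, v, hv, hvx, hxv⟩ := hA.exists_adj_inside hG (S := insert y B)
      (Set.insert_subset hy hBA) (Set.mem_insert y B) hsA.1.1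
      (by rintro (h | h); exacts [hsy h, hsA.1.2 h])
    have hvs : v = s := by
      rcases (hmem v).1 hv with h | h | h
      exacts [absurd (Or.inl h) hvx, h, absurd (Or.inr h) hvx]
    subst hvs
    rcases hx with rfl | hx
    · exact hxv
    · exact absurd (hB.unique hx hsA.1.2 hxv).2 hsy
  · rcases (hmem a).1 hA.left_mem with h | h | h
    · exact Or.inl h
    · exact Or.inr h
    · exact absurd ((hB.unique h (fun h' => hA.right_notMem (hBA h')) hA.adj).2 ▸ hy)
        hA.right_notMem

end Aux

/-! ### Graphs sharing the cards of a pendant edge and a leaf. -/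

section SharedCards

variable {V : Type u}

/-- A graph `H` on the vertices of `T` which arises from `T` by attaching elsewhere the pendant
edge spanned by `J`, and also, up to the bijection `π`, by attaching the leaf `l` elsewhere. -/
structure SharesCards (T H : SimpleGraph V) (C J : Set V) (c d l p j r q : V) (π : V ≃ V) :
    Prop where
  isTree : T.IsTree
  cut : IsCut T C c d
  ncard_eq : C.ncard = Cᶜ.ncard
  subset : J ⊆ C
  left_notMem : c ∉ J
  ncard_pendant : J.ncard = 2
  leaf_notMem : l ∉ C
  leaf_ne : l ≠ d
  adj_leaf : ∀ x, T.Adj l x ↔ x = p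
  preconnected : H.Preconnected
  cut_pendant : IsCut H J j r
  adj_pendant : ∀ x ∈ J, ∀ y ∈ J, x ≠ y → H.Adj x y
  adj_iff : ∀ x ∉ J, ∀ y ∉ J, H.Adj x y ↔ T.Adj x y
  adj_map_iff : ∀ x ≠ l, ∀ y ≠ l, H.Adj (π x) (π y) ↔ T.Adj x y
  adj_map_leaf : ∀ y, H.Adj (π l) y ↔ y = π q

namespace SharesCards

variable {T H : SimpleGraph V} {C J : Set V} {c d l p j r q : V} {π : V ≃ V}

lemma nonempty_iso_of_eq (h : SharesCards T H C J c d l p j r q π) (hqp : q = p) :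
    Nonempty (T ≃g H) := by
  refine ⟨⟨π, ?_⟩⟩
  intro x y
  subst hqp
  by_cases hx : x = l
  · rw [hx, h.adj_map_leaf, π.injective.eq_iff, h.adj_leaf]
  · by_cases hy : y = l
    · rw [hy, adj_comm, h.adj_map_leaf, π.injective.eq_iff, adj_comm, h.adj_leaf]
    · exact h.adj_map_iff x hx y hy

/-- The edge `cd` survives in `H` twice, as `cd` itself and as its image under `π`. Its sides change
only if `J`, respectively the leaf, is reattached across it, which accounts for this cut and the
next ones. -/
lemma cut_sdiff (h : SharesCards T H C J c d l p j r q π) (hr : r ∉ C) :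
    IsCut H (C \ J) c d := by
  have hdJ : d ∉ J := fun hd => h.cut.right_notMem (h.subset hd)
  refine ⟨⟨h.cut.left_mem, h.left_notMem⟩, fun hd => h.cut.right_notMem hd.1,
    (h.adj_iff _ h.left_notMem _ hdJ).2 h.cut.adj, ?_⟩
  intro x y hx hy hxy
  by_cases hyJ : y ∈ J
  · exact absurd ((h.cut_pendant.unique hyJ hx.2 hxy.symm).2 ▸ hx.1) hr
  · exact h.cut.unique hx.1 (fun hyC => hy ⟨hyC, hyJ⟩) ((h.adj_iff _ hx.2 _ hyJ).1 hxy)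

lemma cut_left (h : SharesCards T H C J c d l p j r q π) (hr : r ∈ C) : IsCut H C c d := by
  have hdJ : d ∉ J := fun hd => h.cut.right_notMem (h.subset hd)
  refine ⟨h.cut.left_mem, h.cut.right_notMem, (h.adj_iff _ h.left_notMem _ hdJ).2 h.cut.adj, ?_⟩
  intro x y hx hy hxy
  have hyJ : y ∉ J := fun hyJ => hy (h.subset hyJ)
  by_cases hxJ : x ∈ J
  · exact absurd ((h.cut_pendant.unique hxJ hyJ hxy).2 ▸ hr) hy
  · exact h.cut.unique hx hy ((h.adj_iff _ hxJ _ hyJ).1 hxy)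

lemma ne_leaf (h : SharesCards T H C J c d l p j r q π) {x : V} (hx : x ∈ C) : x ≠ l :=
  fun hxl => h.leaf_notMem (hxl ▸ hx)

lemma adj_map (h : SharesCards T H C J c d l p j r q π) : H.Adj (π c) (π d) :=
  (h.adj_map_iff _ (h.ne_leaf h.cut.left_mem) _ h.leaf_ne.symm).2 h.cut.adj

lemma cut_image (h : SharesCards T H C J c d l p j r q π) (hq : q ∉ C) :
    IsCut H (π '' C) (π c) (π d) := by
  refine ⟨⟨c, h.cut.left_mem, rfl⟩, fun hd => h.cut.right_notMem
    (π.injective.mem_set_image.1 hd), h.adj_map, ?_⟩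
  rintro _ y ⟨x, hx, rfl⟩ hy hxy
  obtain ⟨y, rfl⟩ := π.surjective y
  rw [π.injective.mem_set_image] at hy
  by_cases hyl : y = l
  · rw [hyl, adj_comm, h.adj_map_leaf, π.injective.eq_iff] at hxy
    exact absurd (hxy ▸ hx) hq
  · obtain ⟨rfl, rfl⟩ := h.cut.unique hx hy ((h.adj_map_iff _ (h.ne_leaf hx) _ hyl).1 hxy)
    exact ⟨rfl, rfl⟩

lemma cut_image_sdiff (h : SharesCards T H C J c d l p j r q π) (hq : q ∈ C) :
    IsCut H (π '' (Cᶜ \ {l})) (π d) (π c) := by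
  refine ⟨⟨d, ⟨h.cut.right_notMem, fun hd => h.leaf_ne hd.symm⟩, rfl⟩, fun hd => ?_,
    h.adj_map.symm, ?_⟩
  · exact (π.injective.mem_set_image.1 hd).1 h.cut.left_mem
  · rintro _ y ⟨x, ⟨hx, hxl⟩, rfl⟩ hy hxy
    obtain ⟨y, rfl⟩ := π.surjective y
    rw [π.injective.mem_set_image] at hy
    by_cases hyl : y = l
    · rw [hyl, adj_comm, h.adj_map_leaf, π.injective.eq_iff] at hxy
      exact absurd hq (hxy ▸ hx)
    · have hyC : y ∈ C := by
        by_contra hyC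
        exact hy ⟨hyC, hyl⟩
      obtain ⟨rfl, rfl⟩ := h.cut.unique hyC hx ((h.adj_map_iff _ hxl _ hyl).1 hxy).symm
      exact ⟨rfl, rfl⟩

/-- Since `l` is not in `C`, the map `π` carries the path `C` isomorphically onto its image, where
no vertex can branch. This produces many of the contradictions below. -/
lemma false_of_three (h : SharesCards T H C J c d l p j r q π)
    (hdeg : ∀ v ∈ C, ¬ T.HasThreeNeighborsIn C v) {v x y z : V} (hv : v ∈ π '' C)
    (hx : x ∈ π '' C) (hy : y ∈ π '' C) (hz : z ∈ π '' C) (hxy : x ≠ y) (hxz : x ≠ z)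
    (hyz : y ≠ z) (hvx : H.Adj v x) (hvy : H.Adj v y) (hvz : H.Adj v z) : False := by
  obtain ⟨v, hv, rfl⟩ := hv
  obtain ⟨x, hx, rfl⟩ := hx
  obtain ⟨y, hy, rfl⟩ := hy
  obtain ⟨z, hz, rfl⟩ := hz
  have hl := h.ne_leaf hv
  exact hdeg v hv ⟨x, hx, y, hy, z, hz, fun e => hxy (congrArg π e), fun e => hxz (congrArg π e),
    fun e => hyz (congrArg π e), (h.adj_map_iff _ hl _ (h.ne_leaf hx)).1 hvx,
    (h.adj_map_iff _ hl _ (h.ne_leaf hy)).1 hvy, (h.adj_map_iff _ hl _ (h.ne_leaf hz)).1 hvz⟩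

lemma mem_image_or (π : V ≃ V) (C : Set V) (l x : V) :
    x ∈ π '' C ∨ x = π l ∨ x ∈ π '' (Cᶜ \ {l}) := by
  obtain ⟨y, rfl⟩ := π.surjective x
  simp only [π.injective.mem_set_image, π.injective.eq_iff, Set.mem_sdiff, Set.mem_compl_iff,
    Set.mem_singleton_iff]
  tauto

lemma adj_compl (h : SharesCards T H C J c d l p j r q π) {x y : V} (hx : x ∉ C) (hy : y ∉ C) :
    H.Adj x y ↔ T.Adj x y :=
  h.adj_iff _ (fun hJ => hx (h.subset hJ)) _ (fun hJ => hy (h.subset hJ))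

lemma ncard_image (π : V ≃ V) (S : Set V) : (π '' S).ncard = S.ncard :=
  Set.ncard_image_of_injective _ π.injective

lemma image_compl (π : V ≃ V) (S : Set V) : (π '' S)ᶜ = π '' Sᶜ :=
  (Set.image_compl_eq π.bijective).symm

lemma ncard_sdiff_leaf [Finite V] (h : SharesCards T H C J c d l p j r q π) :
    (π '' (Cᶜ \ {l})).ncard + 1 = C.ncard := by
  rw [ncard_image, h.ncard_eq]
  exact Set.ncard_sdiff_singleton_add_one h.leaf_notMem

lemma ncard_sdiff_pendant [Finite V] (h : SharesCards T H C J c d l p j r q π) :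
    (C \ J).ncard + 2 = C.ncard := by
  have h1 := Set.ncard_sdiff h.subset
  have h2 := Set.ncard_le_ncard h.subset (Set.toFinite _)
  have h3 := h.ncard_pendant
  omega

/-- Both the pendant edge and the leaf stay in their components. -/
lemma nonempty_iso_of_mem_of_notMem [Finite V] (h : SharesCards T H C J c d l p j r q π)
    (hdeg : ∀ v ∈ C, ¬ T.HasThreeNeighborsIn C v) {o : V} (hoC : o ∉ C)
    (ho : T.HasThreeNeighborsIn Cᶜ o) (hr : r ∈ C) (hq : q ∉ C) : Nonempty (T ≃g H) := by
  have hC := h.cut_left hr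
  have hP := h.cut_image hq
  rcases hP.eq_or_eq_compl hC h.preconnected (ncard_image π C) h.ncard_eq with h1 | h1
  · have h2 := hC.unique (h1 ▸ hP.left_mem) (h1 ▸ hP.right_notMem) hP.adj
    -- On `C` the map `π` is an isomorphism fixing `c`, because it preserves the bridge; on the
    -- complement `H` agrees with `T`, so the identity serves.
    refine h.cut.nonempty_iso_of_glue hC π id ⟨fun x hx => h1 ▸ ⟨x, hx, rfl⟩,
      π.injective.injOn, h1.symm.subset⟩ (Set.bijOn_id _) h2.1 rfl ?_ ?_
    · intro x hx y hy
      exact h.adj_map_iff _ (h.ne_leaf hx) _ (h.ne_leaf hy)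
    · intro x hx y hy
      exact h.adj_compl hx hy
  · obtain ⟨x, hx, y, hy, z, hz, hxy, hxz, hyz, h2, h3, h4⟩ := ho
    exact (h.false_of_three hdeg (h1 ▸ hoC) (h1 ▸ hx) (h1 ▸ hy) (h1 ▸ hz) hxy hxz hyz
      ((h.adj_compl hoC hx).2 h2) ((h.adj_compl hoC hy).2 h3) ((h.adj_compl hoC hz).2 h4)).elim

/-- The end `c` cannot be next to the end of a leg inside `R ∪ {d}`. -/
lemma false_of_end (h : SharesCards T H C J c d l p j r q π)
    (hdeg : ∀ v ∈ C, ¬ T.HasThreeNeighborsIn C v)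
    (hpath : ∀ u ∈ C, T.Adj c u → (∀ v ∈ C, T.Adj u v → v = c) →
      ∃ x ∈ C \ J, ∃ y ∈ C \ J, x ≠ y ∧ T.Adj c x ∧ T.Adj c y)
    (hR : C \ J ⊆ π '' C) (hcd : π c = d) {s : V} (hs : s ∈ π '' C) (hds : H.Adj d s)
    (hsd : ∀ x ∈ π '' C, H.Adj s x → x = d) : False := by
  obtain ⟨u, hu, rfl⟩ := hs
  have hlc := h.ne_leaf h.cut.left_mem
  have hlu := h.ne_leaf hu
  rw [← hcd] at hds hsd
  -- The hypotheses make `u` an end of the path next to `c`. Then `c` keeps two neighbours in `C \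
  -- J` and, with `d`, has three in the image of `C`.
  obtain ⟨x, hx, y, hy, hxy, hcx, hcy⟩ := hpath u hu ((h.adj_map_iff _ hlc _ hlu).1 hds)
    (fun v hv huv => π.injective (hsd _ ⟨v, hv, rfl⟩
      ((h.adj_map_iff _ hlu _ (h.ne_leaf hv)).2 huv)))
  have hdC := h.cut.right_notMem
  refine h.false_of_three (z := d) hdeg (hR ⟨h.cut.left_mem, h.left_notMem⟩) (hR hx) (hR hy)
    ⟨c, h.cut.left_mem, hcd⟩ hxy (fun e => hdC (e ▸ hx.1)) (fun e => hdC (e ▸ hy.1))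
    ((h.adj_iff _ h.left_notMem _ hx.2).2 hcx) ((h.adj_iff _ h.left_notMem _ hy.2).2 hcy)
    ((h.adj_iff _ h.left_notMem _ (fun hd => hdC (h.subset hd))).2 h.cut.adj)

/-- The pendant edge moves to the other component, the leaf stays, and the rest of `C` lies in the
image of `C`. -/
lemma false_of_sdiff_subset [Finite V] (h : SharesCards T H C J c d l p j r q π)
    (hdeg : ∀ v ∈ C, ¬ T.HasThreeNeighborsIn C v)
    (hpath : ∀ u ∈ C, T.Adj c u → (∀ v ∈ C, T.Adj u v → v = c) →
      ∃ x ∈ C \ J, ∃ y ∈ C \ J, x ≠ y ∧ T.Adj c x ∧ T.Adj c y)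
    (htwo : (∃ x ∉ C, ∃ y ∉ C, x ≠ y ∧ T.Adj d x ∧ T.Adj d y) ∨
      ∃ x ∈ C, ∃ y ∈ C, x ≠ y ∧ T.Adj c x ∧ T.Adj c y)
    (hr : r ∉ C) (hq : q ∉ C) (hsub : C \ J ⊆ π '' C) : False := by
  have hP := h.cut_image hq
  have hR := h.cut_sdiff hr
  have hcards := h.ncard_sdiff_pendant
  -- The image of `C` consists of `C \ J`, of `d` and of one more vertex `s` adjacent to `d`;
  -- moreover `π c` is `d` or `s`.
  obtain ⟨s, hsR, hsd, hmem, hds, hcs, hs⟩ := hR.exists_eq_insert_insert hP h.preconnected hsub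
    (by rw [ncard_image]; omega)
  have hsP : s ∈ π '' C := (hmem s).2 (Or.inr (Or.inl rfl))
  rcases hcs with hcs | hcs
  · exact h.false_of_end hdeg hpath hsub hcs hsP hds hs
  · rcases htwo with ⟨x, hx, y, hy, hxy, hdx, hdy⟩ | ⟨x, hx, y, hy, hxy, hcx, hcy⟩
    · have hdP : d ∈ π '' C := (hmem d).2 (Or.inl rfl)
      have key : ∀ z ∉ C, T.Adj d z → z = s := by
        intro z hz hdz
        have hdz' := (h.adj_compl h.cut.right_notMem hz).2 hdz
        have hzP : z ∈ π '' C := by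
          by_contra hzP
          exact hsd (hcs ▸ (hP.unique hdP hzP hdz').1.symm)
        rcases (hmem z).1 hzP with h1 | h1 | h1
        exacts [absurd h1.symm hdz.ne, h1, absurd h1.1 hz]
      exact hxy ((key x hx hdx).trans (key y hy hdy).symm)
    · have key : ∀ z ∈ C, T.Adj c z → π z = d := fun z hz hcz => hs _ ⟨z, hz, rfl⟩
        (hcs ▸ (h.adj_map_iff _ (h.ne_leaf h.cut.left_mem) _ (h.ne_leaf hz)).2 hcz)
      exact hxy (π.injective ((key x hx hcx).trans (key y hy hcy).symm))

end SharesCards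

end SharedCards

/-! ### Excluding the positions of the pieces in `H`. -/

namespace SharesCards

variable {V : Type u} {T H : SimpleGraph V} {C J : Set V} {c d l p j r q : V} {π : V ≃ V}

/-- The pendant edge moves to the other component, the leaf stays, and the rest of `C` avoids the
image of `C`, where `d` has two neighbours in its component. -/
lemma nonempty_iso_of_disjoint_of_two [Finite V] (h : SharesCards T H C J c d l p j r q π)
    (htwo : ∃ x ∉ C, ∃ y ∉ C, x ≠ y ∧ T.Adj d x ∧ T.Adj d y)
    (hleaf : ∀ s ∉ C, T.Adj d s → (∀ x, T.Adj s x → x = d) → p = d)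
    (hr : r ∉ C) (hq : q ∉ C) (hsub : C \ J ⊆ (π '' C)ᶜ) : Nonempty (T ≃g H) := by
  have hP := (h.cut_image hq).compl
  have hR := h.cut_sdiff hr
  have hcards := h.ncard_sdiff_pendant
  have hdC := h.cut.right_notMem
  obtain ⟨s, hsR, hsd, hmem, hds, hcs, hs⟩ := hR.exists_eq_insert_insert hP h.preconnected hsub
    (by rw [image_compl, ncard_image, ← h.ncard_eq]; omega)
  have hsP : s ∈ (π '' C)ᶜ := (hmem s).2 (Or.inr (Or.inl rfl))
  have hdP : d ∈ (π '' C)ᶜ := (hmem d).2 (Or.inl rfl)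
  have hnbr : ∀ z ∉ C, T.Adj d z → z = s ∨ (π d = d ∧ z = π c) := by
    intro z hz hdz
    have hdz' := (h.adj_compl hdC hz).2 hdz
    by_cases hzP : z ∈ (π '' C)ᶜ
    · rcases (hmem z).1 hzP with h1 | h1 | h1
      exacts [absurd h1.symm hdz.ne, Or.inl h1, absurd h1.1 hz]
    · have := hP.unique hdP hzP hdz'
      exact Or.inr ⟨this.1.symm, this.2⟩
  obtain ⟨x, hx, y, hy, hxy, hdx, hdy⟩ := htwo
  -- The neighbours of `d` in `D` can only be `s` and the outer end `π c` of the bridge, so both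
  -- occur and the bridge starts at `d`.
  have hπd : π d = d := by
    rcases hnbr x hx hdx with h1 | h1
    · rcases hnbr y hy hdy with h2 | h2
      · exact absurd (h1.trans h2.symm) hxy
      · exact h2.1
    · exact h1.1
  have hsC : s ∉ C := by
    rcases hnbr x hx hdx with h1 | h1
    · exact h1 ▸ hx
    · rcases hnbr y hy hdy with h2 | h2
      · exact h2 ▸ hy
      · exact absurd (h1.2.trans h2.2.symm) hxy
  have hpd : p = d := by
    refine hleaf s hsC ((h.adj_compl hdC hsC).1 hds) fun z hsz => ?_
    have hz : z ∉ C := fun hz => hsd (h.cut.unique hz hsC hsz.symm).2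
    have hsz' := (h.adj_compl hsC hz).2 hsz
    refine hs z ?_ hsz'
    by_contra hzP
    exact hsd ((hP.unique hsP hzP hsz').1.trans hπd)
  refine h.nonempty_iso_of_eq ?_
  -- Now `s` is a leaf at `d`, whence `p = d`. If `q ≠ p`, then `c` and `s`, both neighbours of `d`
  -- in `H`, come from neighbours of `d` in `D` other than `l`; with `l` this makes three, while
  -- only `s` and `π c` are available.
  by_contra hqp
  have hlD : ¬ H.Adj (π l) d := by
    rw [h.adj_map_leaf, ← hπd, π.injective.eq_iff]
    exact fun hdq => hqp (hdq.symm.trans hpd.symm)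
  have key : ∀ v, v ∈ (π '' C)ᶜ → H.Adj d v → ∃ a ∉ C, a ≠ l ∧ π a = v ∧ T.Adj d a := by
    intro v hv hdv
    rw [image_compl] at hv
    obtain ⟨a, ha, rfl⟩ := hv
    have hal : a ≠ l := by
      rintro rfl
      exact hlD hdv.symm
    refine ⟨a, ha, hal, rfl, (h.adj_map_iff _ h.leaf_ne.symm _ hal).1 ?_⟩
    rwa [hπd]
  have hcR : c ∈ C \ J := ⟨h.cut.left_mem, h.left_notMem⟩
  obtain ⟨a, haC, hal, ha, hda⟩ := key c (hsub hcR) hR.adj.symm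
  obtain ⟨b, hbC, hbl, hb, hdb⟩ := key s hsP hds
  have hab : a ≠ b := by
    rintro rfl
    exact hsR (hb ▸ ha ▸ hcR)
  have hdl : T.Adj d l := ((h.adj_leaf d).2 hpd.symm).symm
  have h1 := hnbr a haC hda
  have h2 := hnbr b hbC hdb
  have h3 := hnbr l h.leaf_notMem hdl
  grind

/-- The pendant edge moves to the other component, the leaf stays, and the rest of `C` avoids the
image of `C`, where `d` has a single neighbour in its component. -/
lemma false_of_disjoint_of_one [Finite V] (h : SharesCards T H C J c d l p j r q π)
    {o u v : V} (hoC : o ∉ C) (hdo : T.Adj d o) (hd : ∀ x ∉ C, T.Adj d x → x = o)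
    (huC : u ∉ C) (hvC : v ∉ C) (huv : u ≠ v) (hud : u ≠ d) (hvd : v ≠ d) (hou : T.Adj o u)
    (hov : T.Adj o v)
    (hr : r ∉ C) (hq : q ∉ C) (hsub : C \ J ⊆ (π '' C)ᶜ) : False := by
  have hP := (h.cut_image hq).compl
  have hR := h.cut_sdiff hr
  have hcards := h.ncard_sdiff_pendant
  have hdC := h.cut.right_notMem
  obtain ⟨s, hsR, hsd, hmem, hds, hcs, hs⟩ := hR.exists_eq_insert_insert hP h.preconnected hsub
    (by rw [image_compl, ncard_image, ← h.ncard_eq]; omega)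
  have hsP : s ∈ (π '' C)ᶜ := (hmem s).2 (Or.inr (Or.inl rfl))
  have hdP : d ∈ (π '' C)ᶜ := (hmem d).2 (Or.inl rfl)
  have hnot : ∀ x ∉ C, x ≠ d → x ≠ s → x ∉ (π '' C)ᶜ := by
    intro x hx hxd hxs hxP
    rcases (hmem x).1 hxP with h1 | h1 | h1
    exacts [hxd h1, hxs h1, hx h1.1]
  have hdo' := (h.adj_compl hdC hoC).2 hdo
  -- If `s = o`, the edges `ou` and `ov` both cross a single bridge. Otherwise `do` is that bridge,
  -- and `s` is neither in `J`, whose second vertex would lie across it, nor in `D`, where `d` has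
  -- no other neighbour.
  by_cases hso : s = o
  · subst hso
    have key : ∀ x ∉ C, x ≠ d → T.Adj s x → x = π c := fun x hx hxd hsx =>
      (hP.unique hsP (hnot x hx hxd hsx.ne.symm) ((h.adj_compl hoC hx).2 hsx)).2
    exact huv ((key u huC hud hou).trans (key v hvC hvd hov).symm)
  · have h1 := hP.unique hdP (hnot o hoC hdo.ne.symm (Ne.symm hso)) hdo'
    have hdJ : d ∉ J := fun hJ => hdC (h.subset hJ)
    by_cases hsJ : s ∈ J
    · obtain ⟨s', hs', hss'⟩ : ∃ s' ∈ J, s' ≠ s :=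
        Set.exists_ne_of_one_lt_ncard (by rw [h.ncard_pendant]; omega) s
      have h2 : s' ∉ (π '' C)ᶜ := by
        intro h2
        rcases (hmem s').1 h2 with h3 | h3 | h3
        exacts [hdJ (h3 ▸ hs'), hss' h3, h3.2 hs']
      exact hsd ((hP.unique hsP h2 (h.adj_pendant s hsJ s' hs' hss'.symm)).1.trans h1.1.symm)
    · have hsC : s ∉ C := fun hsC => hsR ⟨hsC, hsJ⟩
      exact hso (hd s hsC ((h.adj_compl hdC hsC).1 hds))

/-- The leaf moves to the path component, the pendant edge stays, and `d` has two neighbours in its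
component. -/
lemma false_of_mem_of_mem_of_two [Finite V] (h : SharesCards T H C J c d l p j r q π)
    (hdeg : ∀ v ∈ C, ¬ T.HasThreeNeighborsIn C v) {o : V} (hoC : o ∉ C)
    (ho : T.HasThreeNeighborsIn Cᶜ o)
    (htwo : ∃ x ∉ C, ∃ y ∉ C, x ≠ y ∧ T.Adj d x ∧ T.Adj d y)
    (hr : r ∈ C) (hq : q ∈ C) : False := by
  have hC := h.cut_left hr
  have hX := h.cut_image_sdiff hq
  have hcards := h.ncard_sdiff_leaf
  have heq := h.ncard_eq
  have hdC := h.cut.right_notMem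
  have hl := h.adj_map_leaf
  obtain ⟨x, hx, y, hy, hxy, hdx, hdy⟩ := htwo
  rw [← h.adj_compl hdC hx] at hdx
  rw [← h.adj_compl hdC hy] at hdy
  rcases hX.subset_or_subset_compl hC h.preconnected (by omega) (by omega) with hsub | hsub
  -- Here `c = π c`, and all of `D` except possibly `π l` lies in the image of the path. As `c` is a
  -- third neighbour of `d`, the leaf must hang at `d`; it then cannot remove the branching at `o`
  -- unless `o = d`, and even there two neighbours besides `c` remain.
  · obtain ⟨h1, h2⟩ := hX.eq_insert_of_ncard hC h.preconnected hsub hcards.symm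
    have hP : ∀ x ∉ C, x ≠ π l → x ∈ π '' C := fun x hx hxl => by
      rcases mem_image_or π C l x with h3 | h3 | h3
      exacts [h3, absurd h3 hxl, absurd (hsub h3) hx]
    have hcP : c ∈ π '' C := ⟨c, h.cut.left_mem, h2.symm⟩
    have hnotl : ∀ v x y, x ≠ y → H.Adj v x → H.Adj v y → v ≠ π l := by
      rintro v x y hxy hvx hvy rfl
      exact hxy (((hl x).1 hvx).trans ((hl y).1 hvy).symm)
    have hthree : ∀ x y, x ∉ C → y ∉ C → x ≠ y → H.Adj d x → H.Adj d y → x ≠ π l →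
        y ≠ π l → False := by
      intro x y hx hy hxy hdx hdy hxl hyl
      refine h.false_of_three hdeg (hP d hdC (hnotl d x y hxy hdx hdy)) (hP x hx hxl)
        (hP y hy hyl) hcP hxy (fun e => hx (e ▸ h.cut.left_mem)) (fun e => hy (e ▸ h.cut.left_mem))
        hdx hdy hC.adj.symm
    have hdq : d = π q := by
      by_contra hdq
      refine hthree x y hx hy hxy hdx hdy ?_ ?_
      · rintro rfl
        exact hdq ((hl d).1 hdx.symm)
      · rintro rfl
        exact hdq ((hl d).1 hdy.symm)
    obtain ⟨a, ha, b, hb, e, he, hab, hae, hbe, hoa, hob, hoe⟩ := ho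
    rw [← h.adj_compl hoC ha] at hoa
    rw [← h.adj_compl hoC hb] at hob
    rw [← h.adj_compl hoC he] at hoe
    have hod : o = d := by
      by_contra hod
      have hne : ∀ x, H.Adj o x → x ≠ π l := by
        rintro _ hox rfl
        exact hod (((hl o).1 hox.symm).trans hdq.symm)
      exact h.false_of_three hdeg (hP o hoC (hnotl o a b hab hoa hob)) (hP a ha (hne a hoa))
        (hP b hb (hne b hob)) (hP e he (hne e hoe)) hab hae hbe hoa hob hoe
    subst hod
    by_cases hal : a = π l
    · exact hthree b e hb he hbe hob hoe (fun h3 => hab (hal.trans h3.symm))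
        (fun h3 => hae (hal.trans h3.symm))
    · by_cases hbl : b = π l
      · exact hthree a e ha he hae hoa hoe hal (fun h3 => hbe (hbl.trans h3.symm))
      · exact hthree a b ha hb hab hoa hob hal hbl
  · obtain ⟨h1, h2⟩ := hX.eq_insert_of_ncard hC.compl h.preconnected hsub (by omega)
    have key : ∀ x ∉ C, H.Adj d x → x = π d := by
      intro x hx hdx
      have hxX : x ∈ π '' (Cᶜ \ {l}) := by
        have : x ∈ insert (π c) (π '' (Cᶜ \ {l})) := h1 ▸ hx
        exact this.resolve_left fun h3 => hdx.ne (h2.trans h3.symm)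
      exact (hX.unique hxX (h2 ▸ hX.right_notMem) hdx.symm).1
    exact hxy ((key x hx hdx).trans (key y hy hdy).symm)

/-- The leaf moves to the path component, the pendant edge stays, and `c` has two neighbours in its
component. -/
lemma false_of_mem_of_mem_of_one [Finite V] (h : SharesCards T H C J c d l p j r q π)
    (htwo : ∃ x ∈ C, ∃ y ∈ C, x ≠ y ∧ T.Adj c x ∧ T.Adj c y)
    (hr : r ∈ C) (hq : q ∈ C) : False := by
  have hC := h.cut_left hr
  have hX := h.cut_image_sdiff hq
  have hcards := h.ncard_sdiff_leaf
  have heq := h.ncard_eq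
  obtain ⟨x, hx, y, hy, hxy, hcx, hcy⟩ := htwo
  have main : ∀ {A : Set V} {a b : V}, IsCut H A a b → A.ncard = C.ncard →
      ¬ π '' (Cᶜ \ {l}) ⊆ A := by
    intro A a b hA hAcard hsub
    obtain ⟨h1, h2⟩ := hX.eq_insert_of_ncard hA h.preconnected hsub (by omega)
    have key : ∀ x ∈ C, T.Adj c x → π x = b := by
      intro x hx hcx
      refine (hA.unique (h2 ▸ hA.left_mem) (fun hxA => ?_)
        ((h.adj_map_iff _ (h.ne_leaf h.cut.left_mem) _ (h.ne_leaf hx)).2 hcx)).2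
      rw [h1] at hxA
      rcases hxA with hxA | hxA
      · exact hcx.ne (π.injective hxA).symm
      · rw [π.injective.mem_set_image] at hxA
        exact hxA.1 hx
    exact hxy (π.injective ((key x hx hcx).trans (key y hy hcy).symm))
  rcases hX.subset_or_subset_compl hC h.preconnected (by omega) (by omega) with hsub | hsub
  · exact main hC rfl hsub
  · exact main hC.compl heq.symm hsub

/-- Both the pendant edge and the leaf move, and the images of the rests are nested; `d` has two
neighbours in its component. -/
lemma false_of_subset_of_two [Finite V] (h : SharesCards T H C J c d l p j r q π)
    (htwo : ∃ x ∉ C, ∃ y ∉ C, x ≠ y ∧ T.Adj d x ∧ T.Adj d y)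
    (hr : r ∉ C) (hq : q ∈ C) (hsub : C \ J ⊆ π '' (Cᶜ \ {l})) : False := by
  have hR := h.cut_sdiff hr
  have hX := h.cut_image_sdiff hq
  have hcards := h.ncard_sdiff_leaf
  have hcards' := h.ncard_sdiff_pendant
  have hdC := h.cut.right_notMem
  obtain ⟨h1, h2⟩ := hR.eq_insert_of_ncard hX h.preconnected hsub (by omega)
  obtain ⟨x, hx, y, hy, hxy, hdx, hdy⟩ := htwo
  have key : ∀ x ∉ C, T.Adj d x → x = π c := by
    intro x hx hdx
    refine (hX.unique (h2 ▸ hX.left_mem) (fun hxX => ?_) ((h.adj_compl hdC hx).2 hdx)).2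
    rw [h1] at hxX
    rcases hxX with h3 | h3
    exacts [hdx.ne h3.symm, hx h3.1]
  exact hxy ((key x hx hdx).trans (key y hy hdy).symm)

/-- Both the pendant edge and the leaf move, and the images of the rests are nested; `d` has a
single neighbour `o` in its component, and `c` a single neighbour in the rest of `C`. -/
lemma false_of_subset_of_one [Finite V] (h : SharesCards T H C J c d l p j r q π)
    (hone : ∀ x ∈ C \ J, ∀ y ∈ C \ J, T.Adj c x → T.Adj c y → x = y)
    {o u v : V} (hoC : o ∉ C) (hdo : T.Adj d o) (hol : o ≠ l)
    (huC : u ∉ C) (hvC : v ∉ C) (huv : u ≠ v) (hud : u ≠ d) (hvd : v ≠ d) (hou : T.Adj o u)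
    (hov : T.Adj o v) (hul : u ≠ l) (hvl : v ≠ l)
    (hr : r ∉ C) (hq : q ∈ C) (hsub : C \ J ⊆ π '' (Cᶜ \ {l})) : False := by
  have hR := h.cut_sdiff hr
  have hX := h.cut_image_sdiff hq
  have hcards := h.ncard_sdiff_leaf
  have hcards' := h.ncard_sdiff_pendant
  obtain ⟨h1, h2⟩ := hR.eq_insert_of_ncard hX h.preconnected hsub (by omega)
  have hmem : ∀ x ∉ C, x ≠ d → x ≠ l → π x ∈ C \ J := by
    intro x hx hxd hxl
    have hxX : π x ∈ π '' (Cᶜ \ {l}) := ⟨x, ⟨hx, hxl⟩, rfl⟩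
    rw [h1] at hxX
    exact hxX.resolve_left fun h3 => hxd (π.injective (h3.trans h2.symm))
  have hoR := hmem o hoC hdo.ne.symm hol
  have hoc : π o = c :=
    (hR.unique hoR hR.right_notMem (h2 ▸ ((h.adj_map_iff _ h.leaf_ne.symm _ hol).2 hdo).symm)).1
  have key : ∀ x ∉ C, x ≠ d → x ≠ l → T.Adj o x → T.Adj c (π x) := by
    intro x hx hxd hxl hox
    rw [← h.adj_iff _ h.left_notMem _ (hmem x hx hxd hxl).2, ← hoc]
    exact (h.adj_map_iff _ hol _ hxl).2 hox
  exact huv (π.injective (hone _ (hmem u huC hud hul) _ (hmem v hvC hvd hvl)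
    (key u huC hud hul hou) (key v hvC hvd hvl hov)))

/-- The three vertices outside the images of the rests, when both the pendant edge and the leaf
move. -/
lemma exists_rest [Finite V] (h : SharesCards T H C J c d l p j r q π) (hr : r ∉ C) (hq : q ∈ C)
    (hdisj : Disjoint (C \ J) (π '' (Cᶜ \ {l}))) :
    d ∉ π '' (Cᶜ \ {l}) ∧ π c ∉ C \ J ∧ ((C \ J) ∪ π '' (Cᶜ \ {l}))ᶜ.ncard = 3 := by
  have hR := h.cut_sdiff hr
  have hX := h.cut_image_sdiff hq
  have hcards := h.ncard_sdiff_leaf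
  have hcards' := h.ncard_sdiff_pendant
  have heq := h.ncard_eq
  have hS : ((C \ J) ∪ π '' (Cᶜ \ {l}))ᶜ.ncard = 3 := by
    have h1 := Set.ncard_add_ncard_compl ((C \ J) ∪ π '' (Cᶜ \ {l}))
    have h2 := Set.ncard_add_ncard_compl C
    rw [Set.ncard_union_eq hdisj (Set.toFinite _) (Set.toFinite _)] at h1
    have h3 : 0 < C.ncard := (Set.ncard_pos (Set.toFinite _)).2 ⟨c, h.cut.left_mem⟩
    omega
  have hdX : d ∉ π '' (Cᶜ \ {l}) := by
    -- Otherwise the bridge at `C \ J` and the bridge at the image of `D - l` coincide, and no edge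
    -- reaches the three remaining vertices.
    intro hdX
    have h1 := hX.unique hdX (Set.disjoint_left.1 hdisj hR.left_mem) hR.adj.symm
    obtain ⟨s, hs⟩ : (((C \ J) ∪ π '' (Cᶜ \ {l}))ᶜ).Nonempty := by
      rw [← Set.ncard_pos]
      omega
    obtain ⟨x, hx, y, hy, hxy⟩ := h.preconnected.exists_adj_of_mem_of_notMem
      (S := (C \ J) ∪ π '' (Cᶜ \ {l})) (Or.inl hR.left_mem) hs
    rcases hx with hx | hx
    · exact hy (Or.inr ((hR.unique hx (fun h3 => hy (Or.inl h3)) hxy).2 ▸ hdX))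
    · have h2 := (hX.unique hx (fun h3 => hy (Or.inr h3)) hxy).2
      exact hy (Or.inl (h2 ▸ h1.2 ▸ hR.left_mem))
  refine ⟨hdX, fun hcR => ?_, hS⟩
  have := hR.unique hcR (Set.disjoint_right.1 hdisj hX.left_mem) hX.adj.symm
  exact hdX (this.2 ▸ hX.left_mem)

/-- Both the pendant edge and the leaf move; `d` has a single neighbour `o` in its component, and
`c` has two neighbours in `C`, none of which is a leaf of `C`. -/
lemma false_of_disjoint_images_of_one [Finite V] (h : SharesCards T H C J c d l p j r q π)
    {o u v : V} (hoC : o ∉ C) (hdo : T.Adj d o) (hd : ∀ x ∉ C, T.Adj d x → x = o)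
    (huC : u ∉ C) (hvC : v ∉ C) (huv : u ≠ v) (hud : u ≠ d) (hvd : v ≠ d) (hou : T.Adj o u)
    (hov : T.Adj o v)
    (htwo : ∃ x ∈ C, ∃ y ∈ C, x ≠ y ∧ T.Adj c x ∧ T.Adj c y)
    (hlong : ∀ x ∈ C, T.Adj c x → ∃ y ∈ C, y ≠ c ∧ T.Adj x y)
    (hr : r ∉ C) (hq : q ∈ C) (hdisj : Disjoint (C \ J) (π '' (Cᶜ \ {l}))) : False := by
  have hR := h.cut_sdiff hr
  have hX := h.cut_image_sdiff hq
  have hdC := h.cut.right_notMem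
  obtain ⟨hdX, hcR, hS⟩ := h.exists_rest hr hq hdisj
  generalize hSdef : ((C \ J) ∪ π '' (Cᶜ \ {l}))ᶜ = S at hS
  have hmem : ∀ x, x ∉ C \ J → x ∉ π '' (Cᶜ \ {l}) → x ∈ S := by
    intro x h1 h2
    rw [← hSdef]
    rintro (h3 | h3)
    exacts [h1 h3, h2 h3]
  have hdS : d ∈ S := hmem d hR.right_notMem hdX
  have hcS : π c ∈ S := hmem _ hcR hX.right_notMem
  have hnotR : ∀ x ∉ C, x ∉ C \ J := fun x hx hx' => hx hx'.1
  have hnbr : ∀ x ∈ S, ∀ y, x ≠ d → x ≠ π c → H.Adj x y → y ∈ S := by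
    intro x hx y hxd hxc hxy
    rw [← hSdef] at hx
    refine hmem y (fun hy => ?_) (fun hy => ?_)
    · exact hxd (hR.unique hy (fun h1 => hx (Or.inl h1)) hxy.symm).2
    · exact hxc (hX.unique hy (fun h1 => hx (Or.inr h1)) hxy.symm).2
  have hou' := (h.adj_compl hoC huC).2 hou
  have hov' := (h.adj_compl hoC hvC).2 hov
  have hdo' := (h.adj_compl hdC hoC).2 hdo
  have hcl := h.ne_leaf h.cut.left_mem
  have hfour : ∀ {x y z w : V}, x ∈ S → y ∈ S → z ∈ S → w ∈ S → x ≠ y → x ≠ z → x ≠ w →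
      y ≠ z → y ≠ w → z = w := by
    intro x y z w hx hy hz hw hxy hxz hxw hyz hyw
    by_contra hzw
    have : ({x, y, z, w} : Set V).ncard = 4 := by
      rw [Set.ncard_insert_of_notMem, Set.ncard_insert_of_notMem, Set.ncard_pair hzw] <;>
        simp [*]
    have h2 := Set.ncard_le_ncard (s := {x, y, z, w}) (t := S)
      (by rintro a (rfl | rfl | rfl | rfl) <;> assumption) (Set.toFinite _)
    omega
  -- The three remaining vertices are joined to the two rests only through `d` and `π c`. If these
  -- coincide, `u` and `v` collapse to `π o` or four vertices lie among the three; if not, following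
  -- the path `C` two steps from `c` closes a triangle.
  by_cases hcd : d = π c
  · by_cases hoX : o ∈ π '' (Cᶜ \ {l})
    · have hoδ := (hX.unique hoX hdX hdo'.symm).1
      have key : ∀ x ∉ C, x ≠ d → H.Adj o x → x = π o := by
        intro x hx hxd hox
        have hxX : x ∈ π '' (Cᶜ \ {l}) := by
          by_contra hxX
          exact hxd ((hX.unique hoX hxX hox).2.trans hcd.symm)
        obtain ⟨a, ⟨haC, hal⟩, rfl⟩ := hxX
        rw [hoδ, h.adj_map_iff _ h.leaf_ne.symm _ hal] at hox
        rw [hd a haC hox]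
      exact huv ((key u huC hud hou').trans (key v hvC hvd hov').symm)
    · have hoS := hmem o (hnotR o hoC) hoX
      have hod := hdo.ne.symm
      have huS := hnbr o hoS u hod (hcd ▸ hod) hou'
      have hvS := hnbr o hoS v hod (hcd ▸ hod) hov'
      exact huv (hfour hdS hoS huS hvS hdo.ne hud.symm hvd.symm hou.ne hov.ne)
  · have hPS : ∀ x ∈ C, T.Adj c x → π x ∈ S := by
      intro x hx hcx
      have hadj := (h.adj_map_iff _ hcl _ (h.ne_leaf hx)).2 hcx
      refine hmem _ (fun hxR => ?_) (fun hxX => (π.injective.mem_set_image.1 hxX).1 hx)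
      exact hcd (hR.unique hxR hcR hadj.symm).2.symm
    obtain ⟨x, hx, y, hy, hxy, hcx, hcy⟩ := htwo
    wlog hxd : π x ≠ d generalizing x y
    · refine this y hy x hx hxy.symm hcy hcx fun hyd => hxy (π.injective ?_)
      rw [hyd]
      exact not_not.1 hxd
    have hyd : π y = d := by
      by_contra hyd
      exact hcx.ne (π.injective (hfour hdS (hPS y hy hcy) hcS (hPS x hx hcx) (Ne.symm hyd) hcd
        (Ne.symm hxd) (fun e => hcy.ne (π.injective e).symm) (fun e => hxy (π.injective e).symm)))
    obtain ⟨w, hw, hwc, hxw⟩ := hlong x hx hcx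
    have hwS : π w ∈ S := hnbr _ (hPS x hx hcx) _ hxd (fun e => hcx.ne (π.injective e).symm)
      ((h.adj_map_iff _ (h.ne_leaf hx) _ (h.ne_leaf hw)).2 hxw)
    have hwy : w = y := by
      apply π.injective
      rw [hyd]
      exact hfour (hPS x hx hcx) hcS hwS hdS (fun e => hcx.ne (π.injective e).symm)
        (fun e => hxw.ne (π.injective e)) hxd (fun e => hwc (π.injective e).symm) (Ne.symm hcd)
    exact h.isTree.2.not_adj_of_adj_adj hcx hcy (hwy ▸ hxw)

end SharesCards

lemma _root_.List.Nodup.length_le_ncard {α : Type*} [Finite α] {L : List α} (hL : L.Nodup)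
    {A : Set α} (h : ∀ x ∈ L, x ∈ A) : L.length ≤ A.ncard := by
  classical
  rw [← List.toFinset_card_of_nodup hL, ← Set.ncard_coe_finset]
  exact Set.ncard_le_ncard (fun x hx => h x (List.mem_toFinset.1 hx)) (Set.toFinite _)

/-! ### Both parts move and the rests are disjoint. -/

namespace SharesCards

variable {V : Type u} {T H : SimpleGraph V} {C J : Set V} {c d l p j r q : V} {π : V ≃ V}

/-- The two bridges enter the remaining three vertices at `d` and at `π c`, so any other one of them
has all its neighbours among the three. -/
lemma notMem_of_adj (h : SharesCards T H C J c d l p j r q π) (hr : r ∉ C) (hq : q ∈ C) {x y : V}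
    (hx : x ∉ C \ J) (hx' : x ∉ π '' (Cᶜ \ {l})) (hxd : x ≠ d) (hxc : x ≠ π c)
    (hxy : H.Adj x y) : y ∉ C \ J ∧ y ∉ π '' (Cᶜ \ {l}) :=
  ⟨fun hy => hxd ((h.cut_sdiff hr).unique hy hx hxy.symm).2,
    fun hy => hxc ((h.cut_image_sdiff hq).unique hy hx' hxy.symm).2⟩

/-- Both the pendant edge and the leaf move, and the two new edges have different ends outside the
rests. -/
lemma false_of_disjoint_of_ne [Finite V] (h : SharesCards T H C J c d l p j r q π)
    {o : V} (hoC : o ∉ C) (ho : T.HasThreeNeighborsIn Cᶜ o)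
    (htwo : ∃ x ∉ C, ∃ y ∉ C, x ≠ y ∧ T.Adj d x ∧ T.Adj d y)
    (hleaf : ∀ s ∉ C, T.Adj d s → (∀ x, T.Adj s x → x = d) → p = d)
    (hr : r ∉ C) (hq : q ∈ C) (hdisj : Disjoint (C \ J) (π '' (Cᶜ \ {l}))) (hdc : d ≠ π c) :
    False := by
  have hR := h.cut_sdiff hr
  have hX := h.cut_image_sdiff hq
  have hdC := h.cut.right_notMem
  obtain ⟨hdX, hcR, hS⟩ := h.exists_rest hr hq hdisj
  have hnotR : ∀ x ∉ C, x ∉ C \ J := fun x hx hx' => hx hx'.1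
  have hfour : ∀ {x y z w : V}, x ∉ C \ J → x ∉ π '' (Cᶜ \ {l}) → y ∉ C \ J →
      y ∉ π '' (Cᶜ \ {l}) → z ∉ C \ J → z ∉ π '' (Cᶜ \ {l}) → w ∉ C \ J → w ∉ π '' (Cᶜ \ {l}) →
      x ≠ y → x ≠ z → x ≠ w → y ≠ z → y ≠ w → z = w := by
    intro x y z w hx hx' hy hy' hz hz' hw hw' hxy hxz hxw hyz hyw
    by_contra hzw
    have := List.Nodup.length_le_ncard (L := [x, y, z, w]) (by simp [*])
      (A := ((C \ J) ∪ π '' (Cᶜ \ {l}))ᶜ) (by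
        intro t ht
        rw [Set.mem_compl_iff, Set.mem_union, not_or]
        simp only [List.mem_cons, List.not_mem_nil, or_false] at ht
        rcases ht with rfl | rfl | rfl | rfl
        exacts [⟨hx, hx'⟩, ⟨hy, hy'⟩, ⟨hz, hz'⟩, ⟨hw, hw'⟩])
    simp only [List.length_cons, List.length_nil] at this
    omega
  have hdX' : ∀ x, H.Adj d x → x ∉ π '' (Cᶜ \ {l}) := fun x hdx hxX =>
    hdc (hX.unique hxX hdX hdx.symm).2
  obtain ⟨s, hsC, hsc, hds, hbC, hdb⟩ : ∃ s ∉ C, s ≠ π c ∧ T.Adj d s ∧ π c ∉ C ∧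
      T.Adj d (π c) := by
    obtain ⟨x, hx, y, hy, hxy, hdx, hdy⟩ := htwo
    have hxX := hdX' x ((h.adj_compl hdC hx).2 hdx)
    have hyX := hdX' y ((h.adj_compl hdC hy).2 hdy)
    by_cases hxc : x = π c
    · exact ⟨y, hy, fun e => hxy (hxc.trans e.symm), hdy, hxc ▸ hx, hxc ▸ hdx⟩
    · have := hfour (hnotR d hdC) hdX (hnotR x hx) hxX (hnotR y hy) hyX hcR hX.right_notMem hdx.ne
        hdy.ne hdc hxy hxc
      exact ⟨x, hx, hxc, hdx, this ▸ hy, this ▸ hdy⟩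
  generalize hbdef : π c = b at *
  have hsX := hdX' s ((h.adj_compl hdC hsC).2 hds)
  have hbX := hdX' b ((h.adj_compl hdC hbC).2 hdb)
  have hrest : ∀ x ∉ C, x ∉ π '' (Cᶜ \ {l}) → x = d ∨ x = b ∨ x = s := by
    intro x hx hxX
    by_contra! hcon
    exact hcon.2.2 (hfour (hnotR d hdC) hdX (hnotR b hbC) hbX (hnotR x hx) hxX (hnotR s hsC) hsX
      hdb.ne hcon.1.symm hds.ne hcon.2.1.symm hsc.symm)
  have hdnbr : ∀ x ∉ C, T.Adj d x → x = b ∨ x = s := fun x hx hdx =>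
    (hrest x hx (hdX' x ((h.adj_compl hdC hx).2 hdx))).resolve_left hdx.ne.symm
  have hcompl : ∀ {x y}, x ∉ C → x ≠ d → T.Adj x y → y ∉ C := fun hx hxd hxy hy =>
    hxd (h.cut.unique hy hx hxy.symm).2
  have hsb : ¬ T.Adj s b := h.isTree.2.not_adj_of_adj_adj hds hdb
  have hsd : ∀ x, T.Adj s x → x = d := by
    intro x hsx
    have hxC := hcompl hsC hds.ne.symm hsx
    have := (h.notMem_of_adj hr hq (hnotR s hsC) hsX hds.ne.symm (by rwa [hbdef])
      ((h.adj_compl hsC hxC).2 hsx)).2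
    rcases hrest x hxC this with h1 | rfl | rfl
    · exact h1
    · exact absurd hsx hsb
    · exact absurd rfl hsx.ne
  have hpd := hleaf s hsC hds hsd
  have hbnbr : ∀ x ∉ C, T.Adj b x → x = π d ∨ x = d := by
    intro x hx hbx
    by_cases hxX : x ∈ π '' (Cᶜ \ {l})
    · exact Or.inl (hX.unique hxX hbX ((h.adj_compl hbC hx).2 hbx).symm).1
    · rcases hrest x hx hxX with h1 | rfl | rfl
      · exact Or.inr h1
      · exact absurd rfl hbx.ne
      · exact absurd hbx.symm hsb
  have hod : o ≠ d := by
    rintro rfl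
    obtain ⟨x, hx, y, hy, z, hz, hxy, hxz, hyz, h1, h2, h3⟩ := ho
    have := hdnbr x hx h1
    have := hdnbr y hy h2
    have := hdnbr z hz h3
    grind
  have hob : ∀ x, T.HasThreeNeighborsIn Cᶜ x → x ≠ b := by
    rintro _ ⟨x, hx, y, hy, z, hz, hxy, hxz, hyz, h1, h2, h3⟩ rfl
    have := hbnbr x hx h1
    have := hbnbr y hy h2
    have := hbnbr z hz h3
    grind
  have hos : o ≠ s := by
    rintro rfl
    obtain ⟨x, hx, y, hy, z, hz, hxy, hxz, hyz, h1, h2, h3⟩ := ho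
    exact hxy ((hsd x h1).trans (hsd y h2).symm)
  -- The remaining vertices are `d`, `b = π c` and a leaf `s` at `d`, and `l` hangs at `d` too. If
  -- `l` were `b`, the vertices of `D` other than `d`, `l`, `s` would be cut off from the tree.
  have hls : l = s := by
    refine (hdnbr l h.leaf_notMem ((h.adj_leaf d).2 hpd.symm).symm).resolve_left ?_
    rintro rfl
    obtain ⟨x, ⟨hxC, hxd, hxl, hxs⟩, y, hy, hxy⟩ := h.isTree.1.preconnected.exists_adj_of_mem_of_notMem
      (S := {x | x ∉ C ∧ x ≠ d ∧ x ≠ l ∧ x ≠ s}) (s := o) (t := d) ⟨hoC, hod, hob o ho, hos⟩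
      (fun h1 => h1.2.1 rfl)
    have hyC := hcompl hxC hxd hxy
    have hy' : y = d ∨ y = l ∨ y = s := by
      by_contra! hcon
      exact hy ⟨hyC, hcon⟩
    rcases hy' with rfl | rfl | rfl
    · rcases hdnbr x hxC hxy.symm with h1 | h1
      exacts [hxl h1, hxs h1]
    · exact hxd (((h.adj_leaf x).1 hxy.symm).trans hpd)
    · exact hxd (hsd x hxy.symm)
  let B : Set V := {x | x ∉ C ∧ x ≠ d ∧ x ≠ s}
  have hstep : ∀ x ∈ B, π.symm x = c ∨ π.symm x = d ∨ π.symm x ∈ B := by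
    rintro x ⟨hxC, hxd, hxs⟩
    by_cases hxX : x ∈ π '' (Cᶜ \ {l})
    · obtain ⟨a, ⟨haC, hal⟩, rfl⟩ := hxX
      rw [Equiv.symm_apply_apply]
      by_cases had : a = d
      · exact Or.inr (Or.inl had)
      · exact Or.inr (Or.inr ⟨haC, had, fun e => hal (e.trans hls.symm)⟩)
    · left
      have : x = b := by
        rcases hrest x hxC hxX with h1 | h1 | h1
        exacts [absurd h1 hxd, h1, absurd h1 hxs]
      rw [this, ← hbdef, Equiv.symm_apply_apply]
  have hne : ∀ x ∈ B, π.symm x ≠ l := by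
    intro x hx hxl
    rcases hstep x hx with h1 | h1 | h1
    · exact h.ne_leaf h.cut.left_mem (h1.symm.trans hxl)
    · exact h.leaf_ne (hxl.symm.trans h1)
    · exact h1.2.2 (hxl.trans hls)
  have hadj : ∀ x ∈ B, ∀ y ∈ B, T.Adj x y → T.Adj (π.symm x) (π.symm y) := by
    intro x hx y hy hxy
    rw [← h.adj_map_iff _ (hne x hx) _ (hne y hy), Equiv.apply_symm_apply, Equiv.apply_symm_apply,
      h.adj_compl hx.1 hy.1]
    exact hxy
  have hnbr : ∀ x ∈ B, x ≠ b → ∀ y, T.Adj x y → y ∈ B := by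
    intro x hx hxb y hxy
    refine ⟨hcompl hx.1 hx.2.1 hxy, ?_, ?_⟩
    · rintro rfl
      rcases hdnbr x hx.1 hxy.symm with h1 | h1
      exacts [hxb h1, hx.2.2 h1]
    · rintro rfl
      exact hx.2.1 (hsd x hxy.symm)
  -- The inverse of `π` preserves adjacency on `B`, so vertices whose backward orbit stays in `B`
  -- form a set closed under adjacency. It contains the branching vertex `o`, as backward images of
  -- `o` keep branching, but not `b`, whose preimage is `c`. This contradicts connectedness.
  let K : Set V := {x | ∀ i : ℕ, π.symm^[i] x ∈ B}
  have hoK : o ∈ K := by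
    suffices ∀ i : ℕ, π.symm^[i] o ∈ B ∧ T.HasThreeNeighborsIn Cᶜ (π.symm^[i] o) from
      fun i => (this i).1
    intro i
    induction i with
    | zero => exact ⟨⟨hoC, hod, hos⟩, ho⟩
    | succ i ih =>
      rw [Function.iterate_succ_apply']
      obtain ⟨hxB, hx3⟩ := ih
      generalize π.symm^[i] o = x at *
      have hxb := hob x hx3
      obtain ⟨y, -, z, -, w, -, hyz, hyw, hzw, hxy, hxz, hxw⟩ := hx3
      have hy := hnbr x hxB hxb y hxy
      have hz := hnbr x hxB hxb z hxz
      have hw := hnbr x hxB hxb w hxw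
      replace hxy := hadj x hxB y hy hxy
      replace hxz := hadj x hxB z hz hxz
      replace hxw := hadj x hxB w hw hxw
      have hyz' := π.symm.injective.ne hyz
      have hyw' := π.symm.injective.ne hyw
      have hzw' := π.symm.injective.ne hzw
      have hθx : π.symm x ∈ B := by
        rcases hstep x hxB with h1 | h1 | h1
        · exact absurd ((π.symm_apply_eq.1 h1).trans hbdef) hxb
        · rw [h1] at hxy hxz hxw
          have key : ∀ y ∈ B, T.Adj d (π.symm y) → π.symm y = c ∨ π.symm y = b := by
            intro y hy hdy
            rcases hstep y hy with h2 | h2 | h2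
            · exact Or.inl h2
            · exact absurd h2.symm hdy.ne
            · exact Or.inr ((hdnbr _ h2.1 hdy).resolve_right h2.2.2)
          have := key y hy hxy
          have := key z hz hxz
          have := key w hw hxw
          grind
        · exact h1
      exact ⟨hθx, _, hcompl hθx.1 hθx.2.1 hxy, _, hcompl hθx.1 hθx.2.1 hxz, _,
        hcompl hθx.1 hθx.2.1 hxw, hyz', hyw', hzw', hxy, hxz, hxw⟩
  have hbK : b ∉ K := by
    intro hbK
    have h1 : π.symm b ∈ B := hbK 1
    rw [← hbdef, Equiv.symm_apply_apply] at h1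
    exact h1.1 h.cut.left_mem
  have hKB : ∀ x ∈ K, x ∈ B ∧ x ≠ b := fun x hx => ⟨hx 0, fun hxb => hbK (hxb ▸ hx)⟩
  obtain ⟨u, hu, v, hv, huv⟩ := h.isTree.1.preconnected.exists_adj_of_mem_of_notMem hoK hbK
  refine hv fun i => ?_
  have key : ∀ i : ℕ, T.Adj (π.symm^[i] u) (π.symm^[i] v) := by
    intro i
    induction i with
    | zero => exact huv
    | succ i ih =>
      rw [Function.iterate_succ_apply', Function.iterate_succ_apply']
      have hui : π.symm^[i] u ∈ K := fun m => by
        rw [← Function.iterate_add_apply]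
        exact hu _
      exact hadj _ (hu i) _ (hnbr _ (hu i) (hKB _ hui).2 _ ih) ih
  have hui : π.symm^[i] u ∈ K := fun m => by
    rw [← Function.iterate_add_apply]
    exact hu _
  exact hnbr _ (hu i) (hKB _ hui).2 _ (key i)

/-- Both the pendant edge and the leaf move, and the three vertices outside the rests form a path
from `d`; the components have at most six vertices. -/
lemma false_of_ncard_le_six [Finite V] (h : SharesCards T H C J c d l p j r q π)
    {o s t : V} (hoC : o ∉ C) (ho : T.HasThreeNeighborsIn Cᶜ o) (hcard : C.ncard ≤ 6)
    (hr : r ∉ C) (hq : q ∈ C) (hsC : s ∉ C) (htC : t ∉ C) (hst : s ≠ t) (hdt : d ≠ t)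
    (hsX : s ∉ π '' (Cᶜ \ {l})) (htX : t ∉ π '' (Cᶜ \ {l}))
    (hrest : ∀ x, x ∉ C \ J → x ∉ π '' (Cᶜ \ {l}) → x = d ∨ x = s ∨ x = t)
    (hds : H.Adj d s) (hnt : ¬ H.Adj d t) (hHst : H.Adj s t) (hdc : π c = d) : False := by
  have hR := h.cut_sdiff hr
  have hX := h.cut_image_sdiff hq
  have hdC := h.cut.right_notMem
  have hdX : d ∉ π '' (Cᶜ \ {l}) := hdc ▸ hX.right_notMem
  have hnotR : ∀ x ∉ C, x ∉ C \ J := fun x hx hx' => hx hx'.1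
  have hJC : ∀ x ∈ J, x ∈ C := fun x hx => h.subset hx
  have heq := h.ncard_eq
  have hdsne := hds.ne
  have hcl := h.ne_leaf h.cut.left_mem
  have hs : ∀ x, H.Adj s x → x = d ∨ x = t := by
    intro x hsx
    have := h.notMem_of_adj hr hq (hnotR s hsC) hsX hdsne.symm (hdc ▸ hdsne.symm) hsx
    rcases hrest x this.1 this.2 with h1 | h1 | h1
    exacts [Or.inl h1, absurd h1.symm hsx.ne, Or.inr h1]
  have ht : ∀ x, H.Adj t x → x = s := by
    intro x htx
    have := h.notMem_of_adj hr hq (hnotR t htC) htX hdt.symm (hdc ▸ hdt.symm) htx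
    rcases hrest x this.1 this.2 with rfl | h1 | h1
    exacts [absurd htx.symm hnt, h1, absurd h1.symm htx.ne]
  have hd : ∀ x ∉ C, H.Adj d x → x = π d ∨ x = s := by
    intro x hx hdx
    by_cases hxX : x ∈ π '' (Cᶜ \ {l})
    · exact Or.inl (hX.unique hxX hdX hdx.symm).1
    · rcases hrest x (hnotR x hx) hxX with h1 | h1 | rfl
      exacts [absurd h1.symm hdx.ne, Or.inr h1, absurd hdx hnt]
  obtain ⟨a, ha, b, hb, e, he, hab, hae, hbe, hoa, hob, hoe⟩ := ho
  rw [← h.adj_compl hoC ha] at hoa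
  rw [← h.adj_compl hoC hb] at hob
  rw [← h.adj_compl hoC he] at hoe
  have hod : o ≠ d := by
    rintro rfl
    have := hd a ha hoa
    have := hd b hb hob
    have := hd e he hoe
    grind
  have hos : o ≠ s := by
    rintro rfl
    have := hs a hoa
    have := hs b hob
    have := hs e hoe
    grind
  have hot : o ≠ t := by
    rintro rfl
    exact hab ((ht a hoa).trans (ht b hob).symm)
  have hoX : o ∈ π '' (Cᶜ \ {l}) := by
    by_contra hoX
    rcases hrest o (hnotR o hoC) hoX with h1 | h1 | h1
    exacts [hod h1, hos h1, hot h1]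
  have hoδ : ∀ x, H.Adj o x → x = d ∨ x ∈ π '' (Cᶜ \ {l}) := by
    intro x hox
    by_cases hxX : x ∈ π '' (Cᶜ \ {l})
    · exact Or.inr hxX
    · exact Or.inl ((hX.unique hoX hxX hox).2.trans hdc)
  have hnst : ∀ x, H.Adj o x → x ≠ s ∧ x ≠ t := by
    intro x hox
    constructor
    · rintro rfl
      rcases hs o hox.symm with h1 | h1
      exacts [hod h1, hot h1]
    · rintro rfl
      exact hos (ht o hox.symm)
  have hao := hnst a hoa
  have hbo := hnst b hob
  have heo := hnst e hoe
  -- The main case has `d` as a neighbour of `o`: then `d`, `s`, `t`, `o`, `a`, `b` already exhaust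
  -- `D`. Were `d` not among the chosen neighbours, seven vertices would be needed.
  have hmain : ∀ {a b : V}, a ∉ C → b ∉ C → a ≠ b → a ≠ d → b ≠ d → H.Adj o a → H.Adj o b →
      a ≠ s ∧ a ≠ t → b ≠ s ∧ b ≠ t → H.Adj o d → False := by
    clear hao hbo heo hoa hob hoe hab hae hbe ha hb he
    intro a b ha hb hab had hbd hoa hob hao hbo hod'
    have hπd : π d = o := ((hd o hoC hod'.symm).resolve_right hos).symm
    have hall : ∀ x ∉ C, x = d ∨ x = s ∨ x = t ∨ x = o ∨ x = a ∨ x = b := by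
      intro x hx
      by_contra! hcon
      have := List.Nodup.length_le_ncard (L := [d, s, t, o, a, b, x]) (by
        simp only [List.nodup_cons, List.mem_cons, List.not_mem_nil, or_false, not_or,
          List.nodup_nil, not_false_iff, and_true]
        have := hoa.ne
        have := hob.ne
        refine ⟨⟨?_, ?_, ?_, ?_, ?_, ?_⟩, ⟨?_, ?_, ?_, ?_, ?_⟩, ⟨?_, ?_, ?_, ?_⟩, ⟨?_, ?_, ?_⟩,
          ⟨?_, ?_⟩, ?_⟩ <;> grind) (A := Cᶜ) (by
        intro y hy
        simp only [List.mem_cons, List.not_mem_nil, or_false] at hy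
        rcases hy with rfl | rfl | rfl | rfl | rfl | rfl | rfl <;> assumption)
      simp only [List.length_cons, List.length_nil] at this
      omega
    have hlift : ∀ x, H.Adj o x → x ≠ d → ∃ y ∉ C, y ≠ l ∧ T.Adj d y ∧ π y = x := by
      intro x hox hxd
      obtain ⟨y, ⟨hy, hyl⟩, rfl⟩ := (hoδ x hox).resolve_left hxd
      rw [← hπd, h.adj_map_iff _ h.leaf_ne.symm _ hyl] at hox
      exact ⟨y, hy, hyl, hox, rfl⟩
    have hdT : ∀ y ∉ C, T.Adj d y → y = o ∨ y = s := fun y hy hdy =>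
      hπd ▸ hd y hy ((h.adj_compl hdC hy).2 hdy)
    have hjJ := h.cut_pendant.left_mem
    have hjr := h.cut_pendant.adj
    have hjC := hJC j hjJ
    have hrdst : r = o ∨ r = a ∨ r = b := by
      have hjo : j ≠ o := fun e => hoC (e ▸ hjC)
      rcases hall r hr with rfl | rfl | rfl | h1
      · exfalso
        have hjX : j ∈ π '' (Cᶜ \ {l}) := by
          by_contra hjX
          rcases hrest j (fun hj => hj.2 hjJ) hjX with h1 | h1 | h1
          exacts [hdC (h1 ▸ hjC), hsC (h1 ▸ hjC), htC (h1 ▸ hjC)]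
        exact hjo ((hX.unique hjX hdX hjr).1.trans hπd)
      · rcases hs j hjr.symm with h1 | h1
        exacts [absurd (h1 ▸ hjC) hdC, absurd (h1 ▸ hjC) htC]
      · exact absurd (ht j hjr.symm ▸ hjC) hsC
      · exact h1
    have hro : r ≠ o := by
      rintro rfl
      obtain ⟨x, hx, -, hdx, hπx⟩ := hlift j hjr.symm (fun e => hdC (e ▸ hjC))
      obtain ⟨y, hy, -, hdy, hπy⟩ := hlift a hoa had
      obtain ⟨z, hz, -, hdz, hπz⟩ := hlift b hob hbd
      have := hdT x hx hdx
      have := hdT y hy hdy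
      have := hdT z hz hdz
      have : j ≠ a := fun e => ha (e ▸ hjC)
      have : j ≠ b := fun e => hb (e ▸ hjC)
      grind
    clear hlift
    -- the end of the new pendant edge is one of the two vertices above `o`
    have hfin : ∀ {a b : V}, a ∉ C → b ∉ C → a ≠ b → a ≠ d → b ≠ d → H.Adj o a → H.Adj o b →
        a ≠ s ∧ a ≠ t → b ≠ s ∧ b ≠ t → r = a →
        (∀ x ∉ C, x = d ∨ x = s ∨ x = t ∨ x = o ∨ x = a ∨ x = b) → False := by
      clear hall hrdst hoa hob hao hbo hab had hbd ha hb
      rintro a b ha hb hab had hbd hoa hob hao hbo rfl hall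
      have hnr : ∀ x ∉ C, x ≠ d → ∀ y, H.Adj x y → y ∉ C \ J := fun x hx hxd y hxy hy =>
        hxd (hR.unique hy (hnotR x hx) hxy.symm).2
      have hor := (h.adj_compl hoC ha).1 hoa
      have hob' := (h.adj_compl hoC hb).1 hob
      have hin : ∀ x ∉ C, H.Adj o x → x ≠ d → ∀ y ∉ C, H.Adj x y → y = o := by
        intro x hx hox hxd y hy hxy
        have hxy' := (h.adj_compl hx hy).1 hxy
        have hox' := (h.adj_compl hoC hx).1 hox
        rcases hall y hy with rfl | rfl | rfl | rfl | rfl | rfl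
        · rcases hd x hx hxy.symm with h1 | h1
          · exact absurd (h1.trans hπd).symm hox.ne
          · exact absurd h1 (hnst x hox).1
        · rcases hs x hxy.symm with h1 | h1
          exacts [absurd h1 hxd, absurd h1 (hnst x hox).2]
        · exact absurd (ht x hxy.symm) (hnst x hox).1
        · rfl
        · exact absurd hxy' (h.isTree.2.not_adj_of_adj_adj hox' hor)
        · exact absurd hxy' (h.isTree.2.not_adj_of_adj_adj hox' hob')
      have hbo' : ∀ y, H.Adj b y → y = o := by
        intro y hby
        by_cases hyC : y ∈ C
        · have hyJ : y ∈ J := by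
            by_contra hyJ
            exact hnr b hb hbd y hby ⟨hyC, hyJ⟩
          exact absurd (h.cut_pendant.unique hyJ (fun hbJ => hb (hJC b hbJ)) hby.symm).2 hab.symm
        · exact hin b hb hob hbd y hyC hby
      have hinJ : ∀ x ∈ J, ∀ y z, H.Adj x y → H.Adj x z → y ∈ J → z ∈ J → y = z := by
        intro x hx y z hxy hxz hy hz
        by_contra hyz
        have := List.Nodup.length_le_ncard (L := [x, y, z])
          (by simp [hxy.ne, hxz.ne, hyz]) (A := J) (by
            intro w hw
            simp only [List.mem_cons, List.not_mem_nil, or_false] at hw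
            rcases hw with rfl | rfl | rfl <;> assumption)
        simp only [List.length_cons, List.length_nil, h.ncard_pendant] at this
        omega
      -- As `J` hangs at `r`, the vertex `b` is a leaf of `H`, so its preimage `w` has no neighbours
      -- except `d` and perhaps `l`. The candidates are `o`, which has both `r` and `b` as
      -- neighbours, and `s`, which gives `t = l`; in the latter case the image of `o` would need
      -- two neighbours besides `o` that are not there.
      obtain ⟨w, ⟨hwC, hwl⟩, hwb⟩ := (hoδ b hob).resolve_left hbd
      have hdw : T.Adj d w := by
        rw [← h.adj_map_iff _ h.leaf_ne.symm _ hwl, hπd, hwb]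
        exact hob
      have hw : ∀ y, T.Adj w y → y = d ∨ y = l := by
        intro y hwy
        by_contra! hcon
        have := hbo' (π y) (hwb ▸ (h.adj_map_iff _ hwl _ hcon.2).2 hwy)
        exact hcon.1 (π.injective (this.trans hπd.symm))
      have hTst := (h.adj_compl hsC htC).1 hHst
      rcases hdT w hwC hdw with rfl | rfl
      · have h1 := (hw r hor).resolve_left had
        have h2 := (hw b hob').resolve_left hbd
        exact hab (h1.trans h2.symm)
      · have htl := (hw t hTst).resolve_left hdt.symm
        have hol : o ≠ l := htl ▸ hot
        have hrl : r ≠ l := htl ▸ hao.2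
        have hbl : b ≠ l := htl ▸ hbo.2
        have hgX : π o ∈ π '' (Cᶜ \ {l}) := ⟨o, ⟨hoC, hol⟩, rfl⟩
        have h1 : H.Adj (π o) o := by
          have := (h.adj_map_iff _ hol _ h.leaf_ne.symm).2 ((h.adj_compl hoC hdC).1 hod')
          rwa [hπd] at this
        have h2 := (h.adj_map_iff _ hol _ hrl).2 hor
        have h3 := (h.adj_map_iff _ hol _ hbl).2 hob'
        have h4 : o ≠ π r := fun e => had (π.injective (e.symm.trans hπd.symm))
        have h5 : o ≠ π b := fun e => hbd (π.injective (e.symm.trans hπd.symm))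
        have h6 : π r ≠ π b := π.injective.ne hab
        have hgd : π o ≠ d := fun e => hdX (e ▸ hgX)
        generalize π o = g at *
        generalize π r = x at *
        generalize π b = y at *
        by_cases hgC : g ∈ C
        · have hgJ : g ∈ J := by
            by_contra hgJ
            exact hnr o hoC hod g h1.symm ⟨hgC, hgJ⟩
          have := (h.cut_pendant.unique hgJ (fun hoJ => hoC (hJC o hoJ)) h1).2
          exact hro this.symm
        · rcases hall g hgC with rfl | rfl | rfl | rfl | rfl | rfl
          · exact hgd rfl
          · exact (hnst g h1.symm).1 rfl
          · exact (hnst g h1.symm).2 rfl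
          · exact h1.ne rfl
          · have key : ∀ z, z ≠ o → H.Adj g z → z = j := by
              intro z hzo hgz
              have hzC : z ∈ C := by
                by_contra hzC
                exact hzo (hin g ha hoa had z hzC hgz)
              have hzJ : z ∈ J := by
                by_contra hzJ
                exact hnr g ha had z hgz ⟨hzC, hzJ⟩
              exact (h.cut_pendant.unique hzJ h.cut_pendant.right_notMem hgz.symm).1
            exact h6 ((key x h4.symm h2).trans (key y h5.symm h3).symm)
          · exact h4 (hbo' x h2).symm
    rcases hrdst with h1 | h1 | h1
    · exact hro h1
    · exact hfin ha hb hab had hbd hoa hob hao hbo h1 hall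
    · exact hfin hb ha hab.symm hbd had hob hoa hbo hao h1 (fun x hx => by
        have := hall x hx
        tauto)
  by_cases had : a = d
  · subst had
    exact hmain hb he hbe hab.symm hae.symm hob hoe hbo heo hoa
  · by_cases hbd : b = d
    · subst hbd
      exact hmain ha he hae had hbe.symm hoa hoe hao heo hob
    · by_cases hed : e = d
      · subst hed
        exact hmain ha hb hab had hbd hoa hob hao hbo hoe
      · have := List.Nodup.length_le_ncard (L := [d, s, t, o, a, b, e]) (by
          simp only [List.nodup_cons, List.mem_cons, List.not_mem_nil, or_false, not_or,
            List.nodup_nil, not_false_iff, and_true]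
          have := hoa.ne
          have := hob.ne
          have := hoe.ne
          refine ⟨⟨?_, ?_, ?_, ?_, ?_, ?_⟩, ⟨?_, ?_, ?_, ?_, ?_⟩, ⟨?_, ?_, ?_, ?_⟩, ⟨?_, ?_, ?_⟩,
            ⟨?_, ?_⟩, ?_⟩ <;> grind) (A := Cᶜ) (by
          intro y hy
          simp only [List.mem_cons, List.not_mem_nil, or_false] at hy
          rcases hy with rfl | rfl | rfl | rfl | rfl | rfl | rfl <;> assumption)
        simp only [List.length_cons, List.length_nil] at this
        omega

/-- Both the pendant edge and the leaf move, and the two new edges have the same end outside the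
rests. -/
lemma false_of_disjoint_of_eq [Finite V] (h : SharesCards T H C J c d l p j r q π)
    (hdeg : ∀ v ∈ C, ¬ T.HasThreeNeighborsIn C v) {o : V} (hoC : o ∉ C)
    (ho : T.HasThreeNeighborsIn Cᶜ o)
    (htwo : ∃ x ∉ C, ∃ y ∉ C, x ≠ y ∧ T.Adj d x ∧ T.Adj d y)
    (hpath : ∀ u ∈ C, T.Adj c u → (∀ v ∈ C, T.Adj u v → v = c) →
      ∃ x ∈ C \ J, ∃ y ∈ C \ J, x ≠ y ∧ T.Adj c x ∧ T.Adj c y)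
    (hcR : ∃ u ∈ C \ J, T.Adj c u)
    (hlong : 7 ≤ C.ncard → ∀ u ∈ C, ∀ v ∈ C, T.Adj c u → T.Adj u v → v ≠ c →
      (∀ w ∈ C, T.Adj v w → w = u) →
      ∃ x ∈ C \ J, ∃ y ∈ C \ J, x ≠ y ∧ T.Adj c x ∧ T.Adj c y ∧
        (∃ x' ∈ C \ J, x' ≠ c ∧ T.Adj x x') ∧ ∃ y' ∈ C \ J, y' ≠ c ∧ T.Adj y y')
    (hr : r ∉ C) (hq : q ∈ C) (hdisj : Disjoint (C \ J) (π '' (Cᶜ \ {l}))) (hdc : π c = d) :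
    False := by
  have hR := h.cut_sdiff hr
  have hX := h.cut_image_sdiff hq
  have hdC := h.cut.right_notMem
  obtain ⟨hdX, -, hS⟩ := h.exists_rest hr hq hdisj
  have hnotR : ∀ x ∉ C, x ∉ C \ J := fun x hx hx' => hx hx'.1
  have hRX : ∀ x ∈ C \ J, x ∉ π '' (Cᶜ \ {l}) := fun _ hx => Set.disjoint_left.1 hdisj hx
  have hfour : ∀ {x y z w : V}, x ∉ C \ J → x ∉ π '' (Cᶜ \ {l}) → y ∉ C \ J →
      y ∉ π '' (Cᶜ \ {l}) → z ∉ C \ J → z ∉ π '' (Cᶜ \ {l}) → w ∉ C \ J → w ∉ π '' (Cᶜ \ {l}) →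
      x ≠ y → x ≠ z → x ≠ w → y ≠ z → y ≠ w → z = w := by
    intro x y z w hx hx' hy hy' hz hz' hw hw' hxy hxz hxw hyz hyw
    by_contra hzw
    have := List.Nodup.length_le_ncard (L := [x, y, z, w]) (by simp [*])
      (A := ((C \ J) ∪ π '' (Cᶜ \ {l}))ᶜ) (by
        intro t ht
        rw [Set.mem_compl_iff, Set.mem_union, not_or]
        simp only [List.mem_cons, List.not_mem_nil, or_false] at ht
        rcases ht with rfl | rfl | rfl | rfl
        exacts [⟨hx, hx'⟩, ⟨hy, hy'⟩, ⟨hz, hz'⟩, ⟨hw, hw'⟩])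
    simp only [List.length_cons, List.length_nil] at this
    omega
  obtain ⟨s, hsC, hsX, hds⟩ : ∃ s ∉ C, s ∉ π '' (Cᶜ \ {l}) ∧ H.Adj d s := by
    obtain ⟨x, hx, y, hy, hxy, hdx, hdy⟩ := htwo
    rw [← h.adj_compl hdC hx] at hdx
    rw [← h.adj_compl hdC hy] at hdy
    by_cases hxX : x ∈ π '' (Cᶜ \ {l})
    · refine ⟨y, hy, fun hyX => hxy ?_, hdy⟩
      exact (hX.unique hxX hdX hdx.symm).1.trans (hX.unique hyX hdX hdy.symm).1.symm
    · exact ⟨x, hx, hxX, hdx⟩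
  have hdR := hR.right_notMem
  obtain ⟨t, htR, htX, htd, hts⟩ : ∃ t, t ∉ C \ J ∧ t ∉ π '' (Cᶜ \ {l}) ∧ t ≠ d ∧ t ≠ s := by
    by_contra! hcon
    have h1 : ((C \ J) ∪ π '' (Cᶜ \ {l}))ᶜ ⊆ {d, s} := by
      intro x hx
      rw [Set.mem_compl_iff, Set.mem_union, not_or] at hx
      by_cases hxd : x = d
      exacts [Or.inl hxd, Or.inr (hcon x hx.1 hx.2 hxd)]
    have h2 := (Set.ncard_le_ncard h1 (Set.toFinite _)).trans (Set.ncard_insert_le d {s})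
    rw [hS, Set.ncard_singleton] at h2
    omega
  have hrest : ∀ x, x ∉ C \ J → x ∉ π '' (Cᶜ \ {l}) → x = d ∨ x = s ∨ x = t := by
    intro x hxR hxX
    by_contra! hcon
    exact hcon.2.2 (hfour hdR hdX (hnotR s hsC) hsX hxR hxX htR htX hds.ne hcon.1.symm htd.symm
      hcon.2.1.symm hts.symm)
  have hsnbr : ∀ x, H.Adj s x → x = d ∨ x = t := by
    intro x hsx
    have := h.notMem_of_adj hr hq (hnotR s hsC) hsX hds.ne.symm (hdc ▸ hds.ne.symm) hsx
    rcases hrest x this.1 this.2 with h1 | h1 | h1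
    exacts [Or.inl h1, absurd h1.symm hsx.ne, Or.inr h1]
  have htnbr : ∀ x, H.Adj t x → x = d ∨ x = s := by
    intro x htx
    have := h.notMem_of_adj hr hq htR htX htd (hdc ▸ htd) htx
    rcases hrest x this.1 this.2 with h1 | h1 | h1
    exacts [Or.inl h1, Or.inr h1, absurd h1.symm htx.ne]
  have htC : t ∉ C := by
    intro htC
    have htJ : t ∈ J := by
      by_contra htJ
      exact htR ⟨htC, htJ⟩
    obtain ⟨t', ht', htt'⟩ : ∃ t' ∈ J, t' ≠ t :=
      Set.exists_ne_of_one_lt_ncard (by rw [h.ncard_pendant]; omega) t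
    rcases htnbr t' (h.adj_pendant t htJ t' ht' htt'.symm) with h1 | h1
    exacts [hdC (h1 ▸ h.subset ht'), hsC (h1 ▸ h.subset ht')]
  have hP : ∀ x, x ∉ π '' (Cᶜ \ {l}) → x ≠ π l → x ∈ π '' C := fun x hxX hxl => by
    rcases mem_image_or π C l x with h3 | h3 | h3
    exacts [h3, absurd h3 hxl, absurd h3 hxX]
  have hPX : ∀ x ∈ π '' C, x ≠ π l := by
    rintro _ ⟨x, hx, rfl⟩ hxl
    exact h.leaf_notMem (π.injective hxl ▸ hx)
  have hcP' : d ∈ π '' C := ⟨c, h.cut.left_mem, hdc⟩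
  have hl := h.adj_map_leaf
  have hnotl : ∀ v x y, x ≠ y → H.Adj v x → H.Adj v y → v ≠ π l := by
    rintro v x y hxy hvx hvy rfl
    exact hxy (((hl x).1 hvx).trans ((hl y).1 hvy).symm)
  have hadjR : ∀ x ∈ C \ J, ∀ y ∈ C \ J, T.Adj x y → H.Adj x y := fun x hx y hy hxy =>
    (h.adj_iff _ hx.2 _ hy.2).2 hxy
  have hcP : c ∈ π '' C := by
    obtain ⟨u, hu, hcu⟩ := hcR
    exact hP c (hRX c hR.left_mem) (hnotl c u d (fun e => hdR (e ▸ hu))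
      (hadjR _ hR.left_mem _ hu hcu) hR.adj)
  have hRP : π l ∉ C \ J → C \ J ⊆ π '' C := fun hlR x hx =>
    hP x (hRX x hx) (fun e => hlR (e ▸ hx))
  have hcs : c ≠ s := fun e => hsC (e ▸ h.cut.left_mem)
  have hct : c ≠ t := fun e => htC (e ▸ h.cut.left_mem)
  -- Either `s` and `t` are both leaves at `d`, or they continue a path from `d`. If one of them is
  -- `π l`, the other ends a leg of one vertex at `π c = d`. Otherwise both lie in the image of `C`:
  -- two leaves give branching there, and a leg of two vertices forces `hlong` or few vertices.
  by_cases hdt : H.Adj d t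
  · by_cases hsl : s = π l
    · refine h.false_of_end hdeg hpath (hRP (hsl ▸ hnotR s hsC)) hdc
        (hP t htX (fun e => hts (e.trans hsl.symm))) hdt fun x hx htx => ?_
      exact (htnbr x htx).resolve_right fun e => hPX x hx (e.trans hsl)
    · by_cases htl : t = π l
      · refine h.false_of_end hdeg hpath (hRP (htl ▸ hnotR t htC)) hdc (hP s hsX hsl) hds
          fun x hx hsx => ?_
        exact (hsnbr x hsx).resolve_right fun e => hPX x hx (e.trans htl)
      · exact h.false_of_three hdeg hcP' hcP (hP s hsX hsl) (hP t htX htl) hcs hct hts.symm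
          hR.adj.symm hds hdt
  · have hHst : H.Adj s t := by
      obtain ⟨x, hx, y, hy, hxy⟩ := h.preconnected.exists_adj_of_mem_of_notMem (S := {t})
        (s := t) (t := d) rfl (fun e => htd e.symm)
      rw [Set.mem_singleton_iff.1 hx] at hxy
      rcases htnbr y hxy with rfl | rfl
      exacts [absurd hxy.symm hdt, hxy.symm]
    have hsl : s ≠ π l := hnotl s d t htd.symm hds.symm hHst
    by_cases htl : t = π l
    · refine h.false_of_end hdeg hpath (hRP (htl ▸ hnotR t htC)) hdc (hP s hsX hsl) hds
        fun x hx hsx => ?_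
      exact (hsnbr x hsx).resolve_right fun e => hPX x hx (e.trans htl)
    · rcases Nat.lt_or_ge 6 C.ncard with hk | hk
      · obtain ⟨u, hu, hus⟩ := hP s hsX hsl
        obtain ⟨v, hv, hvt⟩ := hP t htX htl
        have hcl := h.ne_leaf h.cut.left_mem
        have hlu := h.ne_leaf hu
        have hlv := h.ne_leaf hv
        obtain ⟨x, hx, y, hy, hxy, hcx, hcy, ⟨x', hx', hxc, hxx'⟩, y', hy', hyc, hyy'⟩ :=
          hlong hk u hu v hv ((h.adj_map_iff _ hcl _ hlu).1 (by rwa [hdc, hus]))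
            ((h.adj_map_iff _ hlu _ hlv).1 (by rwa [hvt, hus]))
            (fun e => htd (by rw [← hvt, e, hdc])) (fun w hw hvw => by
              have := (h.adj_map_iff _ hlv _ (h.ne_leaf hw)).2 hvw
              rw [hvt] at this
              rcases htnbr _ this with h1 | h1
              · exact absurd (h1 ▸ this).symm hdt
              · exact π.injective (h1.trans hus.symm))
        have hcR' := hR.left_mem
        refine h.false_of_three hdeg hcP (hP x (hRX x hx) ?_) (hP y (hRX y hy) ?_) hcP' hxy
          (fun e => hdR (e ▸ hx)) (fun e => hdR (e ▸ hy)) (hadjR _ hcR' _ hx hcx)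
          (hadjR _ hcR' _ hy hcy) hR.adj
        · exact hnotl x c x' hxc.symm (hadjR _ hcR' _ hx hcx).symm (hadjR _ hx _ hx' hxx')
        · exact hnotl y c y' hyc.symm (hadjR _ hcR' _ hy hcy).symm (hadjR _ hy _ hy' hyy')
      · exact h.false_of_ncard_le_six hoC ho hk hr hq hsC htC hts.symm htd.symm hsX htX hrest hds
          hdt hHst hdc

end SharesCards

/-! ### Upper bounds from a pendant edge and a leaf. -/

section

variable {V : Type u} {T : SimpleGraph V}

/-- To reconstruct `T` from the cards of a pendant edge and of a leaf, it suffices to consider the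
graphs sharing these cards. -/
lemma ern_le_two_of_sharesCards [Finite V] (hT : T.IsTree) {C J : Set V} {c d l p y x : V}
    (hC : IsCut T C c d) (hcard : C.ncard = Cᶜ.ncard)
    (hJC : J ⊆ C) (hcJ : c ∉ J) (hJ2 : J.ncard = 2) (hJ : IsCut T J y x)
    (hadj : ∀ u ∈ J, ∀ v ∈ J, u ≠ v → T.Adj u v) (hlC : l ∉ C) (hld : l ≠ d)
    (hl : ∀ x, T.Adj l x ↔ x = p)
    (key : ∀ (H : SimpleGraph V) (j r q : V) (π : V ≃ V),
      SharesCards T H C J c d l p j r q π → Nonempty (T ≃g H)) : T.ern ≤ 2 := by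
  have hc := hT.1.preconnected
  have hL := isCut_singleton hl
  have hsum := Set.ncard_add_ncard_compl C
  have hsum' := Set.ncard_add_ncard_compl ({l} : Set V)
  rw [Set.ncard_singleton] at hsum'
  refine ern_le_two hc hJ hL (by rw [Set.ncard_singleton]; omega) (by omega) ?_
  intro j hj r hr l' hl' q hq π
  obtain rfl : l = l' := (Set.mem_singleton_iff.1 hl').symm
  have hkeep : ∀ x ≠ l, ∀ y ≠ l, (T.moveEdge l p l q).Adj x y ↔ T.Adj x y :=
    fun x hx y hy => hL.moveEdge_adj_of_notMem rfl hq hx hy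
  refine key _ j r q π.toEquiv
    { isTree := hT, cut := hC, ncard_eq := hcard, subset := hJC, left_notMem := hcJ,
      ncard_pendant := hJ2, leaf_notMem := hlC, leaf_ne := hld, adj_leaf := hl
      preconnected := hJ.preconnected_moveEdge hc hj hr
      cut_pendant := hJ.moveEdge hj hr
      adj_pendant := fun u hu v hv huv => (hJ.moveEdge_adj_of_mem hj hr hu hv).2 (hadj u hu v hv huv)
      adj_iff := fun u hu v hv => hJ.moveEdge_adj_of_notMem hj hr hu hv
      adj_map_iff := fun u hu v hv => π.map_adj_iff.trans (hkeep u hu v hv)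
      adj_map_leaf := fun u => ?_ }
  have hL' := hL.moveEdge (T := T) (a' := l) (b' := q) rfl hq
  obtain ⟨u, rfl⟩ := π.surjective u
  refine π.map_adj_iff.trans ?_
  change _ ↔ π u = π q
  rw [π.injective.eq_iff]
  constructor
  · intro hlu
    refine (hL'.unique rfl (fun hu => ?_) hlu).2
    exact hlu.ne (Set.mem_singleton_iff.1 hu).symm
  · rintro rfl
    exact hL'.adj

/-- A bicentroidal tree in which the end `d` of the centroidal edge `cd` is not a leaf of its
component is determined by the cards of a suitable pendant edge and of a leaf. -/
theorem ern_le_two_of_two_neighbors [Finite V] (hT : T.IsTree) {C J : Set V} {c d l p y x o : V}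
    (hC : IsCut T C c d) (hcard : C.ncard = Cᶜ.ncard)
    (hJC : J ⊆ C) (hcJ : c ∉ J) (hJ2 : J.ncard = 2) (hJ : IsCut T J y x)
    (hadj : ∀ u ∈ J, ∀ v ∈ J, u ≠ v → T.Adj u v) (hlC : l ∉ C) (hld : l ≠ d)
    (hl : ∀ x, T.Adj l x ↔ x = p)
    (hdeg : ∀ v ∈ C, ¬ T.HasThreeNeighborsIn C v) (hoC : o ∉ C)
    (ho : T.HasThreeNeighborsIn Cᶜ o)
    (htwo : ∃ x ∉ C, ∃ y ∉ C, x ≠ y ∧ T.Adj d x ∧ T.Adj d y)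
    (hleaf : ∀ s ∉ C, T.Adj d s → (∀ x, T.Adj s x → x = d) → p = d)
    (hpath : ∀ u ∈ C, T.Adj c u → (∀ v ∈ C, T.Adj u v → v = c) →
      ∃ x ∈ C \ J, ∃ y ∈ C \ J, x ≠ y ∧ T.Adj c x ∧ T.Adj c y)
    (hcR : ∃ u ∈ C \ J, T.Adj c u)
    (hlong : 7 ≤ C.ncard → ∀ u ∈ C, ∀ v ∈ C, T.Adj c u → T.Adj u v → v ≠ c →
      (∀ w ∈ C, T.Adj v w → w = u) →
      ∃ x ∈ C \ J, ∃ y ∈ C \ J, x ≠ y ∧ T.Adj c x ∧ T.Adj c y ∧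
        (∃ x' ∈ C \ J, x' ≠ c ∧ T.Adj x x') ∧ ∃ y' ∈ C \ J, y' ≠ c ∧ T.Adj y y') :
    T.ern ≤ 2 := by
  refine ern_le_two_of_sharesCards hT hC hcard hJC hcJ hJ2 hJ hadj hlC hld hl ?_
  intro H j r q π h
  have hcards := h.ncard_sdiff_leaf
  have hcards' := h.ncard_sdiff_pendant
  by_cases hr : r ∈ C
  · by_cases hq : q ∈ C
    · exact (h.false_of_mem_of_mem_of_two hdeg hoC ho htwo hr hq).elim
    · exact h.nonempty_iso_of_mem_of_notMem hdeg hoC ho hr hq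
  -- From here on the pendant edge has moved across `cd`. The subcases record whether the leaf moved
  -- as well and on which side of the transported bridge `C \ J` lies.
  · have hR := h.cut_sdiff hr
    by_cases hq : q ∈ C
    · have hX := h.cut_image_sdiff hq
      have h1 := Set.ncard_add_ncard_compl (π '' (Cᶜ \ {l}))
      have h2 := Set.ncard_add_ncard_compl C
      rcases hR.subset_or_subset_compl hX h.preconnected (by omega) (by omega) with hsub | hsub
      · exact (h.false_of_subset_of_two htwo hr hq hsub).elim
      · have hdisj := Set.disjoint_left.2 hsub
        by_cases hdc : π c = d
        · exact (h.false_of_disjoint_of_eq hdeg hoC ho htwo hpath hcR hlong hr hq hdisj hdc).elim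
        · exact (h.false_of_disjoint_of_ne hoC ho htwo hleaf hr hq hdisj (Ne.symm hdc)).elim
    · have hP := h.cut_image hq
      rcases hR.subset_or_subset_compl hP h.preconnected (by rw [SharesCards.ncard_image]; omega)
        (by rw [SharesCards.image_compl, SharesCards.ncard_image]; omega) with hsub | hsub
      · exact (h.false_of_sdiff_subset hdeg hpath (Or.inl htwo) hr hq hsub).elim
      · exact h.nonempty_iso_of_disjoint_of_two htwo hleaf hr hq hsub

/-- A bicentroidal tree in which the end `d` of the centroidal edge `cd` is a leaf of its component
next to a vertex `o` of degree at least three, while `c` is not next to an end of the path `C`, is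
determined by the cards of a pendant edge next to `c` and of a leaf which is not adjacent to `o`. -/
theorem ern_le_two_of_one_neighbor [Finite V] (hT : T.IsTree) {C J : Set V} {c d l p y x o u v : V}
    (hC : IsCut T C c d) (hcard : C.ncard = Cᶜ.ncard)
    (hJC : J ⊆ C) (hcJ : c ∉ J) (hJ2 : J.ncard = 2) (hJ : IsCut T J y x)
    (hadj : ∀ u ∈ J, ∀ v ∈ J, u ≠ v → T.Adj u v) (hlC : l ∉ C) (hld : l ≠ d)
    (hl : ∀ x, T.Adj l x ↔ x = p)
    (hdeg : ∀ v ∈ C, ¬ T.HasThreeNeighborsIn C v) (hoC : o ∉ C) (hdo : T.Adj d o)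
    (hd : ∀ x ∉ C, T.Adj d x → x = o) (huC : u ∉ C) (hvC : v ∉ C) (huv : u ≠ v) (hud : u ≠ d)
    (hvd : v ≠ d) (hou : T.Adj o u) (hov : T.Adj o v) (hol : o ≠ l) (hul : u ≠ l) (hvl : v ≠ l)
    (htwo : ∃ x ∈ C, ∃ y ∈ C, x ≠ y ∧ T.Adj c x ∧ T.Adj c y)
    (hlong : ∀ x ∈ C, T.Adj c x → ∃ y ∈ C, y ≠ c ∧ T.Adj x y)
    (hone : ∀ x ∈ C \ J, ∀ y ∈ C \ J, T.Adj c x → T.Adj c y → x = y) :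
    T.ern ≤ 2 := by
  have ho : T.HasThreeNeighborsIn Cᶜ o :=
    ⟨d, hC.right_notMem, u, huC, v, hvC, hud.symm, hvd.symm, huv, hdo.symm, hou, hov⟩
  have hpath : ∀ u ∈ C, T.Adj c u → (∀ v ∈ C, T.Adj u v → v = c) →
      ∃ x ∈ C \ J, ∃ y ∈ C \ J, x ≠ y ∧ T.Adj c x ∧ T.Adj c y := by
    intro u hu hcu hcon
    obtain ⟨y, hy, hyc, huy⟩ := hlong u hu hcu
    exact absurd (hcon y hy huy) hyc
  refine ern_le_two_of_sharesCards hT hC hcard hJC hcJ hJ2 hJ hadj hlC hld hl ?_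
  intro H j r q π h
  have hcards := h.ncard_sdiff_leaf
  have hcards' := h.ncard_sdiff_pendant
  by_cases hr : r ∈ C
  · by_cases hq : q ∈ C
    · exact (h.false_of_mem_of_mem_of_one htwo hr hq).elim
    · exact h.nonempty_iso_of_mem_of_notMem hdeg hoC ho hr hq
  · have hR := h.cut_sdiff hr
    by_cases hq : q ∈ C
    · have hX := h.cut_image_sdiff hq
      have h1 := Set.ncard_add_ncard_compl (π '' (Cᶜ \ {l}))
      have h2 := Set.ncard_add_ncard_compl C
      rcases hR.subset_or_subset_compl hX h.preconnected (by omega) (by omega) with hsub | hsub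
      · exact (h.false_of_subset_of_one hone hoC hdo hol huC hvC huv hud hvd hou hov hul hvl hr hq
          hsub).elim
      · exact (h.false_of_disjoint_images_of_one hoC hdo hd huC hvC huv hud hvd hou hov htwo hlong hr hq
          (Set.disjoint_left.2 hsub)).elim
    · have hP := h.cut_image hq
      rcases hR.subset_or_subset_compl hP h.preconnected (by rw [SharesCards.ncard_image]; omega)
        (by rw [SharesCards.image_compl, SharesCards.ncard_image]; omega) with hsub | hsub
      · exact (h.false_of_sdiff_subset hdeg hpath (Or.inr htwo) hr hq hsub).elim
      · exact (h.false_of_disjoint_of_one hoC hdo hd huC hvC huv hud hvd hou hov hr hq hsub).elim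

end

/-! ### Numbering the vertices of an induced path. -/

section PathOn

variable {V : Type*} {G : SimpleGraph V} {C : Set V} {k : ℕ} {f : ℕ → V}

/-- The vertices `f 0, …, f (k - 1)` are distinct and form an induced path with vertex set `C`. -/
structure IsPathOn (G : SimpleGraph V) (C : Set V) (k : ℕ) (f : ℕ → V) : Prop where
  mem : ∀ i < k, f i ∈ C
  inj : ∀ i < k, ∀ j < k, f i = f j → i = j
  surj : ∀ x ∈ C, ∃ i < k, f i = x
  adj : ∀ i < k, ∀ j < k, G.Adj (f i) (f j) ↔ i + 1 = j ∨ j + 1 = i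

lemma exists_isPathOn [Nonempty V] (e : G.induce C ≃g pathGraph k) :
    ∃ f, IsPathOn G C k f := by
  -- Values at indices from `k` on are arbitrary; natural indices keep the arithmetic within reach
  -- of `omega`.
  let f : ℕ → V := fun i => if hi : i < k then e.symm ⟨i, hi⟩ else Classical.arbitrary V
  have hf : ∀ i (hi : i < k), f i = e.symm ⟨i, hi⟩ := fun i hi => dif_pos hi
  refine ⟨f, fun i hi => ?_, fun i hi j hj hij => ?_, fun x hx => ?_, fun i hi j hj => ?_⟩
  · rw [hf i hi]
    exact (e.symm ⟨i, hi⟩).2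
  · rw [hf i hi, hf j hj] at hij
    exact congrArg Fin.val (e.symm.injective (Subtype.ext hij))
  · refine ⟨e ⟨x, hx⟩, (e ⟨x, hx⟩).2, ?_⟩
    rw [hf _ (e ⟨x, hx⟩).2]
    exact congrArg Subtype.val (e.symm_apply_apply ⟨x, hx⟩)
  · rw [hf i hi, hf j hj]
    exact (e.symm.map_adj_iff (v := ⟨i, hi⟩) (w := ⟨j, hj⟩)).trans pathGraph_adj

namespace IsPathOn

lemma reverse (h : IsPathOn G C k f) : IsPathOn G C k (fun i => f (k - 1 - i)) := by
  refine ⟨fun i hi => h.mem _ (by omega), fun i hi j hj hij => ?_, fun x hx => ?_,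
    fun i hi j hj => ?_⟩
  · have := h.inj _ (by omega) _ (by omega) hij
    omega
  · obtain ⟨i, hi, rfl⟩ := h.surj x hx
    exact ⟨k - 1 - i, by omega, by congr 1; omega⟩
  · rw [h.adj _ (by omega) _ (by omega)]
    omega

lemma ncard_image (h : IsPathOn G C k f) {S : Set ℕ} (hS : ∀ i ∈ S, i < k) :
    (f '' S).ncard = S.ncard :=
  Set.InjOn.ncard_image fun i hi j hj hij => h.inj i (hS i hi) j (hS j hj) hij

lemma ncard_eq (h : IsPathOn G C k f) : C.ncard = k := by
  have : C = f '' Set.Iio k := by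
    ext x
    constructor
    · intro hx
      obtain ⟨i, hi, rfl⟩ := h.surj x hx
      exact ⟨i, hi, rfl⟩
    · rintro ⟨i, hi, rfl⟩
      exact h.mem i hi
  rw [this, h.ncard_image (S := Set.Iio k) (fun i hi => hi), Set.ncard_eq_toFinset_card']
  simp

lemma not_hasThreeNeighborsIn (h : IsPathOn G C k f) : ∀ v ∈ C, ¬ G.HasThreeNeighborsIn C v := by
  rintro v hv ⟨x, hx, y, hy, z, hz, hxy, hxz, hyz, h1, h2, h3⟩
  obtain ⟨i, hi, rfl⟩ := h.surj v hv
  obtain ⟨a, ha, rfl⟩ := h.surj x hx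
  obtain ⟨b, hb, rfl⟩ := h.surj y hy
  obtain ⟨e, he, rfl⟩ := h.surj z hz
  rw [h.adj _ hi _ ha] at h1
  rw [h.adj _ hi _ hb] at h2
  rw [h.adj _ hi _ he] at h3
  have hab : a ≠ b := fun e => hxy (congrArg f e)
  have hae : a ≠ e := fun e => hxz (congrArg f e)
  have hbe : b ≠ e := fun e => hyz (congrArg f e)
  omega

/-- Any vertex of a path is in the first half, up to reversing the path. -/
lemma exists_two_mul_lt (h : IsPathOn G C k f) {x : V} (hx : x ∈ C) :
    ∃ f', IsPathOn G C k f' ∧ ∃ t, 2 * t < k ∧ f' t = x := by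
  obtain ⟨i, hi, rfl⟩ := h.surj x hx
  by_cases hik : 2 * i < k
  · exact ⟨f, h, i, hik, rfl⟩
  · exact ⟨_, h.reverse, k - 1 - i, by omega, by congr 1; omega⟩

/-- The last two vertices of a path, none of which has a neighbour outside the path. -/
lemma isCut_pair (h : IsPathOn G C k f) (hk : 3 ≤ k) {c d : V} (hC : IsCut G C c d)
    (hc : c ∉ ({f (k - 2), f (k - 1)} : Set V)) :
    IsCut G {f (k - 2), f (k - 1)} (f (k - 2)) (f (k - 3)) := by
  refine ⟨Or.inl rfl, ?_, (h.adj _ (by omega) _ (by omega)).2 (by omega), ?_⟩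
  · rintro (h1 | h1)
    · have := h.inj _ (by omega) _ (by omega) h1
      omega
    · have := h.inj _ (by omega) _ (by omega) h1
      omega
  · intro x y hx hy hxy
    have hxC : x ∈ C := by
      rcases hx with rfl | rfl
      exacts [h.mem _ (by omega), h.mem _ (by omega)]
    by_cases hyC : y ∈ C
    · obtain ⟨i, hi, rfl⟩ := h.surj y hyC
      have h1 : i ≠ k - 2 := fun e => hy (Or.inl (congrArg f e))
      have h2 : i ≠ k - 1 := fun e => hy (Or.inr (congrArg f e))
      rcases hx with rfl | rfl
      · rw [h.adj _ (by omega) _ hi] at hxy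
        exact ⟨rfl, by congr 1; omega⟩
      · rw [h.adj _ (by omega) _ hi] at hxy
        omega
    · exact absurd ((hC.unique hxC hyC hxy).1 ▸ hx) hc

lemma ncard_pair (h : IsPathOn G C k f) (hk : 2 ≤ k) :
    ({f (k - 2), f (k - 1)} : Set V).ncard = 2 := by
  refine Set.ncard_pair fun e => ?_
  have := h.inj _ (by omega) _ (by omega) e
  omega

lemma adj_pair (h : IsPathOn G C k f) (hk : 2 ≤ k) :
    ∀ u ∈ ({f (k - 2), f (k - 1)} : Set V), ∀ v ∈ ({f (k - 2), f (k - 1)} : Set V), u ≠ v →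
      G.Adj u v := by
  have h1 := (h.adj (k - 2) (by omega) (k - 1) (by omega)).2 (by omega)
  rintro u (rfl | rfl) v (rfl | rfl) huv
  exacts [absurd rfl huv, h1, h1.symm, absurd rfl huv]

lemma pair_subset (h : IsPathOn G C k f) (hk : 2 ≤ k) :
    ({f (k - 2), f (k - 1)} : Set V) ⊆ C := by
  rintro x (rfl | rfl)
  exacts [h.mem _ (by omega), h.mem _ (by omega)]

lemma mem_sdiff_pair (h : IsPathOn G C k f) {i : ℕ} (hk : 2 ≤ k) (hi : i < k) :
    f i ∈ C \ ({f (k - 2), f (k - 1)} : Set V) ↔ i + 2 < k := by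
  constructor
  · rintro ⟨-, h1⟩
    have h2 : i ≠ k - 2 := fun e => h1 (Or.inl (congrArg f e))
    have h3 : i ≠ k - 1 := fun e => h1 (Or.inr (congrArg f e))
    omega
  · intro hi'
    refine ⟨h.mem i hi, ?_⟩
    rintro (h1 | h1)
    · have := h.inj _ hi _ (by omega) h1
      omega
    · have := h.inj _ hi _ (by omega) h1
      omega

end IsPathOn

end PathOn

/-! ### Path components next to a non-leaf, and the star. -/

section Cases

variable {V : Type u} {T : SimpleGraph V}

/-- A bicentroidal tree one of whose centroidal components is a path `C` with at least five vertices,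
or with four vertices and the centroidal edge at its end, when the end of the centroidal edge in
the other component is not a leaf of this component. -/
theorem IsPathOn.ern_le_two_of_two_neighbors [Finite V] (hT : T.IsTree) {C : Set V} {c d o : V}
    {k : ℕ} {f : ℕ → V} (hf : IsPathOn T C k f) (hC : IsCut T C c d) (hcard : C.ncard = Cᶜ.ncard)
    (hk : 4 ≤ k)
    (hend : (∃ x ∈ C, ∃ y ∈ C, x ≠ y ∧ T.Adj c x ∧ T.Adj c y) → 5 ≤ k) (hoC : o ∉ C)
    (ho : T.HasThreeNeighborsIn Cᶜ o)
    (htwo : ∃ x ∉ C, ∃ y ∉ C, x ≠ y ∧ T.Adj d x ∧ T.Adj d y) : T.ern ≤ 2 := by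
  -- A leaf hanging at `d` is preferred; any leaf of `T` in `D` is used only if there is none at
  -- `d`.
  obtain ⟨l, hlC, p, hl, hld, hleaf⟩ : ∃ l ∉ C, ∃ p, (∀ x, T.Adj l x ↔ x = p) ∧ l ≠ d ∧
      ∀ s ∉ C, T.Adj d s → (∀ x, T.Adj s x → x = d) → p = d := by
    by_cases hs : ∃ s ∉ C, T.Adj d s ∧ ∀ x, T.Adj s x → x = d
    · obtain ⟨s, hsC, hds, hs⟩ := hs
      exact ⟨s, hsC, d, fun x => ⟨hs x, fun e => e ▸ hds.symm⟩, hds.ne.symm, fun _ _ _ _ => rfl⟩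
    · obtain ⟨l, hlC, p, hl⟩ := hT.exists_leaf_mem hC.compl
      refine ⟨l, hlC, p, hl, ?_, fun s hsC hds h => absurd ⟨s, hsC, hds, h⟩ hs⟩
      rintro rfl
      obtain ⟨x, -, y, -, hxy, hx, hy⟩ := htwo
      exact hxy (((hl x).1 hx).trans ((hl y).1 hy).symm)
  -- With `c` in the first half, the last two vertices form a pendant edge avoiding `c`.
  obtain ⟨f, hf, t, ht, rfl⟩ := hf.exists_two_mul_lt hC.left_mem
  have hcJ : f t ∉ ({f (k - 2), f (k - 1)} : Set V) :=
    ((hf.mem_sdiff_pair (by omega) (by omega)).2 (by omega)).2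
  have ht0 : t = 0 ∨ 5 ≤ k := by
    by_contra! hcon
    refine absurd (hend ⟨f (t - 1), hf.mem _ (by omega), f (t + 1), hf.mem _ (by omega),
      fun e => ?_, (hf.adj _ (by omega) _ (by omega)).2 (by omega),
      (hf.adj _ (by omega) _ (by omega)).2 (by omega)⟩) (by omega)
    have := hf.inj _ (by omega) _ (by omega) e
    omega
  refine SimpleGraph.ern_le_two_of_two_neighbors hT hC hcard (hf.pair_subset (by omega)) hcJ
    (hf.ncard_pair (by omega)) (hf.isCut_pair (by omega) hC hcJ) (hf.adj_pair (by omega)) hlC hld hl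
    hf.not_hasThreeNeighborsIn hoC ho htwo hleaf ?_ ?_ ?_
  · intro u hu hcu hv
    obtain ⟨i, hi, rfl⟩ := hf.surj u hu
    rw [hf.adj _ (by omega) _ hi] at hcu
    have h1 : i + 1 < k → i + 1 = t := fun hi' => hf.inj _ hi' _ (by omega)
      (hv _ (hf.mem _ hi') ((hf.adj _ hi _ hi').2 (Or.inl rfl)))
    have h2 : 1 ≤ i → i - 1 = t := fun hi' => hf.inj _ (by omega) _ (by omega)
      (hv _ (hf.mem _ (by omega)) ((hf.adj _ hi _ (by omega)).2 (by omega)))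
    -- Only the end `f 0` can be next to `c`, as the other end is too far away. The vertex `f 2`
    -- avoids `J` because `k ≥ 5`.
    have h3 : t = 1 := by omega
    subst h3
    refine ⟨f 0, (hf.mem_sdiff_pair (by omega) (by omega)).2 (by omega), f 2,
      (hf.mem_sdiff_pair (by omega) (by omega)).2 (by omega), fun e => ?_,
      (hf.adj _ (by omega) _ (by omega)).2 (by omega),
      (hf.adj _ (by omega) _ (by omega)).2 (by omega)⟩
    have := hf.inj _ (by omega) _ (by omega) e
    omega
  · rcases Nat.eq_zero_or_pos t with rfl | ht1
    · exact ⟨f 1, (hf.mem_sdiff_pair (by omega) (by omega)).2 (by omega),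
        (hf.adj _ (by omega) _ (by omega)).2 (by omega)⟩
    · exact ⟨f (t - 1), (hf.mem_sdiff_pair (by omega) (by omega)).2 (by omega),
        (hf.adj _ (by omega) _ (by omega)).2 (by omega)⟩
  · intro h7 u hu v hv hcu huv hvc hvu
    rw [hf.ncard_eq] at h7
    obtain ⟨i, hi, rfl⟩ := hf.surj u hu
    obtain ⟨m, hm, rfl⟩ := hf.surj v hv
    rw [hf.adj _ (by omega) _ hi] at hcu
    rw [hf.adj _ hi _ hm] at huv
    have hmt : m ≠ t := fun e => hvc (congrArg f e)
    have h1 : m + 1 < k → m + 1 = i := fun hm' => hf.inj _ hm' _ hi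
      (hvu _ (hf.mem _ hm') ((hf.adj _ hm _ hm').2 (Or.inl rfl)))
    have h2 : 1 ≤ m → m - 1 = i := fun hm' => hf.inj _ (by omega) _ hi
      (hvu _ (hf.mem _ (by omega)) ((hf.adj _ hm _ (by omega)).2 (by omega)))
    -- The leg of two vertices is `f 1`, `f 0`. The bound seven is what keeps `f 4` outside `J`.
    have h3 : t = 2 := by omega
    subst h3
    refine ⟨f 1, (hf.mem_sdiff_pair (by omega) (by omega)).2 (by omega), f 3,
      (hf.mem_sdiff_pair (by omega) (by omega)).2 (by omega), fun e => ?_,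
      (hf.adj _ (by omega) _ (by omega)).2 (by omega),
      (hf.adj _ (by omega) _ (by omega)).2 (by omega),
      ⟨f 0, (hf.mem_sdiff_pair (by omega) (by omega)).2 (by omega), fun e => ?_,
      (hf.adj _ (by omega) _ (by omega)).2 (by omega)⟩,
      ⟨f 4, (hf.mem_sdiff_pair (by omega) (by omega)).2 (by omega), fun e => ?_,
      (hf.adj _ (by omega) _ (by omega)).2 (by omega)⟩⟩
    all_goals
      have := hf.inj _ (by omega) _ (by omega) e
      omega

/-- The star as a centroidal component. -/
theorem ern_le_two_of_ncard_eq_four [Finite V] (hT : T.IsTree) {C : Set V} {c d o c₁ c₂ : V}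
    (hC : IsCut T C c d) (hcard : C.ncard = Cᶜ.ncard) (h4 : C.ncard = 4)
    (hdeg : ∀ v ∈ C, ¬ T.HasThreeNeighborsIn C v) (h₁ : c₁ ∈ C) (h₂ : c₂ ∈ C) (h₁₂ : c₁ ≠ c₂)
    (hc₁ : T.Adj c c₁) (hc₂ : T.Adj c c₂) (hoC : o ∉ C)
    (ho : T.HasThreeNeighborsIn Cᶜ o) : T.ern ≤ 2 := by
  have hdC := hC.right_notMem
  obtain ⟨l, hlC, hld, hol⟩ : ∃ l ∉ C, l ≠ d ∧ T.Adj o l := by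
    obtain ⟨x, hx, y, hy, -, -, hxy, -, -, h1, h2, -⟩ := ho
    by_cases hxd : x = d
    · exact ⟨y, hy, fun e => hxy (hxd.trans e.symm), h2⟩
    · exact ⟨x, hx, hxd, h1⟩
  have hall : ∀ x ∉ C, x ≠ o → T.Adj o x := by
    obtain ⟨x, hx, y, hy, z, hz, hxy, hxz, hyz, h1, h2, h3⟩ := ho
    intro w hw hwo
    by_contra hcon
    have := List.Nodup.length_le_ncard (L := [o, x, y, z, w]) (by
      simp only [List.nodup_cons, List.mem_cons, List.not_mem_nil, or_false, not_or,
        List.nodup_nil, not_false_iff, and_true]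
      have := h1.ne
      have := h2.ne
      have := h3.ne
      refine ⟨⟨?_, ?_, ?_, ?_⟩, ⟨?_, ?_, ?_⟩, ⟨?_, ?_⟩, ?_⟩ <;> grind) (A := Cᶜ) (by
      intro y hy
      simp only [List.mem_cons, List.not_mem_nil, or_false] at hy
      rcases hy with rfl | rfl | rfl | rfl | rfl <;> assumption)
    simp only [List.length_cons, List.length_nil] at this
    omega
  have hl : ∀ x, T.Adj l x ↔ x = o := by
    refine fun x => ⟨fun hlx => ?_, fun e => e ▸ hol.symm⟩
    by_contra hxo
    have hxC : x ∉ C := fun hxC => hld (hC.unique hxC hlC hlx.symm).2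
    exact hT.2.not_adj_of_adj_adj hol (hall x hxC hxo) hlx
  refine ern_le_two_of_leaf hT hC hcard hdeg hoC ho h₁ h₂ h₁₂ hc₁ hc₂ hlC hld hl ?_
  intro q hq hql κ
  by_contra hqo
  have hκ : ∀ x y : (Cᶜ : Set V), T.Adj (κ x) (κ y) ↔ (T.moveEdge l o l q).Adj x y :=
    fun x y => κ.map_adj_iff
  have hcen : ∀ x, ∀ y ∉ C, y ≠ κ.symm ⟨o, hoC⟩ → x = (κ.symm ⟨o, hoC⟩ : V) →
      (T.moveEdge l o l q).Adj x y := by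
    rintro _ y hy hyo rfl
    rw [← hκ _ ⟨y, hy⟩, RelIso.apply_symm_apply]
    refine hall _ (κ ⟨y, hy⟩).2 fun e => hyo ?_
    have : κ ⟨y, hy⟩ = ⟨o, hoC⟩ := Subtype.ext e
    rw [← this, RelIso.symm_apply_apply]
  have hxC : (κ.symm ⟨o, hoC⟩ : V) ∉ C := (κ.symm ⟨o, hoC⟩).2
  generalize (κ.symm ⟨o, hoC⟩ : V) = x at *
  have hne : ∀ y, ¬ (T.moveEdge l o l q).Adj y y := fun y => SimpleGraph.irrefl _
  have hlo : ¬ (T.moveEdge l o l q).Adj l o := by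
    rw [moveEdge_adj]
    rintro (⟨-, h1⟩ | ⟨h1, -⟩)
    · exact h1 rfl
    · rcases Sym2.eq_iff.1 h1 with ⟨-, h1⟩ | ⟨h1, -⟩
      exacts [hqo h1.symm, hql h1.symm]
  obtain ⟨w, hwC, hwo, hwl, hwq⟩ : ∃ w ∉ C, w ≠ o ∧ w ≠ l ∧ w ≠ q := by
    obtain ⟨x, hx, y, hy, z, hz, hxy, hxz, hyz, h1, h2, h3⟩ := ho
    have := h1.ne
    have := h2.ne
    have := h3.ne
    by_cases hx' : x = l ∨ x = q
    · by_cases hy' : y = l ∨ y = q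
      · exact ⟨z, hz, by grind, by grind, by grind⟩
      · exact ⟨y, hy, by grind, by grind, by grind⟩
    · exact ⟨x, hx, by grind, by grind, by grind⟩
  have hlq : ∀ y ∉ C, (T.moveEdge l o l q).Adj w y → y = o := by
    intro y hy h1
    rw [moveEdge_adj] at h1
    by_contra hyo
    rcases h1 with ⟨h1, -⟩ | ⟨h1, -⟩
    · exact hT.2.not_adj_of_adj_adj (hall w hwC hwo) (hall y hy hyo) h1
    · rcases Sym2.eq_iff.1 h1 with ⟨h1, -⟩ | ⟨h1, -⟩
      exacts [hwl h1, hwq h1]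
  have hxo : x = o := by
    by_cases hxw : x = w
    · exfalso
      exact hol.ne (hlq l hlC (hcen w l hlC (fun e => hwl (hxw.symm.trans e.symm)) hxw.symm)).symm
    · exact hlq x hxC (hcen x w hwC (Ne.symm hxw) rfl).symm
  exact hlo (hcen o l hlC (fun e => hol.ne (hxo.symm.trans e.symm)) hxo.symm).symm

end Cases

/-! ### Cuts in induced subgraphs. -/

section InducedCut

variable {V : Type*} {G : SimpleGraph V}

lemma isCut_induce {S A : Set V} {a b : V} (haS : a ∈ S) (hbS : b ∈ S) (ha : a ∈ A) (hb : b ∉ A)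
    (hab : G.Adj a b) (h : ∀ x ∈ A, ∀ y ∈ S, y ∉ A → G.Adj x y → x = a ∧ y = b) :
    IsCut (G.induce S) (Subtype.val ⁻¹' A) ⟨a, haS⟩ ⟨b, hbS⟩ :=
  ⟨ha, hb, hab, fun x y hx hy hxy => by
    obtain ⟨h1, h2⟩ := h x hx y y.2 hy hxy
    exact ⟨Subtype.ext h1, Subtype.ext h2⟩⟩

lemma ncard_preimage_val {S A : Set V} (h : A ⊆ S) :
    (Subtype.val ⁻¹' A : Set S).ncard = A.ncard :=
  Set.ncard_preimage_of_injective_subset_range Subtype.val_injective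
    (by rwa [Subtype.range_coe])

end InducedCut

/-! ### Spiders with a leg of one vertex. -/

section Spider

variable {V : Type u} {T : SimpleGraph V} {C : Set V} {c d : V} {m s : ℕ} {g : ℕ → V}

/-- The tree on `Cᶜ` consists of a path `g 0, …, g (m - 1)` and a further leaf `d` attached at its
inner vertex `g s`. -/
structure IsSpiderOn (T : SimpleGraph V) (C : Set V) (d : V) (m s : ℕ) (g : ℕ → V) : Prop where
  isPathOn : IsPathOn T (Cᶜ \ {d}) m g
  pos : 1 ≤ s
  lt : s + 1 < m
  notMem : d ∉ C
  adj_iff : ∀ i < m, T.Adj d (g i) ↔ i = s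

namespace IsSpiderOn

lemma reverse (h : IsSpiderOn T C d m s g) :
    IsSpiderOn T C d m (m - 1 - s) (fun i => g (m - 1 - i)) := by
  have h1 := h.pos
  have h2 := h.lt
  refine ⟨h.isPathOn.reverse, by omega, by omega, h.notMem, fun i hi => ?_⟩
  rw [h.adj_iff _ (by omega)]
  omega

lemma notMem' (h : IsSpiderOn T C d m s g) {i : ℕ} (hi : i < m) : g i ∉ C :=
  (h.isPathOn.mem i hi).1

lemma ne (h : IsSpiderOn T C d m s g) {i : ℕ} (hi : i < m) : g i ≠ d :=
  (h.isPathOn.mem i hi).2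

lemma eq_or (h : IsSpiderOn T C d m s g) {x : V} (hx : x ∉ C) : x = d ∨ ∃ i < m, g i = x := by
  by_cases hxd : x = d
  · exact Or.inl hxd
  · exact Or.inr (h.isPathOn.surj x ⟨hx, hxd⟩)

lemma adj (h : IsSpiderOn T C d m s g) {i j : ℕ} (hi : i < m) (hj : j < m) :
    T.Adj (g i) (g j) ↔ i + 1 = j ∨ j + 1 = i := h.isPathOn.adj i hi j hj

lemma inj (h : IsSpiderOn T C d m s g) {i j : ℕ} (hi : i < m) (hj : j < m) (hij : i ≠ j) :
    g i ≠ g j := fun e => hij (h.isPathOn.inj i hi j hj e)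

lemma eq_of_hasThreeNeighborsIn (h : IsSpiderOn T C d m s g) {x : V} (hxC : x ∉ C)
    (hx : T.HasThreeNeighborsIn Cᶜ x) : x = g s := by
  obtain ⟨a, ha, b, hb, e, he, hab, hae, hbe, h1, h2, h3⟩ := hx
  rcases h.eq_or hxC with rfl | ⟨i, hi, rfl⟩
  · have key : ∀ y ∉ C, T.Adj x y → y = g s := by
      intro y hy hxy
      rcases h.eq_or hy with rfl | ⟨j, hj, rfl⟩
      · exact absurd rfl hxy.ne
      · rw [(h.adj_iff j hj).1 hxy]
    exact absurd ((key a ha h1).trans (key b hb h2).symm) hab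
  · by_contra his
    have his' : i ≠ s := fun e => his (congrArg g e)
    have key : ∀ y ∉ C, T.Adj (g i) y → ∃ j < m, g j = y ∧ (i + 1 = j ∨ j + 1 = i) := by
      intro y hy hxy
      rcases h.eq_or hy with rfl | ⟨j, hj, rfl⟩
      · exact absurd ((h.adj_iff i hi).1 hxy.symm) his'
      · exact ⟨j, hj, rfl, (h.adj hi hj).1 hxy⟩
    obtain ⟨j1, -, rfl, h1⟩ := key a ha h1
    obtain ⟨j2, -, rfl, h2⟩ := key b hb h2
    obtain ⟨j3, -, rfl, h3⟩ := key e he h3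
    have hab' : j1 ≠ j2 := fun e => hab (congrArg g e)
    have hae' : j1 ≠ j3 := fun e => hae (congrArg g e)
    have hbe' : j2 ≠ j3 := fun e => hbe (congrArg g e)
    omega

lemma ncard_image_Ico (h : IsSpiderOn T C d m s g) {a b : ℕ} (hb : b ≤ m) :
    (g '' Set.Ico a b).ncard = b - a := by
  rw [h.isPathOn.ncard_image (fun i hi => lt_of_lt_of_le hi.2 hb), Set.ncard_eq_toFinset_card']
  simp

lemma image_Ico_subset (h : IsSpiderOn T C d m s g) {a b : ℕ} (hb : b ≤ m) :
    g '' Set.Ico a b ⊆ Cᶜ := by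
  rintro _ ⟨i, hi, rfl⟩
  exact h.notMem' (lt_of_lt_of_le hi.2 hb)

/-- The sizes of the legs of a spider. -/
lemma ncard_of_isCut (h : IsSpiderOn T C d m s g)
    (hconn : (T.induce Cᶜ).Preconnected) {A : Set (Cᶜ : Set V)} {x y : (Cᶜ : Set V)}
    (hA : IsCut (T.induce Cᶜ) A x y) (hy : y = g s) :
    A.ncard = 1 ∨ A.ncard = s ∨ A.ncard = m - 1 - s := by
  have hs1 := h.pos
  have hs2 := h.lt
  obtain ⟨y, hyC⟩ := y
  obtain ⟨x, hxC⟩ := x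
  change y = g s at hy
  subst hy
  have hadj : T.Adj x (g s) := hA.adj
  rcases h.eq_or hxC with rfl | ⟨i, hi, rfl⟩
  · left
    have hcut := isCut_induce (A := {x}) hxC hyC rfl (fun e => h.ne (i := s) (by omega) e) hadj
      (by
        rintro _ rfl y hy hyx hxy
        refine ⟨rfl, ?_⟩
        rcases h.eq_or hy with rfl | ⟨j, hj, rfl⟩
        · exact absurd rfl hyx
        · rw [(h.adj_iff j hj).1 hxy])
    rw [hA.eq_of_same_edge hcut hconn, ncard_preimage_val (Set.singleton_subset_iff.2 hxC),
      Set.ncard_singleton]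
  · rcases (h.adj hi (by omega)).1 hadj with h1 | h1
    · right; left
      have hcut := isCut_induce (A := g '' Set.Ico 0 s) hxC hyC ⟨i, ⟨by omega, by omega⟩, rfl⟩ (by
          rintro ⟨j, hj, e⟩
          exact h.inj (lt_trans hj.2 (by omega)) (by omega) (ne_of_lt hj.2) e) hadj (by
        rintro _ ⟨a, ha, rfl⟩ y hy hyA hay
        have ha2 : a < s := ha.2
        rcases h.eq_or hy with rfl | ⟨j, hj, rfl⟩
        · exact absurd ((h.adj_iff a (by omega)).1 hay.symm) (by omega)
        · have hjs : ¬ j < s := fun hjs => hyA ⟨j, ⟨by omega, hjs⟩, rfl⟩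
          rw [h.adj (by omega) hj] at hay
          exact ⟨by congr 1; omega, by congr 1; omega⟩)
      rw [hA.eq_of_same_edge hcut hconn, ncard_preimage_val (h.image_Ico_subset (by omega)),
        h.ncard_image_Ico (by omega), Nat.sub_zero]
    · right; right
      have hcut := isCut_induce (A := g '' Set.Ico (s + 1) m) hxC hyC ⟨i, ⟨by omega, hi⟩, rfl⟩ (by
          rintro ⟨j, hj, e⟩
          have hj1 : s + 1 ≤ j := hj.1
          exact h.inj hj.2 (by omega) (by omega) e) hadj (by
        rintro _ ⟨a, ha, rfl⟩ y hy hyA hay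
        have ha1 : s + 1 ≤ a := ha.1
        have ha2 : a < m := ha.2
        rcases h.eq_or hy with rfl | ⟨j, hj, rfl⟩
        · exact absurd ((h.adj_iff a ha2).1 hay.symm) (by omega)
        · have hjs : ¬ s + 1 ≤ j := fun hjs => hyA ⟨j, ⟨hjs, hj⟩, rfl⟩
          rw [h.adj (by omega) hj] at hay
          exact ⟨by congr 1; omega, by congr 1; omega⟩)
      rw [hA.eq_of_same_edge hcut hconn, ncard_preimage_val (h.image_Ico_subset le_rfl),
        h.ncard_image_Ico le_rfl]
      omega

/-- In a spider with a leg of at least three vertices, whose length does not exceed the one of the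
third leg by one, the end of this leg cannot be moved without changing the spider. -/
lemma eq_of_moveEdge_iso (h : IsSpiderOn T C d m s g) (hconn : (T.induce Cᶜ).Preconnected)
    (hs : 3 ≤ s) (hms : m ≠ 2 * s) {q : V} (hqC : q ∉ C) (hq : q ≠ g 0)
    (κ : (T.moveEdge (g 0) (g 1) (g 0) q).induce Cᶜ ≃g T.induce Cᶜ) : q = g 1 := by
  have hs2 := h.lt
  by_contra hq1
  have hκ : ∀ x y : (Cᶜ : Set V), T.Adj (κ x) (κ y) ↔
      (T.moveEdge (g 0) (g 1) (g 0) q).Adj x y := fun x y => κ.map_adj_iff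
  have hthree : ∀ x : (Cᶜ : Set V), (∃ a b e : (Cᶜ : Set V), a ≠ b ∧ a ≠ e ∧ b ≠ e ∧
      (T.moveEdge (g 0) (g 1) (g 0) q).Adj x a ∧ (T.moveEdge (g 0) (g 1) (g 0) q).Adj x b ∧
      (T.moveEdge (g 0) (g 1) (g 0) q).Adj x e) → (κ x : V) = g s := by
    rintro x ⟨a, b, e, hab, hae, hbe, h1, h2, h3⟩
    refine h.eq_of_hasThreeNeighborsIn (κ x).2 ⟨κ a, (κ a).2, κ b, (κ b).2, κ e, (κ e).2,
      fun e => hab (κ.injective (Subtype.ext e)), fun e => hae (κ.injective (Subtype.ext e)),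
      fun e => hbe (κ.injective (Subtype.ext e)), (hκ _ _).2 h1, (hκ _ _).2 h2, (hκ _ _).2 h3⟩
  have hold : ∀ {x y : V}, T.Adj x y → x ≠ g 0 → y ≠ g 0 →
      (T.moveEdge (g 0) (g 1) (g 0) q).Adj x y := by
    intro x y hxy hx hy
    refine Or.inl ⟨hxy, fun e => ?_⟩
    rcases Sym2.eq_iff.1 e with ⟨e, -⟩ | ⟨-, e⟩
    exacts [hx e, hy e]
  have hne : ∀ {i : ℕ}, i < m → 1 ≤ i → g i ≠ g 0 := fun hi hi1 => h.inj hi (by omega) (by omega)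
  have hgs : g s ∉ C := h.notMem' (by omega)
  -- The centre still branches after the move, and a spider has one branching vertex, so `κ` fixes
  -- the centre.
  have hκs : (κ ⟨g s, hgs⟩ : V) = g s := by
    refine hthree _ ⟨⟨d, h.notMem⟩, ⟨g (s - 1), h.notMem' (by omega)⟩,
      ⟨g (s + 1), h.notMem' (by omega)⟩, fun e => ?_, fun e => ?_, fun e => ?_, ?_, ?_, ?_⟩
    · exact h.ne (i := s - 1) (by omega) (congrArg Subtype.val e).symm
    · exact h.ne (i := s + 1) (by omega) (congrArg Subtype.val e).symm
    · exact h.inj (by omega) (by omega) (by omega) (congrArg Subtype.val e)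
    · exact hold ((h.adj_iff s (by omega)).2 rfl).symm (hne (by omega) (by omega))
        (h.ne (by omega)).symm
    · exact hold ((h.adj (by omega) (by omega)).2 (by omega)) (hne (by omega) (by omega))
        (hne (by omega) (by omega))
    · exact hold ((h.adj (by omega) (by omega)).2 (by omega)) (hne (by omega) (by omega))
        (hne (by omega) (by omega))
  -- Reattaching `g 0` inside its old leg would create a second branching vertex.
  by_cases hqU : q ∈ g '' Set.Ico 1 s
  · obtain ⟨i, ⟨hi1, hi2⟩, rfl⟩ := hqU
    have hi1' : i ≠ 1 := fun e => hq1 (congrArg g e)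
    have hκi : (κ ⟨g i, hqC⟩ : V) = g s := by
      refine hthree _ ⟨⟨g 0, h.notMem' (by omega)⟩, ⟨g (i - 1), h.notMem' (by omega)⟩,
        ⟨g (i + 1), h.notMem' (by omega)⟩, fun e => ?_, fun e => ?_, fun e => ?_, ?_, ?_, ?_⟩
      · exact h.inj (by omega) (by omega) (by omega) (congrArg Subtype.val e)
      · exact h.inj (by omega) (by omega) (by omega) (congrArg Subtype.val e)
      · exact h.inj (by omega) (by omega) (by omega) (congrArg Subtype.val e)
      · exact Or.inr ⟨Sym2.eq_swap, hq⟩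
      · exact hold ((h.adj (by omega) (by omega)).2 (by omega)) (hne (by omega) (by omega))
          (hne (by omega) (by omega))
      · exact hold ((h.adj (by omega) (by omega)).2 (by omega)) (hne (by omega) (by omega))
          (hne (by omega) (by omega))
    have := κ.injective (Subtype.ext (hκi.trans hκs.symm))
    exact h.inj (by omega) (by omega) (ne_of_lt hi2) (congrArg Subtype.val this)
  · have hcut := isCut_induce (G := T.moveEdge (g 0) (g 1) (g 0) q) (S := Cᶜ)
      (A := g '' Set.Ico 1 s) (a := g (s - 1)) (b := g s) (h.notMem' (by omega)) hgs
      ⟨s - 1, ⟨by omega, by omega⟩, rfl⟩ (by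
        rintro ⟨j, hj, e⟩
        exact h.inj (lt_trans hj.2 (by omega)) (by omega) (ne_of_lt hj.2) e)
      (hold ((h.adj (by omega) (by omega)).2 (by omega)) (hne (by omega) (by omega))
        (hne (by omega) (by omega))) (by
        rintro _ ⟨a, ha, rfl⟩ y hy hyA hay
        have ha1 : 1 ≤ a := ha.1
        have ha2 : a < s := ha.2
        rcases hay with ⟨hay, hne'⟩ | ⟨hay, -⟩
        · rcases h.eq_or hy with rfl | ⟨j, hj, rfl⟩
          · exact absurd ((h.adj_iff a (by omega)).1 hay.symm) (by omega)
          · have hjs : ¬ (1 ≤ j ∧ j < s) := fun hjs => hyA ⟨j, hjs, rfl⟩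
            rw [h.adj (by omega) hj] at hay
            by_cases hj0 : j = 0
            · subst hj0
              have : a = 1 := by omega
              subst this
              exact absurd Sym2.eq_swap hne'
            · exact ⟨by congr 1; omega, by congr 1; omega⟩
        · rcases Sym2.eq_iff.1 hay with ⟨e, -⟩ | ⟨rfl, -⟩
          · exact absurd e (hne (by omega) ha1)
          · exact absurd ⟨a, ha, rfl⟩ hqU)
    -- Otherwise a leg of `s - 1` vertices is left. The available sizes are `1`, `s` and `m - 1 -
    -- s`, excluded by `3 ≤ s` and `m ≠ 2 * s`.
    have h1 := h.ncard_of_isCut hconn (hcut.map κ) hκs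
    rw [Set.ncard_image_of_injective _ κ.injective,
      ncard_preimage_val (h.image_Ico_subset (by omega)), h.ncard_image_Ico (by omega)] at h1
    omega

lemma nonempty_iso_of_bijective (h : IsSpiderOn T C d m s g) {n : ℕ} {X : SimpleGraph (Fin n)}
    (F : Fin n → V) (hF : ∀ i, F i ∉ C) (hinj : Function.Injective F) (hd : ∃ i, F i = d)
    (hg : ∀ i < m, ∃ j, F j = g i) (hadj : ∀ i j, T.Adj (F i) (F j) ↔ X.Adj i j) :
    Nonempty (T.induce Cᶜ ≃g X) := by
  refine ⟨RelIso.symm ⟨Equiv.ofBijective (fun i => (⟨F i, hF i⟩ : (Cᶜ : Set V)))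
    ⟨fun i j e => hinj (congrArg Subtype.val e), ?_⟩, fun {i j} => hadj i j⟩⟩
  rintro ⟨x, hx⟩
  rcases h.eq_or hx with rfl | ⟨i, hi, rfl⟩
  · obtain ⟨i, hi⟩ := hd
    exact ⟨i, Subtype.ext hi⟩
  · obtain ⟨j, hj⟩ := hg i hi
    exact ⟨j, Subtype.ext hj⟩

lemma nonempty_iso_treeS1 (h : IsSpiderOn T C d 4 2 g) : Nonempty (T.induce Cᶜ ≃g treeS1) := by
  have hg : ∀ {i j : ℕ}, i < 4 → j < 4 → (g i = g j ↔ i = j) := fun hi hj =>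
    ⟨h.isPathOn.inj _ hi _ hj, congrArg g⟩
  have hd : ∀ {i : ℕ}, i < 4 → g i ≠ d := h.ne
  have hd' : ∀ {i : ℕ}, i < 4 → d ≠ g i := fun hi => (h.ne hi).symm
  have hdg : ∀ {i : ℕ}, i < 4 → (T.Adj d (g i) ↔ i = 2) := fun {i} hi => h.adj_iff i hi
  have hgd : ∀ {i : ℕ}, i < 4 → (T.Adj (g i) d ↔ i = 2) := fun hi => (T.adj_comm _ _).trans (hdg hi)
  -- The legs at `g 2` are `d`, `g 3` and `g 1, g 0`; the list below follows the vertex labels of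
  -- `treeS1`.
  have hgg : ∀ {i j : ℕ}, i < 4 → j < 4 → (T.Adj (g i) (g j) ↔ i + 1 = j ∨ j + 1 = i) := h.adj
  refine h.nonempty_iso_of_bijective ![g 2, d, g 3, g 1, g 0] ?_ ?_ ⟨1, rfl⟩ ?_ ?_
  · intro i
    fin_cases i
    exacts [h.notMem' (by omega), h.notMem, h.notMem' (by omega), h.notMem' (by omega),
      h.notMem' (by omega)]
  · intro i j
    fin_cases i <;> fin_cases j <;> simp [hg, hd, hd']
  · intro i hi
    interval_cases i
    exacts [⟨4, rfl⟩, ⟨3, rfl⟩, ⟨0, rfl⟩, ⟨2, rfl⟩]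
  · intro i j
    fin_cases i <;> fin_cases j <;> simp [treeS1, hdg, hgd, hgg]

lemma nonempty_iso_treeS2 (h : IsSpiderOn T C d 6 3 g) : Nonempty (T.induce Cᶜ ≃g treeS2) := by
  have hg : ∀ {i j : ℕ}, i < 6 → j < 6 → (g i = g j ↔ i = j) := fun hi hj =>
    ⟨h.isPathOn.inj _ hi _ hj, congrArg g⟩
  have hd : ∀ {i : ℕ}, i < 6 → g i ≠ d := h.ne
  have hd' : ∀ {i : ℕ}, i < 6 → d ≠ g i := fun hi => (h.ne hi).symm
  have hdg : ∀ {i : ℕ}, i < 6 → (T.Adj d (g i) ↔ i = 3) := fun {i} hi => h.adj_iff i hi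
  have hgd : ∀ {i : ℕ}, i < 6 → (T.Adj (g i) d ↔ i = 3) := fun hi => (T.adj_comm _ _).trans (hdg hi)
  have hgg : ∀ {i j : ℕ}, i < 6 → j < 6 → (T.Adj (g i) (g j) ↔ i + 1 = j ∨ j + 1 = i) := h.adj
  refine h.nonempty_iso_of_bijective ![g 3, d, g 4, g 5, g 2, g 1, g 0] ?_ ?_ ⟨1, rfl⟩ ?_ ?_
  · intro i
    fin_cases i
    exacts [h.notMem' (by omega), h.notMem, h.notMem' (by omega), h.notMem' (by omega),
      h.notMem' (by omega), h.notMem' (by omega), h.notMem' (by omega)]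
  · intro i j
    fin_cases i <;> fin_cases j <;> simp [hg, hd, hd']
  · intro i hi
    interval_cases i
    exacts [⟨6, rfl⟩, ⟨5, rfl⟩, ⟨4, rfl⟩, ⟨0, rfl⟩, ⟨2, rfl⟩, ⟨3, rfl⟩]
  · intro i j
    fin_cases i <;> fin_cases j <;> simp [treeS2, hdg, hgd, hgg]

end IsSpiderOn

end Spider

/-! ### Assembling the cases. -/

section Main

variable {V : Type u} {T : SimpleGraph V} {C : Set V} {c d : V}

namespace IsSpiderOn

variable {m s : ℕ} {g : ℕ → V}

lemma adj_zero_iff (h : IsSpiderOn T C d m s g) (hC : IsCut T C c d) (x : V) :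
    T.Adj (g 0) x ↔ x = g 1 := by
  have hs1 := h.pos
  have hs2 := h.lt
  have h0 : g 0 ∉ C := h.notMem' (by omega)
  constructor
  · intro h0x
    have hxC : x ∉ C := fun hxC => h.ne (i := 0) (by omega) (hC.unique hxC h0 h0x.symm).2
    rcases h.eq_or hxC with rfl | ⟨j, hj, rfl⟩
    · exact absurd ((h.adj_iff 0 (by omega)).1 h0x.symm) (by omega)
    · rw [h.adj (by omega) hj] at h0x
      congr 1
      omega
  · rintro rfl
    exact (h.adj (by omega) (by omega)).2 (Or.inl rfl)

lemma hasThreeNeighborsIn (h : IsSpiderOn T C d m s g) : T.HasThreeNeighborsIn Cᶜ (g s) := by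
  have hs1 := h.pos
  have hs2 := h.lt
  exact ⟨d, h.notMem, g (s - 1), h.notMem' (by omega), g (s + 1), h.notMem' (by omega),
    (h.ne (by omega)).symm, (h.ne (by omega)).symm, h.inj (by omega) (by omega) (by omega),
    ((h.adj_iff s (by omega)).2 rfl).symm, (h.adj (by omega) (by omega)).2 (by omega),
    (h.adj (by omega) (by omega)).2 (by omega)⟩

lemma adj_left_iff (h : IsSpiderOn T C d m s g) (hC : IsCut T C c d) (x : V) :
    T.Adj d x ↔ x = c ∨ x = g s := by
  have hs2 := h.lt
  constructor
  · intro hdx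
    by_cases hxC : x ∈ C
    · exact Or.inl (hC.unique hxC hC.right_notMem hdx.symm).1
    · rcases h.eq_or hxC with rfl | ⟨j, hj, rfl⟩
      · exact absurd rfl hdx.ne
      · exact Or.inr (by rw [(h.adj_iff j hj).1 hdx])
  · rintro (rfl | rfl)
    exacts [hC.adj.symm, (h.adj_iff s (by omega)).2 rfl]

lemma ern_le_two_of_leg [Finite V] (h : IsSpiderOn T C d m s g) (hT : T.IsTree)
    (hC : IsCut T C c d) (hcard : C.ncard = Cᶜ.ncard)
    (hdeg : ∀ v ∈ C, ¬ T.HasThreeNeighborsIn C v)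
    (htwo : ∃ x ∈ C, ∃ y ∈ C, x ≠ y ∧ T.Adj c x ∧ T.Adj c y) (hs : 3 ≤ s) (hms : m ≠ 2 * s) :
    T.ern ≤ 2 := by
  obtain ⟨c₁, h₁, c₂, h₂, h₁₂, hc₁, hc₂⟩ := htwo
  have hs2 := h.lt
  exact ern_le_two_of_leaf hT hC hcard hdeg (h.notMem' (by omega)) h.hasThreeNeighborsIn h₁ h₂ h₁₂
    hc₁ hc₂ (h.notMem' (by omega)) (h.ne (by omega)) (h.adj_zero_iff hC) fun q hq hq0 κ =>
      h.eq_of_moveEdge_iso (hC.compl.isTree_induce hT).1.preconnected hs hms hq hq0 κ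

/-- The spider with legs of one, two and two vertices, when the centroidal edge is next to an end of
the path. -/
lemma ern_le_two_of_one [Finite V] (h : IsSpiderOn T C d 5 2 g) (hT : T.IsTree) {f : ℕ → V}
    (hf : IsPathOn T C 6 f) (hC : IsCut T C (f 1) d) (hcard : C.ncard = Cᶜ.ncard) :
    T.ern ≤ 2 := by
  have hdC := hC.right_notMem
  refine ern_le_two_of_degree_two hT hC hcard (h.notMem' (i := 2) (by omega))
    (h.adj_left_iff hC) hf.not_hasThreeNeighborsIn (Or.inr fun z hz => ⟨fun κ => ?_⟩)
  have hκ : ∀ x y : (Cᶜ : Set V), T.Adj (κ x) (κ y) ↔ T.Adj x y := fun x y => κ.map_adj_iff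
  have hmem : ∀ x, (κ x : V) = d ∨ (κ x : V) ∈ C := fun x => (κ x).2.1
  have hd : ∀ x, T.Adj d (κ x) → (κ x : V) = f 1 := fun x hdx =>
    (hC.unique ((hmem x).resolve_left hdx.ne.symm) hdC hdx.symm).1
  have hi : ∀ i < 6, ∀ x, T.Adj (f i) (κ x) →
      (i = 1 ∧ (κ x : V) = d) ∨ ∃ a < 6, f a = κ x ∧ (i + 1 = a ∨ a + 1 = i) := by
    intro i hi x hix
    rcases hmem x with hx | hx
    · left
      rw [hx] at hix
      exact ⟨hf.inj _ hi _ (by omega) (hC.unique (hf.mem i hi) hdC hix).1, hx⟩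
    · right
      obtain ⟨a, ha, hax⟩ := hf.surj _ hx
      rw [← hax, hf.adj _ hi _ ha] at hix
      exact ⟨a, ha, hax, hix⟩
  let x (i : ℕ) (hi : i < 5) : (Cᶜ : Set V) := ⟨g i, h.notMem' hi⟩
  have hx : ∀ i (hi : i < 5) j (hj : j < 5), i ≠ j → (κ (x i hi) : V) ≠ κ (x j hj) :=
    fun i hi j hj hij e => h.inj hi hj hij (congrArg Subtype.val (κ.injective (Subtype.ext e)))
  have hadj : ∀ i (hi : i < 5) j (hj : j < 5), (i + 1 = j ∨ j + 1 = i) →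
      T.Adj (κ (x i hi)) (κ (x j hj)) := fun i hi j hj hij => (hκ _ _).2 ((h.adj hi hj).2 hij)
  have h21 := hadj 2 (by omega) 1 (by omega) (by omega)
  have h23 := hadj 2 (by omega) 3 (by omega) (by omega)
  have h13 := hx 1 (by omega) 3 (by omega) (by omega)
  have hd2 : T.Adj (κ (x 2 (by omega))) (κ ⟨d, hdC⟩) :=
    (hκ _ _).2 ((h.adj_iff 2 (by omega)).2 rfl).symm
  have hdx : ∀ i (hi : i < 5), (κ (x i hi) : V) ≠ κ ⟨d, hdC⟩ :=
    fun i hi e => h.ne hi (congrArg Subtype.val (κ.injective (Subtype.ext e)))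
  -- In `C + d` only `f 1` branches, so it is the image of the centre `g 2`. Its neighbours `f 0`
  -- and `d` are ends, so both legs of two vertices would have to start at `f 2`.
  have h2 : (κ (x 2 (by omega)) : V) = f 1 := by
    rcases hmem (x 2 (by omega)) with h2 | h2
    · rw [h2] at h21 h23
      exact absurd ((hd _ h21).trans (hd _ h23).symm) h13
    · obtain ⟨i, hi6, hi2⟩ := hf.surj _ h2
      by_cases hi1 : i = 1
      · rw [← hi2, hi1]
      · exfalso
        rw [← hi2] at h21 h23 hd2
        obtain ⟨a, -, ha, ha'⟩ := (hi i hi6 _ h21).resolve_left (fun e => hi1 e.1)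
        obtain ⟨b, -, hb, hb'⟩ := (hi i hi6 _ h23).resolve_left (fun e => hi1 e.1)
        obtain ⟨e, -, he, he'⟩ := (hi i hi6 _ hd2).resolve_left (fun e => hi1 e.1)
        have h1 : a ≠ b := fun e => h13 (by rw [← ha, ← hb, e])
        have h3 : a ≠ e := fun e' => hdx 1 (by omega) (by rw [← ha, ← he, e'])
        have h4 : b ≠ e := fun e' => hdx 3 (by omega) (by rw [← hb, ← he, e'])
        omega
  have key : ∀ i (hi : i < 5) j (hj : j < 5), T.Adj (κ (x 2 (by omega))) (κ (x i hi)) →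
      (i + 1 = j ∨ j + 1 = i) → j ≠ 2 → (κ (x i hi) : V) = f 2 := by
    intro i hi5 j hj5 h2i hij hj2
    have hj1 : (κ (x j hj5) : V) ≠ f 1 := h2 ▸ hx j hj5 2 (by omega) hj2
    have hij' := hadj i hi5 j hj5 hij
    rw [h2] at h2i
    rcases hi 1 (by omega) _ h2i with ⟨-, e⟩ | ⟨a, ha, hai, ha'⟩
    · rw [e] at hij'
      exact absurd (hd _ hij') hj1
    · have ha2 : a = 0 ∨ a = 2 := by omega
      rcases ha2 with rfl | rfl
      · rw [← hai] at hij'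
        rcases hi 0 (by omega) _ hij' with ⟨e, -⟩ | ⟨b, hb, hbj, hb'⟩
        · omega
        · obtain rfl : b = 1 := by omega
          exact absurd hbj.symm hj1
      · exact hai.symm
  exact h13 ((key 1 (by omega) 0 (by omega) h21 (by omega) (by omega)).trans
    (key 3 (by omega) 4 (by omega) h23 (by omega) (by omega)).symm)

/-- The spider with legs of one, two and two vertices, when the centroidal edge is in the middle of
the path. -/
lemma ern_le_two_of_three [Finite V] (h : IsSpiderOn T C d 5 2 g) (hT : T.IsTree) {f : ℕ → V}
    (hf : IsPathOn T C 6 f) (hC : IsCut T C (f 3) d) (hcard : C.ncard = Cᶜ.ncard) :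
    T.ern ≤ 2 := by
  have hcJ : f 3 ∉ ({f (6 - 2), f (6 - 1)} : Set V) :=
    ((hf.mem_sdiff_pair (by omega) (by omega)).2 (by omega)).2
  have hadj : ∀ {i j : ℕ}, i < 6 → j < 6 → (i + 1 = j ∨ j + 1 = i) → T.Adj (f i) (f j) :=
    fun hi hj hij => (hf.adj _ hi _ hj).2 hij
  have hne : ∀ {i j : ℕ}, i < 6 → j < 6 → i ≠ j → f i ≠ f j :=
    fun hi hj hij e => hij (hf.inj _ hi _ hj e)
  refine ern_le_two_of_one_neighbor hT hC hcard (hf.pair_subset (by omega)) hcJ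
    (hf.ncard_pair (by omega)) (hf.isCut_pair (by omega) hC hcJ) (hf.adj_pair (by omega))
    (l := g 0) (o := g 2) (u := g 1) (v := g 3)
    (h.notMem' (by omega)) (h.ne (by omega)) (h.adj_zero_iff hC)
    hf.not_hasThreeNeighborsIn (h.notMem' (by omega)) ((h.adj_left_iff hC _).2 (Or.inr rfl)) ?_
    (h.notMem' (by omega)) (h.notMem' (by omega)) (h.inj (by omega) (by omega) (by omega))
    (h.ne (by omega)) (h.ne (by omega)) ((h.adj (by omega) (by omega)).2 (by omega))
    ((h.adj (by omega) (by omega)).2 (by omega)) (h.inj (by omega) (by omega) (by omega))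
    (h.inj (by omega) (by omega) (by omega)) (h.inj (by omega) (by omega) (by omega))
    ⟨f 2, hf.mem _ (by omega), f 4, hf.mem _ (by omega), hne (by omega) (by omega) (by omega),
      hadj (by omega) (by omega) (by omega), hadj (by omega) (by omega) (by omega)⟩ ?_ ?_
  · intro x hx hdx
    exact ((h.adj_left_iff hC x).1 hdx).resolve_left fun e => hx (e ▸ hC.left_mem)
  · intro x hx hcx
    obtain ⟨i, hi, rfl⟩ := hf.surj x hx
    rw [hf.adj _ (by omega) _ hi] at hcx
    have : i = 2 ∨ i = 4 := by omega
    rcases this with rfl | rfl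
    · exact ⟨f 1, hf.mem _ (by omega), hne (by omega) (by omega) (by omega),
        hadj (by omega) (by omega) (by omega)⟩
    · exact ⟨f 5, hf.mem _ (by omega), hne (by omega) (by omega) (by omega),
        hadj (by omega) (by omega) (by omega)⟩
  · have key : ∀ x ∈ C \ ({f (6 - 2), f (6 - 1)} : Set V), T.Adj (f 3) x → x = f 2 := by
      intro x hx hcx
      obtain ⟨i, hi, rfl⟩ := hf.surj x hx.1
      rw [hf.mem_sdiff_pair (by omega) hi] at hx
      rw [hf.adj _ (by omega) _ hi] at hcx
      congr 1
      omega
    exact fun x hx y hy hcx hcy => (key x hx hcx).trans (key y hy hcy).symm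

/-- The legs have 1, `s` and `m - 1 - s` vertices. Shortening either of the last two settles
everything except the legs 1, 2, 3 and 1, 1, 2, which are pseudopaths, and 1, 2, 2. -/
lemma ern_le_two [Finite V] (h : IsSpiderOn T C d m s g) (hT : T.IsTree) {f : ℕ → V}
    (hf : IsPathOn T C (m + 1) f) (hC : IsCut T C c d) (hcard : C.ncard = Cᶜ.ncard) (hm : 4 ≤ m)
    (htwo : ∃ x ∈ C, ∃ y ∈ C, x ≠ y ∧ T.Adj c x ∧ T.Adj c y)
    (hD : ¬ (T.induce Cᶜ).IsPseudopath) : T.ern ≤ 2 := by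
  have hs1 := h.pos
  have hs2 := h.lt
  have hdeg := hf.not_hasThreeNeighborsIn
  by_cases hA : 3 ≤ s ∧ m ≠ 2 * s
  · exact h.ern_le_two_of_leg hT hC hcard hdeg htwo hA.1 hA.2
  by_cases hB : 3 ≤ m - 1 - s ∧ m ≠ 2 * (m - 1 - s)
  · exact h.reverse.ern_le_two_of_leg hT hC hcard hdeg htwo hB.1 hB.2
  have hcases : (m = 6 ∧ s = 3) ∨ (m = 6 ∧ s = 2) ∨ (m = 4 ∧ s = 2) ∨ (m = 4 ∧ s = 1) ∨
      (m = 5 ∧ s = 2) := by omega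
  rcases hcases with ⟨rfl, rfl⟩ | ⟨rfl, rfl⟩ | ⟨rfl, rfl⟩ | ⟨rfl, rfl⟩ | ⟨rfl, rfl⟩
  · exact absurd (Or.inr (Or.inr h.nonempty_iso_treeS2)) hD
  · exact absurd (Or.inr (Or.inr h.reverse.nonempty_iso_treeS2)) hD
  · exact absurd (Or.inr (Or.inl h.nonempty_iso_treeS1)) hD
  · exact absurd (Or.inr (Or.inl h.reverse.nonempty_iso_treeS1)) hD
  · obtain ⟨f, hf, t, ht, rfl⟩ := hf.exists_two_mul_lt hC.left_mem
    -- The value `0` would make `c` an end of the path; for `2` the path is reversed, so that `c`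
    -- becomes `f 3` and the last two vertices are next to it.
    have ht3 : t = 0 ∨ t = 1 ∨ t = 2 := by omega
    rcases ht3 with rfl | rfl | rfl
    · obtain ⟨x, hx, y, hy, hxy, h1, h2⟩ := htwo
      obtain ⟨i, hi, rfl⟩ := hf.surj x hx
      obtain ⟨j, hj, rfl⟩ := hf.surj y hy
      rw [hf.adj _ (by omega) _ hi] at h1
      rw [hf.adj _ (by omega) _ hj] at h2
      exact absurd (congrArg f (by omega)) hxy
    · exact h.ern_le_two_of_one hT hf hC hcard
    · exact h.ern_le_two_of_three hT hf.reverse hC hcard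

end IsSpiderOn

lemma exists_hasThreeNeighborsIn [Finite V] {S : Set V} (hS : (T.induce S).IsTree)
    (hpath : ∀ k, IsEmpty (T.induce S ≃g pathGraph k)) : ∃ o ∈ S, T.HasThreeNeighborsIn S o := by
  by_contra! hcon
  obtain ⟨e⟩ := IsTree.nonempty_iso_pathGraph _ hS rfl fun v x y z h1 h2 h3 => by
    by_contra! hne
    exact hcon v v.2 ⟨x, x.2, y, y.2, z, z.2, fun e => hne.1 (Subtype.ext e),
      fun e => hne.2.1 (Subtype.ext e), fun e => hne.2.2 (Subtype.ext e), h1, h2, h3⟩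
  exact (hpath _).elim e

lemma IsCut.exists_adj_iff_of_not_two (hC : IsCut T C c d) (hT : T.IsTree) {o : V} (hoC : o ∉ C)
    (ho : T.HasThreeNeighborsIn Cᶜ o)
    (htwo : ¬ ∃ x ∉ C, ∃ y ∉ C, x ≠ y ∧ T.Adj d x ∧ T.Adj d y) :
    ∃ u ∉ C, ∀ x, T.Adj d x ↔ x = c ∨ x = u := by
  have hdC := hC.right_notMem
  have hod : o ≠ d := by
    rintro rfl
    obtain ⟨x, hx, y, hy, z, hz, hxy, -, -, h1, h2, -⟩ := ho
    exact htwo ⟨x, hx, y, hy, hxy, h1, h2⟩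
  obtain ⟨x, hx, u, hu, -, hdu⟩ := hC.compl.exists_adj_inside hT.1.preconnected (S := {d})
    (Set.singleton_subset_iff.2 hdC) rfl hoC hod
  rw [Set.mem_singleton_iff.1 hx] at hdu
  refine ⟨u, hu, fun y => ⟨fun hdy => ?_, ?_⟩⟩
  · by_cases hy : y ∈ C
    · exact Or.inl (hC.unique hy hdC hdy.symm).1
    · right
      by_contra hyu
      exact htwo ⟨y, hy, u, hu, hyu, hdy, hdu⟩
  · rintro (rfl | rfl)
    exacts [hC.adj.symm, hdu]

/-- Without branching, `D - d` is a path. The branching of `D` disappears with `d`, so it sits at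
the neighbour `u` of `d`, which keeps two neighbours and is therefore inner in the path. -/
lemma IsCut.exists_isSpiderOn [Finite V] (hC : IsCut T C c d) (hT : T.IsTree) {u o : V}
    (huC : u ∉ C) (hd : ∀ x, T.Adj d x ↔ x = c ∨ x = u) (hoC : o ∉ C)
    (ho : T.HasThreeNeighborsIn Cᶜ o)
    (hdeg : ∀ v ∈ Cᶜ \ {d}, ¬ T.HasThreeNeighborsIn (Cᶜ \ {d}) v) :
    ∃ s g, IsSpiderOn T C d (Cᶜ \ {d}).ncard s g := by
  have hdC := hC.right_notMem
  have hB := hC.compl_sdiff_singleton huC hd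
  have hcC := hC.left_mem
  obtain ⟨e⟩ := IsTree.nonempty_iso_pathGraph _ (hB.isTree_induce hT) rfl
    fun v x y z h1 h2 h3 => by
      by_contra! hne
      exact hdeg v v.2 ⟨x, x.2, y, y.2, z, z.2, fun e => hne.1 (Subtype.ext e),
        fun e => hne.2.1 (Subtype.ext e), fun e => hne.2.2 (Subtype.ext e), h1, h2, h3⟩
  have : Nonempty V := ⟨c⟩
  obtain ⟨g, hg⟩ := exists_isPathOn e
  rw [Nat.card_coe_set_eq] at hg
  obtain ⟨s, hs, rfl⟩ := hg.surj u hB.left_mem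
  have hod : o ≠ d := by
    rintro rfl
    obtain ⟨x, hx, y, hy, z, hz, hxy, -, -, h1, h2, -⟩ := ho
    have key : ∀ x ∉ C, T.Adj o x → x = g s := fun x hx hox =>
      ((hd x).1 hox).resolve_left fun e => hx (e ▸ hcC)
    exact hxy ((key x hx h1).trans (key y hy h2).symm)
  have hos : o = g s := by
    by_contra hos
    obtain ⟨x, hx, y, hy, z, hz, hxy, hxz, hyz, h1, h2, h3⟩ := ho
    have key : ∀ x ∉ C, T.Adj o x → x ∈ Cᶜ \ {d} := by
      intro x hx hox
      refine ⟨hx, ?_⟩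
      rintro rfl
      rcases (hd o).1 hox.symm with rfl | h
      exacts [hoC hcC, hos h]
    exact hdeg o ⟨hoC, hod⟩
      ⟨x, key x hx h1, y, key y hy h2, z, key z hz h3, hxy, hxz, hyz, h1, h2, h3⟩
  subst hos
  have key : ∀ x ∉ C, x ≠ d → T.Adj (g s) x →
      ∃ i < (Cᶜ \ {d}).ncard, g i = x ∧ (s + 1 = i ∨ i + 1 = s) := by
    intro x hx hxd hsx
    obtain ⟨i, hi, rfl⟩ := hg.surj x ⟨hx, hxd⟩
    exact ⟨i, hi, rfl, (hg.adj _ hs _ hi).1 hsx⟩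
  have htwo : ∃ x ∉ C, ∃ y ∉ C, x ≠ y ∧ x ≠ d ∧ y ≠ d ∧ T.Adj (g s) x ∧ T.Adj (g s) y := by
    obtain ⟨x, hx, y, hy, z, hz, hxy, hxz, hyz, h1, h2, h3⟩ := ho
    by_cases hxd : x = d
    · exact ⟨y, hy, z, hz, hyz, fun e => hxy (hxd.trans e.symm), fun e => hxz (hxd.trans e.symm),
        h2, h3⟩
    · by_cases hyd : y = d
      · exact ⟨x, hx, z, hz, hxz, hxd, fun e => hyz (hyd.trans e.symm), h1, h3⟩
      · exact ⟨x, hx, y, hy, hxy, hxd, hyd, h1, h2⟩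
  obtain ⟨x, hx, y, hy, hxy, hxd, hyd, h1, h2⟩ := htwo
  obtain ⟨i, hi, rfl, h1⟩ := key x hx hxd h1
  obtain ⟨j, hj, rfl, h2⟩ := key y hy hyd h2
  have hij : i ≠ j := fun e => hxy (congrArg g e)
  refine ⟨s, g, hg, by omega, by omega, hdC, fun i hi => ?_⟩
  rw [hd]
  constructor
  · rintro (h | h)
    · exact absurd (h ▸ hcC) (hg.mem i hi).1
    · exact hg.inj _ hi _ hs h
  · rintro rfl
    exact Or.inr rfl

/-- A tree with a bridge `cd` separating it into a path and a tree with the same number of vertices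
which is not a pseudopath has edge-reconstruction number two. -/
theorem ern_eq_two [Finite V] (hT : T.IsTree) (hC : IsCut T C c d) (hcard : C.ncard = Cᶜ.ncard)
    {k : ℕ} (hpath : Nonempty (T.induce C ≃g pathGraph k))
    (hD : ¬ (T.induce Cᶜ).IsPseudopath) : T.ern = 2 := by
  have hdC := hC.right_notMem
  have hDtree := hC.compl.isTree_induce hT
  have : Nonempty V := ⟨c⟩
  obtain ⟨f, hf⟩ := hpath.elim exists_isPathOn
  have hdeg := hf.not_hasThreeNeighborsIn
  have hk := hf.ncard_eq
  obtain ⟨o, hoC, ho⟩ := exists_hasThreeNeighborsIn hDtree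
    fun n => ⟨fun e => hD (Or.inl ⟨n, ⟨e⟩⟩)⟩
  have hk4 : 4 ≤ k := by
    obtain ⟨x, hx, y, hy, z, hz, hxy, hxz, hyz, h1, h2, h3⟩ := ho
    have := List.Nodup.length_le_ncard (L := [o, x, y, z])
      (by simp [h1.ne, h2.ne, h3.ne, hxy, hxz, hyz]) (A := Cᶜ) (by
      intro w hw
      simp only [List.mem_cons, List.not_mem_nil, or_false] at hw
      rcases hw with rfl | rfl | rfl | rfl <;> assumption)
    simp only [List.length_cons, List.length_nil] at this
    omega
  have hV := Set.ncard_add_ncard_compl C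
  refine le_antisymm ?_ (hT.two_le_ern (by omega))
  by_cases hnon : ∃ x ∈ C, ∃ y ∈ C, x ≠ y ∧ T.Adj c x ∧ T.Adj c y
  · by_cases hk5 : k = 4
    · obtain ⟨c₁, h₁, c₂, h₂, h₁₂, hc₁, hc₂⟩ := hnon
      exact ern_le_two_of_ncard_eq_four hT hC hcard (hk.trans hk5) hdeg h₁ h₂ h₁₂ hc₁ hc₂ hoC ho
    by_cases htwo : ∃ x ∉ C, ∃ y ∉ C, x ≠ y ∧ T.Adj d x ∧ T.Adj d y
    · exact hf.ern_le_two_of_two_neighbors hT hC hcard hk4 (fun _ => by omega) hoC ho htwo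
    obtain ⟨u, huC, hd⟩ := hC.exists_adj_iff_of_not_two hT hoC ho htwo
    by_cases hv : ∃ v, v ∉ C ∧ v ≠ d ∧ T.HasThreeNeighborsIn (Cᶜ \ {d}) v
    · exact ern_le_two_of_degree_two hT hC hcard huC hd hdeg (Or.inl hv)
    have hBcard : (Cᶜ \ {d}).ncard + 1 = Cᶜ.ncard := Set.ncard_sdiff_singleton_add_one hdC
    obtain ⟨s, g, h⟩ := hC.exists_isSpiderOn hT huC hd hoC ho fun v hv' h =>
      hv ⟨v, hv'.1, hv'.2, h⟩
    have hmk : (Cᶜ \ {d}).ncard + 1 = k := by omega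
    exact h.ern_le_two hT (by rwa [hmk]) hC hcard (by omega) hnon hD
  · by_cases htwo : ∃ x ∉ C, ∃ y ∉ C, x ≠ y ∧ T.Adj d x ∧ T.Adj d y
    · exact hf.ern_le_two_of_two_neighbors hT hC hcard hk4 (fun h => absurd h hnon) hoC ho htwo
    obtain ⟨u, huC, hd⟩ := hC.exists_adj_iff_of_not_two hT hoC ho htwo
    -- Now `c` is an end of `C`, so `C + d` is a path and cannot contain a copy of `D`, which
    -- branches at `o`.
    refine ern_le_two_of_degree_two hT hC hcard huC hd hdeg (Or.inr fun z _ => ⟨fun κ => ?_⟩)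
    obtain ⟨x, hx, y, hy, w, hw, hxy, hxw, hyw, h1, h2, h3⟩ := ho
    have hκ : ∀ x y : (Cᶜ : Set V), T.Adj (κ x) (κ y) ↔ T.Adj x y := fun x y => κ.map_adj_iff
    have hne : ∀ x y : (Cᶜ : Set V), (x : V) ≠ y → (κ x : V) ≠ κ y := fun x y h e =>
      h (congrArg Subtype.val (κ.injective (Subtype.ext e)))
    have hκd : ∀ x y : (Cᶜ : Set V), (κ x : V) = d → T.Adj x y → (κ y : V) = c := by
      intro x y hx hxy
      rw [← hκ, hx] at hxy
      have hyC : (κ y : V) ∈ C := (κ y).2.1.resolve_left hxy.ne.symm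
      exact (hC.unique hyC hdC hxy.symm).1
    have hoC' : (κ ⟨o, hoC⟩ : V) ∈ C := by
      refine (κ ⟨o, hoC⟩).2.1.resolve_left fun e => ?_
      exact hne ⟨x, hx⟩ ⟨y, hy⟩ hxy ((hκd ⟨o, hoC⟩ ⟨x, hx⟩ e h1).trans
        (hκd ⟨o, hoC⟩ ⟨y, hy⟩ e h2).symm)
    have hpair : ∀ x y : (Cᶜ : Set V), (x : V) ≠ y → T.Adj o x → T.Adj o y →
        (κ ⟨o, hoC⟩ : V) = c → (κ x : V) = d ∨ (κ y : V) = d := by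
      intro x y hxy hox hoy hoc
      by_contra! hcon
      refine hnon ⟨κ x, (κ x).2.1.resolve_left hcon.1, κ y, (κ y).2.1.resolve_left hcon.2,
        hne x y hxy, hoc ▸ (hκ ⟨o, hoC⟩ x).2 hox, hoc ▸ (hκ ⟨o, hoC⟩ y).2 hoy⟩
    by_cases hoc : (κ ⟨o, hoC⟩ : V) = c
    · have e1 := hpair ⟨x, hx⟩ ⟨y, hy⟩ hxy h1 h2 hoc
      have e2 := hpair ⟨x, hx⟩ ⟨w, hw⟩ hxw h1 h3 hoc
      have e3 := hpair ⟨y, hy⟩ ⟨w, hw⟩ hyw h2 h3 hoc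
      have n1 := hne ⟨x, hx⟩ ⟨y, hy⟩ hxy
      have n2 := hne ⟨x, hx⟩ ⟨w, hw⟩ hxw
      have n3 := hne ⟨y, hy⟩ ⟨w, hw⟩ hyw
      grind
    · have hin : ∀ x : (Cᶜ : Set V), T.Adj o x → (κ x : V) ∈ C := fun x hox =>
        (κ x).2.1.resolve_left fun e => hoc (hC.unique hoC' (fun h => hdC (e ▸ h))
          ((hκ ⟨o, hoC⟩ x).2 hox)).1
      exact hdeg _ hoC' ⟨_, hin ⟨x, hx⟩ h1, _, hin ⟨y, hy⟩ h2, _, hin ⟨w, hw⟩ h3,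
        hne ⟨x, hx⟩ ⟨y, hy⟩ hxy, hne ⟨x, hx⟩ ⟨w, hw⟩ hxw, hne ⟨y, hy⟩ ⟨w, hw⟩ hyw,
        (hκ ⟨o, hoC⟩ ⟨x, hx⟩).2 h1, (hκ ⟨o, hoC⟩ ⟨y, hy⟩).2 h2, (hκ ⟨o, hoC⟩ ⟨w, hw⟩).2 h3⟩

lemma IsCut.induce_deleteEdges {A S : Set V} (h : IsCut T A c d) (hS : S = A ∨ S = Aᶜ) :
    (T.deleteEdges {s(c, d)}).induce S = T.induce S := by
  ext ⟨x, hx⟩ ⟨y, hy⟩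
  change (T.deleteEdges {s(c, d)}).Adj x y ↔ T.Adj x y
  rw [deleteEdges_adj, Set.mem_singleton_iff]
  refine and_iff_left fun e => ?_
  have h1 := h.left_mem
  have h2 := h.right_notMem
  rcases Sym2.eq_iff.1 e with ⟨rfl, rfl⟩ | ⟨rfl, rfl⟩ <;> rcases hS with rfl | rfl
  exacts [h2 hy, hx h1, h2 hx, hy h1]

end Main

end SimpleGraph

theorem mainTheorem8 {V : Type u} [Finite V] (T : SimpleGraph V) (hT : T.IsBicentroidal)
    (e : Sym2 V) (he : T.IsCentroidalEdge e)
    (C D : (T.deleteEdges {e}).ConnectedComponent) (hCD : C ≠ D)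
    (k : ℕ) (hC : Nonempty (C.toSimpleGraph ≃g SimpleGraph.pathGraph k))
    (hD : ¬ D.toSimpleGraph.IsPseudopath) :
    T.ern = 2 := by
  obtain ⟨c, d, rfl, hcut, hsupp⟩ := hT.1.exists_isCut_of_components he.1 hCD
  -- Both ends have minimum weight; this is all that is used of the centroid.
  have hw : T.weight c = T.weight d := le_antisymm (he.2 c (Sym2.mem_mk_left c d) d)
    (he.2 d (Sym2.mem_mk_right c d) c)
  refine SimpleGraph.ern_eq_two hT.1 hcut (hcut.ncard_eq_ncard_compl hT.1.1.preconnected hw)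
    (k := k) ?_ ?_
  · rw [← hcut.induce_deleteEdges (Or.inl rfl)]
    exact hC
  · rw [← hsupp, ← hcut.induce_deleteEdges (Or.inr hsupp)]
    exact hD
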